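/- Let $R=[0,1]^2$ and $n\ge 0$. Let $\mathcal G_n$ be the set of isotopy classes (rel $\partial R$) of finite tame graphs $G$ embedded in $R$ that meet $\partial R$ exactly in $n$ fixed points at the top and $n$ fixed points at the bottom (multiple edges, loops, isolated vertices and vertexless simple closed curves, which count as loops, are allowed). An edge is inner if it has no end on $\partial R$. Let $\mathcal F_n$ be the free $\mathbb C[Q]$-module on $\mathcal G_n$, an algebra under vertical stacking, and let the chromatic algebra $\mathcal C_n$ be the quotient of $\mathcal F_n$ by the two-sided ideal generated by the relations (1) $G=G/e-G\backslash e$, if $e$ is an inner edge of $G$ that is not a loop; (2) $G=(Q-1)\,G\backslash e$, if $e$ is an inner edge of $G$ that is a loop; (3) $G=0$, if $G$ has a $1$-valent vertex in the interior of $R$. The dual graph $\widehat G$ is the multigraph whose vertices are the connected components of $R\setminus G$ and which has one edge $\hat e$ for every edge $e$ of $G$, joining the regions adjacent to $e$ (a loop, if the same region lies on both sides). The chromatic polynomial of a finite multigraph $\Gamma$ is $\chi_\Gamma(Q)=\sum_{S\subseteq E(\Gamma)}(-1)^{|S|}Q^{k(S)}$, where $k(S)$ is the number of connected components of $(V(\Gamma),S)$.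 The closure $\overline G\subset\mathbb R^2$ is obtained from $G$ by joining, for each $i$, the $i$-th top point to the $i$-th bottom point by disjoint arcs in the complement of $R$ (the nested arcs around the right-hand side of $R$), and $\widehat{\overline G}$ is its dual graph, whose vertices are the components of $\mathbb R^2\setminus\overline G$. **Proposition.** For every $n$, the graphs $\widehat G$ and $\widehat{\overline G}$ are finite, and: (a) There is a unique $\mathbb C[Q]$-linear map $\chi:\mathcal C_n\to\mathbb C[Q]$ with $\chi(G)=\chi_{\widehat G}(Q)$ for every graph $G$ in the rectangle. (b) If $e$ is an inner edge of $G$ that is not a loop, then $\widehat{G/e}\cong\widehat G\backslash\hat e$ and $\widehat{G\backslash e}\cong\widehat G/\hat e$ (where contracting a loop means deleting it), and $\chi_{\widehat G}=\chi_{\widehat{G/e}}-\chi_{\widehat{G\backslash e}}$. (c) If $e$ is an inner edge of $G$ that is a loop, then $\chi_{\widehat G}=(Q-1)\,\chi_{\widehat{G\backslash e}}$. If moreover $D$ is a component of $R\setminus G$ with $\overline D\subseteq D\cup\overline e$, then $D$ is a pendant ($1$-valent) vertex of $\widehat G$, its only edge is $\hat e$, which is not a loop, and $\widehat{G\backslash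 e}\cong\widehat G\setminus D$. (d) If $G$ has a $1$-valent vertex $v$ in the interior of $R$, then $\widehat G$ has a loop, dual to an edge with end $v$, and $\chi_{\widehat G}=0$. (e) The normalized trace is well defined: there is a unique $\mathbb C[Q]$-linear map $tr_\chi:\mathcal C_n\to\mathbb C[Q]$ with $Q\cdot tr_\chi(G)=\chi_{\widehat{\overline G}}(Q)$ for every $G$. Likewise, for every nonzero complex number $Q$, if $\mathcal C_n^Q$ denotes the algebra over $\mathbb C$ defined by the same generators and relations with this value of $Q$, there is a unique $\mathbb C$-linear map $tr_\chi:\mathcal C_n^Q\to\mathbb C$ with $tr_\chi(G)=Q^{-1}\chi_{\widehat{\overline G}}(Q)$ for every $G$. -/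

import Mathlib

open Set Polynomial

noncomputable section

/-! ### Chromatic polynomials of finite multigraphs -/

namespace Graph

variable {α β α' β' : Type*}

/-- The number of connected components of the graph with the same vertices as `Γ` whose edges are
the edges of `Γ` that lie in `S`. -/
def numComponents (Γ : Graph α β) (S : Set β) : ℕ :=
  Nat.card (Quot fun x y : Γ.vertexSet => ∃ e ∈ S, Γ.IsLink e x y)

/-- The chromatic polynomial `∑_{S ⊆ E(Γ)} (-1)^{|S|} Q^{k(S)}` of a finite multigraph. -/
def chromaticPolynomial (Γ : Graph α β) : ℂ[X] :=
  ∑ᶠ (S : Set β) (_ : S ⊆ Γ.edgeSet), (-1) ^ S.ncard * X ^ Γ.numComponents S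

/-- Contraction of an edge `e` with ends `a` and `b`: `e` is deleted and `b` is identified
with `a`.  (If `a = b`, that is, if `e` is a loop, this is the deletion of `e`.) -/
def contractEdge (Γ : Graph α β) (e : β) (a b : α) : Graph α β :=
  open Classical in (Γ.deleteEdges {e}).map fun x => if x = b then a else x

/-- Isomorphism of multigraphs. -/
def IsIsoTo (Γ : Graph α β) (Δ : Graph α' β') : Prop :=
  ∃ (f : Γ.vertexSet ≃ Δ.vertexSet) (g : Γ.edgeSet ≃ Δ.edgeSet),
    ∀ (e : Γ.edgeSet) (x y : Γ.vertexSet), Γ.IsLink e x y ↔ Δ.IsLink (g e) (f x) (f y)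

end Graph

namespace ChromaticAlgebra

/-- The plane. -/
abbrev Plane : Type := ℝ × ℝ

/-- The rectangle `R`. -/
def rect : Set Plane := Icc 0 1 ×ˢ Icc 0 1

/-- The interior of the rectangle. -/
def openRect : Set Plane := Ioo 0 1 ×ˢ Ioo 0 1

/-- The horizontal positions of the `n` marked points on the top and on the bottom of `R`. -/
def strandPos (n : ℕ) (i : Fin n) : ℝ := ((i : ℝ) + 1) / ((n : ℝ) + 1)

/-! ### Plane graphs and their duals -/

/-- The star with `d` rays: the local model of a graph at a `d`-valent point. -/
def star (d : ℕ) : Set ℂ :=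
  {z | z = 0 ∨ ∃ k < d, ∃ t : ℝ, 0 < t ∧ z = t * Complex.exp (2 * Real.pi * Complex.I * k / d)}

/-- The set `X` looks near `p` like a star with `d` rays looks near its centre. -/
def HasValence (X : Set Plane) (p : Plane) (d : ℕ) : Prop :=
  ∃ φ : OpenPartialHomeomorph Plane ℂ, p ∈ φ.source ∧ φ p = 0 ∧
    ∀ q ∈ φ.source, q ∈ X ↔ φ q ∈ star d

/-- The edges (without their end vertices) of the graph with underlying set `X` and set of
vertices `V`: the connected components of `X \ V`.  Closed curves that contain no vertex are
edges, too. -/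
def edgesOf (X V : Set Plane) : Set (Set Plane) :=
  {e | ∃ p ∈ X \ V, e = connectedComponentIn (X \ V) p}

/-- The regions: the connected components of the complement of `X` in `Y`. -/
def regionsOf (Y X : Set Plane) : Set (Set Plane) :=
  {A | ∃ p ∈ Y \ X, A = connectedComponentIn (Y \ X) p}

/-- The dual multigraph of a graph in the part `Y` of the plane, with underlying set `X` and set of
vertices `V`.  Its vertices are the regions, and every edge `e` of the graph is also an edge of the
dual, which joins the two regions adjacent to `e` (a loop, if there is just one region
adjacent to `e`). -/
def dualOf (Y X V : Set Plane) : Graph (Set Plane) (Set Plane) where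
  vertexSet := regionsOf Y X
  IsLink e A B := e ∈ edgesOf X V ∧ A ∈ regionsOf Y X ∧ B ∈ regionsOf Y X ∧
    ∀ p ∈ e, ∀ C ∈ regionsOf Y X, p ∈ closure C ↔ C = A ∨ C = B
  isLink_symm := fun e _ =>
    ⟨fun A B h => ⟨h.1, h.2.2.1, h.2.1, fun p hp C hC => (h.2.2.2 p hp C hC).trans or_comm⟩⟩
  eq_or_eq_of_isLink_of_isLink := by
    rintro e A B C D ⟨⟨p, hp, rfl⟩, hA, hB, h⟩ ⟨-, hC, hD, h'⟩
    have hpe := mem_connectedComponentIn hp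
    exact (h' p hpe A hA).1 ((h p hpe A hA).2 (Or.inl rfl))
  left_mem_of_isLink := fun _ _ _ h => h.2.1

/-! ### Graphs in the rectangle -/

/-- A (tame) graph embedded in the rectangle `R`, meeting the boundary of `R` in exactly `n` points
at the top and `n` points at the bottom.  Near these points the graph consists of vertical
segments. -/
structure RectGraph (n : ℕ) where
  /-- the underlying point set -/
  carrier : Set Plane
  /-- the vertices, all in the interior of `R` -/
  verts : Set Plane
  finite_verts : verts.Finite
  isClosed_carrier : IsClosed carrier
  carrier_subset : carrier ⊆ Ioo 0 1 ×ˢ Icc 0 1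
  verts_subset : verts ⊆ carrier
  collar : ∃ ε > 0, (∀ v ∈ verts, v.2 ∈ Ioo ε (1 - ε)) ∧
    ∀ p : Plane, p.2 ∈ Icc 0 ε ∪ Icc (1 - ε) 1 → (p ∈ carrier ↔ ∃ i, p.1 = strandPos n i)
  valence_two : ∀ p ∈ carrier \ verts, p ∈ openRect → HasValence carrier p 2
  valence_verts : ∀ v ∈ verts, ∃ d, HasValence carrier v d

namespace RectGraph

variable {n : ℕ}

/-- The edges of a graph in the rectangle. -/
def edges (G : RectGraph n) : Set (Set Plane) := edgesOf G.carrier G.verts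

/-- The dual graph of a graph in the rectangle; its vertices are the components of the complement
of the graph in the rectangle. -/
def dual (G : RectGraph n) : Graph (Set Plane) (Set Plane) := dualOf rect G.carrier G.verts

/-- An inner edge: an edge without an end on the boundary of the rectangle. -/
def IsInnerEdge (G : RectGraph n) (e : Set Plane) : Prop := e ∈ G.edges ∧ e ⊆ openRect

/-- An inner edge is a loop if it has at most one end vertex (none, if it is a simple closed curve
which is not connected to the rest of the graph). -/
def IsLoop (G : RectGraph n) (e : Set Plane) : Prop := (closure e ∩ G.verts).Subsingleton

/-- `G'` is the graph `G \ e`, obtained from `G` by deleting the edge `e`. -/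
def IsDeletion (G : RectGraph n) (e : Set Plane) (G' : RectGraph n) : Prop :=
  G'.carrier = G.carrier \ e ∧ G'.verts = G.verts

/-- `G'` is the graph `G / e`, obtained from `G` by contracting the edge `e`: it is the image of `G`
under a map of the plane onto itself, fixed outside the interior of `R`, which collapses `e` and its
ends to one point and identifies no other points. -/
def IsContraction (G : RectGraph n) (e : Set Plane) (G' : RectGraph n) : Prop :=
  ∃ f : Plane → Plane, Continuous f ∧ Function.Surjective f ∧ (∀ p ∉ openRect, f p = p) ∧
    (∀ p q, f p = f q ↔ p = q ∨ (p ∈ closure e ∧ q ∈ closure e)) ∧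
    G'.carrier = f '' G.carrier ∧ G'.verts = f '' G.verts

/-- Ambient isotopy of graphs in the rectangle, fixed on the boundary of the rectangle. -/
def IsIsotopic (G H : RectGraph n) : Prop :=
  ∃ F : unitInterval → Plane ≃ₜ Plane, (Continuous fun q : unitInterval × Plane => F q.1 q.2) ∧
    (∀ p, F 0 p = p) ∧ (∀ t, ∀ p ∉ openRect, F t p = p) ∧
    F 1 '' G.carrier = H.carrier ∧ F 1 '' G.verts = H.verts

lemma isIsotopic_equivalence : Equivalence (IsIsotopic (n := n)) where
  refl G := ⟨fun _ => Homeomorph.refl _, continuous_snd, by simp, by simp, by simp, by simp⟩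
  symm := by
    rintro G H ⟨F, hc, h0, hb, h1, h2⟩
    have hb' : ∀ p ∉ openRect, (F 1).symm p = p := fun p hp => by
      rw [Homeomorph.symm_apply_eq, hb 1 p hp]
    refine ⟨fun t => (F 1).symm.trans (F (unitInterval.symm t)), ?_, ?_, ?_, ?_, ?_⟩
    · exact hc.comp ((unitInterval.continuous_symm.comp continuous_fst).prodMk
        ((F 1).symm.continuous.comp continuous_snd))
    · intro p; simp
    · intro t p hp; simp [hb' p hp, hb _ p hp]
    · rw [← h1, image_image]; simp [h0]
    · rw [← h2, image_image]; simp [h0]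
  trans := by
    rintro G H K ⟨F, hc, h0, hb, h1, h2⟩ ⟨F', hc', h0', hb', h1', h2'⟩
    refine ⟨fun t => (F t).trans (F' t), ?_, ?_, ?_, ?_, ?_⟩
    · exact hc'.comp (continuous_fst.prodMk hc)
    · intro p; simp [h0, h0']
    · intro t p hp; simp [hb t p hp, hb' t p hp]
    · rw [← h1', ← h1, image_image]; rfl
    · rw [← h2', ← h2, image_image]; rfl

instance setoid (n : ℕ) : Setoid (RectGraph n) := ⟨IsIsotopic, isIsotopic_equivalence⟩

/-! ### Vertical stacking -/

/-- The homeomorphism of the plane which squeezes the rectangle to its upper half. -/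
def toUpper : Plane ≃ₜ Plane where
  toFun p := (p.1, (p.2 + 1) / 2)
  invFun p := (p.1, 2 * p.2 - 1)
  left_inv p := by ext <;> simp; ring
  right_inv p := by ext <;> simp
  continuous_toFun := by fun_prop
  continuous_invFun := by fun_prop

/-- The homeomorphism of the plane which squeezes the rectangle to its lower half. -/
def toLower : Plane ≃ₜ Plane where
  toFun p := (p.1, p.2 / 2)
  invFun p := (p.1, 2 * p.2)
  left_inv p := by ext <;> simp; ring
  right_inv p := by ext <;> simp
  continuous_toFun := by fun_prop
  continuous_invFun := by fun_prop

lemma mem_toUpper_image {X : Set Plane} {p : Plane} :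
    p ∈ toUpper '' X ↔ (p.1, 2 * p.2 - 1) ∈ X := by
  rw [Homeomorph.image_eq_preimage_symm]; rfl

lemma mem_toLower_image {X : Set Plane} {p : Plane} :
    p ∈ toLower '' X ↔ (p.1, 2 * p.2) ∈ X := by
  rw [Homeomorph.image_eq_preimage_symm]; rfl

lemma mem_star_two {z : ℂ} : z ∈ star 2 ↔ z.im = 0 := by
  constructor
  · rintro (rfl | ⟨k, hk, t, ht, rfl⟩)
    · simp
    · interval_cases k
      · simp
      · have : (2 * Real.pi * Complex.I * ((1 : ℕ) : ℂ) / ((2 : ℕ) : ℂ)) = Real.pi * Complex.I := by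
          push_cast; ring
        rw [this, Complex.exp_pi_mul_I]; simp
  · intro h
    rcases lt_trichotomy z.re 0 with h' | h' | h'
    · refine Or.inr ⟨1, by norm_num, -z.re, by linarith, ?_⟩
      have : (2 * Real.pi * Complex.I * ((1 : ℕ) : ℂ) / ((2 : ℕ) : ℂ)) = Real.pi * Complex.I := by
        push_cast; ring
      rw [this, Complex.exp_pi_mul_I]
      apply Complex.ext <;> simp [h]
    · exact Or.inl (Complex.ext h' h)
    · refine Or.inr ⟨0, by norm_num, z.re, h', ?_⟩
      apply Complex.ext <;> simp [h]

lemma hasValence_congr {X X' U : Set Plane} {p : Plane} {d : ℕ} (h : HasValence X p d)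
    (hU : IsOpen U) (hp : p ∈ U) (hX : ∀ q ∈ U, q ∈ X' ↔ q ∈ X) : HasValence X' p d := by
  obtain ⟨φ, h1, h2, h3⟩ := h
  refine ⟨φ.restrOpen U hU, by simp [h1, hp], by simpa using h2, ?_⟩
  intro q hq
  simp only [OpenPartialHomeomorph.restrOpen_source, mem_inter_iff] at hq
  rw [hX q hq.2, h3 q hq.1]; simp

lemma hasValence_image {X : Set Plane} {p : Plane} {d : ℕ} (h : HasValence X p d)
    (g : Plane ≃ₜ Plane) : HasValence (g '' X) (g p) d := by
  obtain ⟨φ, h1, h2, h3⟩ := h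
  refine ⟨g.symm.transOpenPartialHomeomorph φ, by simpa using h1, by simpa using h2, ?_⟩
  intro q hq
  have hq' : g.symm q ∈ φ.source := hq
  rw [Homeomorph.image_eq_preimage_symm, mem_preimage, h3 _ hq']; rfl

/-- A vertical line, as a local model. -/
lemma hasValence_two_of_vertical {X U : Set Plane} {p : Plane} (hU : IsOpen U) (hp : p ∈ U)
    (hX : ∀ q ∈ U, q ∈ X ↔ q.1 = p.1) : HasValence X p 2 := by
  let g : Plane ≃ₜ ℂ :=
    { toFun := fun q => ⟨q.2 - p.2, q.1 - p.1⟩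
      invFun := fun z => (z.im + p.1, z.re + p.2)
      left_inv := fun q => by ext <;> simp
      right_inv := fun z => by apply Complex.ext <;> simp
      continuous_toFun := by
        have : (fun q : Plane => (⟨q.2 - p.2, q.1 - p.1⟩ : ℂ)) =
            fun q : Plane => Complex.equivRealProdCLM.symm (q.2 - p.2, q.1 - p.1) := by
          funext q; apply Complex.ext <;> simp
        rw [this]
        exact Complex.equivRealProdCLM.symm.continuous.comp (by fun_prop)
      continuous_invFun := by
        have h1 := Complex.continuous_im
        have h2 := Complex.continuous_re
        fun_prop }
  refine ⟨g.toOpenPartialHomeomorph.restrOpen U hU, by simp [hp], ?_, ?_⟩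
  · apply Complex.ext <;> simp [g]
  · intro q hq
    simp only [OpenPartialHomeomorph.restrOpen_source, mem_inter_iff] at hq
    rw [hX q hq.2, mem_star_two]
    simp [g, sub_eq_zero]

lemma strandPos_mem {n : ℕ} (i : Fin n) : strandPos n i ∈ Ioo (0 : ℝ) 1 := by
  have h : (i : ℝ) + 1 ≤ n := by exact_mod_cast i.2
  have h0 : (0 : ℝ) ≤ i := by positivity
  constructor
  · unfold strandPos; positivity
  · unfold strandPos; rw [div_lt_one (by positivity)]; linarith

lemma exists_open_strandPos {n : ℕ} (i : Fin n) : ∃ U : Set ℝ, IsOpen U ∧ strandPos n i ∈ U ∧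
    ∀ x ∈ U, (∃ j, x = strandPos n j) ↔ x = strandPos n i := by
  refine ⟨(strandPos n '' {j | strandPos n j ≠ strandPos n i})ᶜ, ?_, ?_, ?_⟩
  · exact ((Set.toFinite _).isClosed).isOpen_compl
  · rintro ⟨j, hj, h⟩; exact hj h
  · intro x hx
    refine ⟨?_, fun h => ⟨i, h⟩⟩
    rintro ⟨j, rfl⟩
    by_contra h
    exact hx ⟨j, h, rfl⟩

lemma upper_of_mem (G : RectGraph n) {p : Plane} (h : p ∈ toUpper '' G.carrier) :
    p.2 ∈ Icc (1 / 2) 1 := by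
  have := G.carrier_subset (mem_toUpper_image.1 h)
  have h2 := this.2
  simp only [mem_Icc] at h2 ⊢
  constructor <;> linarith [h2.1, h2.2]

lemma lower_of_mem (G : RectGraph n) {p : Plane} (h : p ∈ toLower '' G.carrier) :
    p.2 ∈ Icc 0 (1 / 2) := by
  have := G.carrier_subset (mem_toLower_image.1 h)
  have h2 := this.2
  simp only [mem_Icc] at h2 ⊢
  constructor <;> linarith [h2.1, h2.2]

lemma stack_collar (G H : RectGraph n) : ∃ ε > 0, ε < 1 ∧
    (∀ v ∈ G.verts, v.2 ∈ Ioo ε (1 - ε)) ∧ (∀ v ∈ H.verts, v.2 ∈ Ioo ε (1 - ε)) ∧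
    (∀ p : Plane, p.2 ∈ Icc 0 ε ∪ Icc (1 - ε) 1 → (p ∈ G.carrier ↔ ∃ i, p.1 = strandPos n i)) ∧
    (∀ p : Plane, p.2 ∈ Icc 0 ε ∪ Icc (1 - ε) 1 → (p ∈ H.carrier ↔ ∃ i, p.1 = strandPos n i)) := by
  obtain ⟨a, ha, h1, h2⟩ := G.collar
  obtain ⟨b, hb, h3, h4⟩ := H.collar
  have hle1 : min (min a b) (1 / 2) ≤ a := (min_le_left _ _).trans (min_le_left _ _)
  have hle2 : min (min a b) (1 / 2) ≤ b := (min_le_left _ _).trans (min_le_right _ _)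
  refine ⟨min (min a b) (1 / 2), by positivity, ?_, ?_, ?_, ?_, ?_⟩
  · exact (min_le_right _ _).trans_lt (by norm_num)
  · intro v hv
    have := h1 v hv
    exact ⟨by linarith [this.1], by linarith [this.2]⟩
  · intro v hv
    have := h3 v hv
    exact ⟨by linarith [this.1], by linarith [this.2]⟩
  · rintro p hp
    apply h2
    rcases hp with hp | hp
    · exact Or.inl ⟨hp.1, by linarith [hp.2]⟩
    · exact Or.inr ⟨by linarith [hp.1], hp.2⟩
  · rintro p hp
    apply h4
    rcases hp with hp | hp
    · exact Or.inl ⟨hp.1, by linarith [hp.2]⟩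
    · exact Or.inr ⟨by linarith [hp.1], hp.2⟩

/-- Vertical stacking: `G` on top of `H`. -/
def stack (G H : RectGraph n) : RectGraph n where
  carrier := toUpper '' G.carrier ∪ toLower '' H.carrier
  verts := toUpper '' G.verts ∪ toLower '' H.verts
  finite_verts := (G.finite_verts.image _).union (H.finite_verts.image _)
  isClosed_carrier := (toUpper.isClosedMap _ G.isClosed_carrier).union
    (toLower.isClosedMap _ H.isClosed_carrier)
  carrier_subset := by
    rintro p (h | h)
    · refine ⟨(G.carrier_subset (mem_toUpper_image.1 h)).1, ?_⟩
      have := upper_of_mem G h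
      exact ⟨by linarith [this.1], this.2⟩
    · refine ⟨(H.carrier_subset (mem_toLower_image.1 h)).1, ?_⟩
      have := lower_of_mem H h
      exact ⟨this.1, by linarith [this.2]⟩
  verts_subset := union_subset_union (image_mono G.verts_subset) (image_mono H.verts_subset)
  collar := by
    obtain ⟨ε, h0, h1, hG, hH, hGc, hHc⟩ := stack_collar G H
    refine ⟨ε / 2, by positivity, ?_, ?_⟩
    · rintro v (h | h)
      · have := hG _ (mem_toUpper_image.1 h)
        simp only [mem_Ioo] at this ⊢
        constructor <;> linarith [this.1, this.2]
      · have := hH _ (mem_toLower_image.1 h)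
        simp only [mem_Ioo] at this ⊢
        constructor <;> linarith [this.1, this.2]
    · rintro p (hp | hp)
      · have e : p ∉ toUpper '' G.carrier := fun h => by
          have := upper_of_mem G h
          linarith [this.1, hp.2]
        simp only [mem_union, e, false_or, mem_toLower_image]
        exact hHc _ (Or.inl ⟨by simpa using hp.1, by simp; linarith [hp.2]⟩)
      · have e : p ∉ toLower '' H.carrier := fun h => by
          have := lower_of_mem H h
          linarith [this.2, hp.1]
        simp only [mem_union, e, or_false, mem_toUpper_image]
        exact hGc _ (Or.inr ⟨by simp; linarith [hp.1], by simp; linarith [hp.2]⟩)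
  valence_two := by
    rintro p ⟨hp, hv⟩ hR
    rcases lt_trichotomy p.2 (1 / 2) with h | h | h
    · have hp' : p ∈ toLower '' H.carrier := hp.resolve_left fun h' => by
        linarith [(upper_of_mem G h').1]
      have hV : HasValence H.carrier (p.1, 2 * p.2) 2 := by
        refine H.valence_two _ ⟨mem_toLower_image.1 hp', fun h' => ?_⟩ ?_
        · exact hv (Or.inr (mem_toLower_image.2 h'))
        · exact ⟨hR.1, by simp; exact ⟨hR.2.1, by linarith⟩⟩
      have := hasValence_image hV toLower
      have e : toLower (p.1, 2 * p.2) = p := toLower.right_inv p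
      rw [e] at this
      refine hasValence_congr this (U := {q | q.2 < 1 / 2}) (isOpen_lt continuous_snd continuous_const) h ?_
      intro q hq
      have : q ∉ toUpper '' G.carrier := fun h' => by
        have := (upper_of_mem G h').1
        simp only [mem_ofPred_eq] at hq
        linarith
      simp [this]
    · obtain ⟨ε, h0, h1, hG, hH, hGc, hHc⟩ := stack_collar G H
      have key : ∀ q : Plane, q.2 ∈ Ioo (1 / 2 - ε / 2) (1 / 2 + ε / 2) →
          (q ∈ toUpper '' G.carrier ∪ toLower '' H.carrier ↔ ∃ i, q.1 = strandPos n i) := by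
        intro q hq
        simp only [mem_Ioo] at hq
        constructor
        · rintro (h' | h')
          · have := upper_of_mem G h'
            exact (hGc (q.1, 2 * q.2 - 1) (Or.inl (by simp; constructor <;> linarith [this.1, hq.2]))).1
              (mem_toUpper_image.1 h')
          · have := lower_of_mem H h'
            exact (hHc (q.1, 2 * q.2) (Or.inr (by simp; constructor <;> linarith [this.2, hq.1]))).1
              (mem_toLower_image.1 h')
        · intro hi
          rcases le_total q.2 (1 / 2) with h' | h'
          · exact Or.inr (mem_toLower_image.2 ((hHc _ (Or.inr
              (by simp; constructor <;> linarith [hq.1]))).2 hi))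
          · exact Or.inl (mem_toUpper_image.2 ((hGc _ (Or.inl
              (by simp; constructor <;> linarith [hq.2]))).2 hi))
      obtain ⟨i, hi⟩ := (key p (by rw [h]; constructor <;> linarith)).1 hp
      obtain ⟨U, hU, hiU, hU'⟩ := exists_open_strandPos i
      refine hasValence_two_of_vertical (U := U ×ˢ Ioo (1 / 2 - ε / 2) (1 / 2 + ε / 2))
        (hU.prod isOpen_Ioo) ⟨by rwa [hi], by rw [h]; constructor <;> linarith⟩ ?_
      intro q hq
      rw [key q hq.2, hU' _ hq.1, hi]
    · have hp' : p ∈ toUpper '' G.carrier := hp.resolve_right fun h' => by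
        linarith [(lower_of_mem H h').2]
      have hV : HasValence G.carrier (p.1, 2 * p.2 - 1) 2 := by
        refine G.valence_two _ ⟨mem_toUpper_image.1 hp', fun h' => ?_⟩ ?_
        · exact hv (Or.inl (mem_toUpper_image.2 h'))
        · exact ⟨hR.1, by simp; exact ⟨by linarith, by linarith [hR.2.2]⟩⟩
      have := hasValence_image hV toUpper
      have e : toUpper (p.1, 2 * p.2 - 1) = p := toUpper.right_inv p
      rw [e] at this
      refine hasValence_congr this (U := {q | 1 / 2 < q.2}) (isOpen_lt continuous_const continuous_snd) h ?_
      intro q hq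
      have : q ∉ toLower '' H.carrier := fun h' => by
        have := (lower_of_mem H h').2
        simp only [mem_ofPred_eq] at hq
        linarith
      simp [this]
  valence_verts := by
    rintro _ (⟨v, hv, rfl⟩ | ⟨v, hv, rfl⟩)
    · obtain ⟨ε, h0, hG, -⟩ := G.collar
      obtain ⟨d, hd⟩ := G.valence_verts v hv
      refine ⟨d, hasValence_congr (hasValence_image hd toUpper) (U := {q | 1 / 2 < q.2})
        (isOpen_lt continuous_const continuous_snd) ?_ ?_⟩
      · have := (hG v hv).1
        change 1 / 2 < (v.2 + 1) / 2
        linarith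
      · intro q hq
        have : q ∉ toLower '' H.carrier := fun h' => by
          have := (lower_of_mem H h').2
          simp only [mem_ofPred_eq] at hq
          linarith
        simp [this]
    · obtain ⟨ε, h0, hH, -⟩ := H.collar
      obtain ⟨d, hd⟩ := H.valence_verts v hv
      refine ⟨d, hasValence_congr (hasValence_image hd toLower) (U := {q | q.2 < 1 / 2})
        (isOpen_lt continuous_snd continuous_const) ?_ ?_⟩
      · have := (hH v hv).2
        change v.2 / 2 < 1 / 2
        linarith
      · intro q hq
        have : q ∉ toUpper '' G.carrier := fun h' => by
          have := (upper_of_mem G h').1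
          simp only [mem_ofPred_eq] at hq
          linarith
        simp [this]

/-- The graph consisting of `n` vertical strands. -/
def strands (n : ℕ) : RectGraph n where
  carrier := {p | (∃ i, p.1 = strandPos n i) ∧ p.2 ∈ Icc 0 1}
  verts := ∅
  finite_verts := finite_empty
  isClosed_carrier := by
    have : {p : Plane | (∃ i, p.1 = strandPos n i) ∧ p.2 ∈ Icc 0 1} =
        range (strandPos n) ×ˢ Icc 0 1 := by
      ext p; simp [eq_comm]
    rw [this]
    exact (finite_range _).isClosed.prod isClosed_Icc
  carrier_subset := by
    rintro p ⟨⟨i, hi⟩, hp⟩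
    exact ⟨by rw [hi]; exact strandPos_mem i, hp⟩
  verts_subset := empty_subset _
  collar := by
    refine ⟨1 / 2, by norm_num, by simp, ?_⟩
    intro p hp
    simp only [mem_ofPred_eq, and_iff_left_iff_imp]
    rintro -
    rcases hp with hp | hp
    · exact ⟨hp.1, by linarith [hp.2]⟩
    · exact ⟨by linarith [hp.1], hp.2⟩
  valence_two := by
    rintro p ⟨⟨⟨i, hi⟩, -⟩, -⟩ hR
    obtain ⟨U, hU, hiU, hU'⟩ := exists_open_strandPos i
    refine hasValence_two_of_vertical (U := U ×ˢ Ioo 0 1) (hU.prod isOpen_Ioo)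
      ⟨by rwa [hi], hR.2⟩ ?_
    intro q hq
    simp only [mem_ofPred_eq, hU' _ hq.1, hi, and_iff_left_iff_imp]
    exact fun _ => ⟨hq.2.1.le, hq.2.2.le⟩
  valence_verts := by simp

lemma exists_homeomorph_of_fix {f : Plane → Plane} (hf : Continuous f) (hb : Function.Bijective f)
    (h : ∀ p ∉ openRect, f p = p) : ∃ g : Plane ≃ₜ Plane, ∀ p, g p = f p := by
  have hK : IsCompact rect := isCompact_Icc.prod isCompact_Icc
  have hO : IsOpen openRect := isOpen_Ioo.prod isOpen_Ioo
  have hOR : openRect ⊆ rect := prod_mono Ioo_subset_Icc_self Ioo_subset_Icc_self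
  have hcl : IsClosedMap f := by
    intro S hS
    have : f '' S = f '' (S ∩ rect) ∪ (S ∩ openRectᶜ) := by
      ext q
      constructor
      · rintro ⟨p, hp, rfl⟩
        by_cases hpr : p ∈ openRect
        · exact Or.inl ⟨p, ⟨hp, hOR hpr⟩, rfl⟩
        · rw [h p hpr]; exact Or.inr ⟨hp, hpr⟩
      · rintro (⟨p, hp, rfl⟩ | ⟨hq, hq'⟩)
        · exact ⟨p, hp.1, rfl⟩
        · exact ⟨q, hq, h q hq'⟩
    rw [this]
    exact ((hK.inter_left hS).image hf).isClosed.union (hS.inter hO.isClosed_compl)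
  exact ⟨(Equiv.ofBijective f hb).toHomeomorphOfContinuousClosed hf hcl, fun p => rfl⟩

/-- A vertical reparametrization of the rectangle is realized by an isotopy. -/
lemma isIsotopic_of_reparam (G H : RectGraph n) (σ : ℝ → ℝ) (hσ : Continuous σ)
    (hm : StrictMono σ) (h0 : σ 0 = 0) (h1 : σ 1 = 1)
    (hc : (fun p : Plane => (p.1, σ p.2)) '' G.carrier = H.carrier)
    (hv : (fun p : Plane => (p.1, σ p.2)) '' G.verts = H.verts) : G.IsIsotopic H := by
  have hcomp : IsCompact G.carrier := (isCompact_Icc.prod isCompact_Icc).of_isClosed_subset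
    G.isClosed_carrier (G.carrier_subset.trans (prod_mono Ioo_subset_Icc_self subset_rfl))
  obtain ⟨a, ha, hGa⟩ : ∃ a > (0 : ℝ), ∀ p ∈ G.carrier, a ≤ p.1 ∧ p.1 ≤ 1 - a := by
    rcases G.carrier.eq_empty_or_nonempty with he | hne
    · exact ⟨1, one_pos, by simp [he]⟩
    · obtain ⟨p, hp, hpm⟩ := hcomp.exists_isMinOn hne
        (f := fun p : Plane => min p.1 (1 - p.1)) (by fun_prop)
      have := (G.carrier_subset hp).1
      refine ⟨min p.1 (1 - p.1), lt_min this.1 (by linarith [this.2]), fun q hq => ?_⟩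
      have hq' : min p.1 (1 - p.1) ≤ min q.1 (1 - q.1) := hpm hq
      exact ⟨hq'.trans (min_le_left _ _), by linarith [hq'.trans (min_le_right _ _)]⟩
  -- `ρ` is `σ` on the unit interval and the identity outside
  let ρ : ℝ → ℝ := fun y => σ (max 0 (min 1 y)) + (y - max 0 (min 1 y))
  have hρc : Continuous ρ := by fun_prop
  have hρ01 : ∀ y ∈ Icc (0 : ℝ) 1, ρ y = σ y := fun y hy => by
    simp [ρ, min_eq_right hy.2, max_eq_right hy.1]
  have hρout : ∀ y ∉ Ioo (0 : ℝ) 1, ρ y = y := fun y hy => by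
    rcases le_or_gt y 0 with h | h
    · simp [ρ, min_eq_right (h.trans zero_le_one), max_eq_left h, h0]
    · have h' : 1 ≤ y := by by_contra h'; exact hy ⟨h, not_le.1 h'⟩
      simp [ρ, min_eq_left h', h1]
  have hρm : StrictMono ρ := by
    have key : ∀ x y : ℝ, x < y → x ∈ Icc (0 : ℝ) 1 → y ∈ Icc (0 : ℝ) 1 → ρ x < ρ y :=
      fun x y h hx hy => by rw [hρ01 x hx, hρ01 y hy]; exact hm h
    have hmem : ∀ x ∈ Icc (0 : ℝ) 1, ρ x ∈ Icc (0 : ℝ) 1 := fun x hx => by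
      rw [hρ01 x hx]
      exact ⟨h0.symm.trans_le (hm.monotone hx.1), (hm.monotone hx.2).trans_eq h1⟩
    intro x y h
    by_cases hx : x ∈ Icc (0 : ℝ) 1 <;> by_cases hy : y ∈ Icc (0 : ℝ) 1
    · exact key x y h hx hy
    · have hy' : 1 < y := by by_contra h'; exact hy ⟨hx.1.trans h.le, not_lt.1 h'⟩
      rw [hρout y (fun h => hy (Ioo_subset_Icc_self h))]
      exact (hmem x hx).2.trans_lt hy'
    · have hx' : x < 0 := by by_contra h'; exact hx ⟨not_lt.1 h', h.le.trans hy.2⟩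
      rw [hρout x (fun h => hx (Ioo_subset_Icc_self h))]
      exact hx'.trans_le (hmem y hy).1
    · rw [hρout x (fun h => hx (Ioo_subset_Icc_self h)),
        hρout y (fun h => hy (Ioo_subset_Icc_self h))]
      exact h
  let c : ℝ → ℝ := fun x => max 0 (min 1 (min x (1 - x) / a))
  have hcc : Continuous c := by fun_prop
  have hc0 : ∀ x, 0 ≤ c x := fun x => le_max_left _ _
  have hc1 : ∀ x, c x ≤ 1 := fun x => max_le zero_le_one (min_le_left _ _)
  have hcout : ∀ x ∉ Ioo (0 : ℝ) 1, c x = 0 := fun x hx => by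
    apply max_eq_left
    refine (min_le_right _ _).trans (div_nonpos_of_nonpos_of_nonneg ?_ ha.le)
    rcases le_or_gt x 0 with h | h
    · exact (min_le_left _ _).trans h
    · have h' : 1 ≤ x := by by_contra h'; exact hx ⟨h, not_le.1 h'⟩
      exact (min_le_right _ _).trans (by linarith)
  have hcin : ∀ p ∈ G.carrier, c p.1 = 1 := fun p hp => by
    have h := hGa p hp
    have : 1 ≤ min p.1 (1 - p.1) / a := by
      rw [le_div_iff₀ ha, one_mul]; exact le_min h.1 (by linarith [h.2])
    simp [c, min_eq_left this]
  let f : unitInterval → Plane → Plane := fun t p => (p.1, p.2 + t * c p.1 * (ρ p.2 - p.2))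
  have hfc : Continuous fun q : unitInterval × Plane => f q.1 q.2 := by fun_prop
  have hfix : ∀ t, ∀ p ∉ openRect, f t p = p := by
    intro t p hp
    by_cases h : p.1 ∈ Ioo (0 : ℝ) 1
    · have h' : p.2 ∉ Ioo (0 : ℝ) 1 := fun h' => hp ⟨h, h'⟩
      simp [f, hρout _ h']
    · simp [f, hcout _ h]
  have hbij : ∀ t, Function.Bijective (f t) := by
    intro t
    have hmono : ∀ x, StrictMono fun y => y + t * c x * (ρ y - y) := by
      intro x y z h
      have h2 := hρm h
      have b0 : 0 ≤ (t : ℝ) * c x := mul_nonneg t.2.1 (hc0 x)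
      have b1 : (t : ℝ) * c x ≤ 1 := mul_le_one₀ t.2.2 (hc0 x) (hc1 x)
      simp only
      set b := (t : ℝ) * c x
      rcases b0.eq_or_lt with hb | hb
      · rw [← hb]; simpa using h
      · nlinarith [mul_pos hb (sub_pos.2 h2), mul_nonneg (sub_nonneg.2 b1) (sub_pos.2 h).le]
    constructor
    · rintro ⟨x, y⟩ ⟨x', y'⟩ h
      simp only [f, Prod.mk.injEq] at h
      obtain ⟨rfl, h⟩ := h
      rw [(hmono x).injective h]
    · rintro ⟨x, z⟩
      suffices ∃ y, y + t * c x * (ρ y - y) = z by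
        obtain ⟨y, hy⟩ := this
        exact ⟨(x, y), by simp [f, hy]⟩
      by_cases hz : z ∈ Ioo (0 : ℝ) 1
      · have hcont : ContinuousOn (fun y => y + t * c x * (ρ y - y)) (Icc 0 1) := by fun_prop
        have := intermediate_value_Icc zero_le_one hcont
        simp only [hρ01 0 (by simp), hρ01 1 (by simp), h0, h1] at this
        obtain ⟨y, -, hy⟩ := this (show z ∈ _ by simpa using Ioo_subset_Icc_self hz)
        exact ⟨y, hy⟩
      · exact ⟨z, by simp [hρout z hz]⟩
  choose F hF using fun t => exists_homeomorph_of_fix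
    (hfc.comp (Continuous.prodMk_right t)) (hbij t) (hfix t)
  have hF' : ∀ t p, F t p = f t p := hF
  have hF1 : ∀ p ∈ G.carrier, F 1 p = (p.1, σ p.2) := fun p hp => by
    rw [hF']
    simp [f, hcin p hp, hρ01 _ (G.carrier_subset hp).2]
  refine ⟨F, ?_, ?_, ?_, ?_, ?_⟩
  · simpa only [hF'] using hfc
  · intro p; simp [hF', f]
  · intro t p hp; rw [hF', hfix t p hp]
  · rw [← hc]; exact image_congr hF1
  · rw [← hv]; exact image_congr fun p hp => hF1 p (G.verts_subset hp)

lemma stack_isIsotopic {G G' H H' : RectGraph n} (hG : G.IsIsotopic G') (hH : H.IsIsotopic H') :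
    (stack G H).IsIsotopic (stack G' H') := by
  obtain ⟨F, hc, h0, hb, h1, h2⟩ := hG
  obtain ⟨F', hc', h0', hb', h1', h2'⟩ := hH
  have hbU : ∀ t p, p.2 ∉ Ioo (1 / 2 : ℝ) 1 ∨ p.1 ∉ Ioo (0 : ℝ) 1 →
      toUpper (F t (toUpper.symm p)) = p := by
    intro t p hp
    rw [hb, Homeomorph.apply_symm_apply]
    rintro ⟨ha, hb⟩
    have hb : 0 < 2 * p.2 - 1 ∧ 2 * p.2 - 1 < 1 := hb
    rcases hp with hp | hp
    · exact hp ⟨by linarith [hb.1], by linarith [hb.2]⟩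
    · exact hp ha
  have hbL : ∀ t p, p.2 ∉ Ioo (0 : ℝ) (1 / 2) ∨ p.1 ∉ Ioo (0 : ℝ) 1 →
      toLower (F' t (toLower.symm p)) = p := by
    intro t p hp
    rw [hb', Homeomorph.apply_symm_apply]
    rintro ⟨ha, hb⟩
    have hb : 0 < 2 * p.2 ∧ 2 * p.2 < 1 := hb
    rcases hp with hp | hp
    · exact hp ⟨by linarith [hb.1], by linarith [hb.2]⟩
    · exact hp ha
  let U : unitInterval → Plane ≃ₜ Plane := fun t => (toUpper.symm.trans (F t)).trans toUpper
  let L : unitInterval → Plane ≃ₜ Plane := fun t => (toLower.symm.trans (F' t)).trans toLower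
  have hU : ∀ t p, p.2 ∉ Ioo (1 / 2 : ℝ) 1 ∨ p.1 ∉ Ioo (0 : ℝ) 1 → U t p = p := hbU
  have hL : ∀ t p, p.2 ∉ Ioo (0 : ℝ) (1 / 2) ∨ p.1 ∉ Ioo (0 : ℝ) 1 → L t p = p := hbL
  have hUc : Continuous fun q : unitInterval × Plane => U q.1 q.2 :=
    toUpper.continuous.comp (hc.comp
      (continuous_fst.prodMk (toUpper.symm.continuous.comp continuous_snd)))
  have hLc : Continuous fun q : unitInterval × Plane => L q.1 q.2 :=
    toLower.continuous.comp (hc'.comp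
      (continuous_fst.prodMk (toLower.symm.continuous.comp continuous_snd)))
  have hUup : ∀ t p, U t (toUpper p) = toUpper (F t p) := fun t p => by simp [U]
  have hLlo : ∀ t p, L t (toLower p) = toLower (F' t p) := fun t p => by simp [L]
  have hcar : ∀ p : Plane, p.2 ∈ Icc (0 : ℝ) 1 → L 1 (toLower p) = toLower (F' 1 p) ∧
      U 1 (toLower (F' 1 p)) = toLower (F' 1 p) := by
    intro p hp
    refine ⟨hLlo 1 p, hU 1 _ (Or.inl ?_)⟩
    have : (F' 1 p).2 ≤ 1 := by
      by_contra h
      have hq : F' 1 p ∉ openRect := fun h' => h h'.2.2.le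
      have := (F' 1).injective (hb' 1 _ hq)
      rw [this] at h
      exact h hp.2
    intro h
    have h : 1 / 2 < (F' 1 p).2 / 2 := h.1
    linarith
  have hcar' : ∀ p : Plane, p.2 ∈ Icc (0 : ℝ) 1 → L 1 (toUpper p) = toUpper p := by
    intro p hp
    refine hL 1 _ (Or.inl fun h => ?_)
    have h : (p.2 + 1) / 2 < 1 / 2 := h.2
    linarith [hp.1]
  have himg : ∀ A B : Set Plane, (∀ p ∈ A, p.2 ∈ Icc (0 : ℝ) 1) → (∀ p ∈ B, p.2 ∈ Icc (0 : ℝ) 1) →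
      ((L 1).trans (U 1)) '' (toUpper '' A ∪ toLower '' B) =
        toUpper '' (F 1 '' A) ∪ toLower '' (F' 1 '' B) := by
    intro A B hA hB
    rw [image_union, image_image, image_image, image_image, image_image]
    congr 1
    · refine image_congr fun p hp => ?_
      simp [hcar' p (hA p hp), hUup]
    · refine image_congr fun p hp => ?_
      simp [(hcar p (hB p hp)).1, (hcar p (hB p hp)).2]
  refine ⟨fun t => (L t).trans (U t), ?_, ?_, ?_, ?_, ?_⟩
  · exact hUc.comp (continuous_fst.prodMk hLc)
  · intro p; simp [U, L, h0, h0']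
  · intro t p hp
    have hp' : p.1 ∉ Ioo (0 : ℝ) 1 ∨ p.2 ∉ Ioo (0 : ℝ) 1 := by
      by_contra h; push Not at h; exact hp h
    have e1 : L t p = p := hL t p (hp'.symm.imp
      (fun h h' => h ⟨h'.1, h'.2.trans (by norm_num)⟩) id)
    have e2 : U t p = p := hU t p (hp'.symm.imp
      (fun h h' => h ⟨lt_trans (by norm_num) h'.1, h'.2⟩) id)
    simp [e1, e2]
  · simp only [stack]
    rw [← h1, ← h1']
    exact himg _ _ (fun p hp => (G.carrier_subset hp).2) (fun p hp => (H.carrier_subset hp).2)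
  · simp only [stack]
    rw [← h2, ← h2']
    exact himg _ _ (fun p hp => (G.carrier_subset (G.verts_subset hp)).2)
      (fun p hp => (H.carrier_subset (H.verts_subset hp)).2)

lemma stack_assoc (G H K : RectGraph n) :
    (stack (stack G H) K).IsIsotopic (stack G (stack H K)) := by
  let σ : ℝ → ℝ := fun y => max (y / 2) (max (y - 1 / 4) (2 * y - 1))
  have hG : ∀ p : Plane, p.2 ∈ Icc (0 : ℝ) 1 →
      ((toUpper (toUpper p)).1, σ (toUpper (toUpper p)).2) = toUpper p := by
    intro p hp
    have : σ (((p.2 + 1) / 2 + 1) / 2) = (p.2 + 1) / 2 := by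
      have h1 : ((p.2 + 1) / 2 + 1) / 2 - 1 / 4 ≤ 2 * (((p.2 + 1) / 2 + 1) / 2) - 1 := by
        linarith [hp.1]
      have h2 : ((p.2 + 1) / 2 + 1) / 2 / 2 ≤ 2 * (((p.2 + 1) / 2 + 1) / 2) - 1 := by
        linarith [hp.1]
      simp only [σ]
      rw [max_eq_right h1, max_eq_right h2]; ring
    exact Prod.ext rfl this
  have hH : ∀ p : Plane, p.2 ∈ Icc (0 : ℝ) 1 →
      ((toUpper (toLower p)).1, σ (toUpper (toLower p)).2) = toLower (toUpper p) := by
    intro p hp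
    have : σ ((p.2 / 2 + 1) / 2) = (p.2 + 1) / 2 / 2 := by
      have h1 : 2 * ((p.2 / 2 + 1) / 2) - 1 ≤ (p.2 / 2 + 1) / 2 - 1 / 4 := by
        linarith [hp.2]
      have h2 : (p.2 / 2 + 1) / 2 / 2 ≤ (p.2 / 2 + 1) / 2 - 1 / 4 := by
        linarith [hp.1]
      simp only [σ]
      rw [max_eq_left h1, max_eq_right h2]; ring
    exact Prod.ext rfl this
  have hK : ∀ p : Plane, p.2 ∈ Icc (0 : ℝ) 1 →
      ((toLower p).1, σ (toLower p).2) = toLower (toLower p) := by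
    intro p hp
    have : σ (p.2 / 2) = p.2 / 2 / 2 := by
      simp only [σ]
      rw [max_eq_left]
      refine max_le ?_ ?_ <;> linarith [hp.2]
    exact Prod.ext rfl this
  have himg : ∀ A B C : Set Plane, (∀ p ∈ A, p.2 ∈ Icc (0 : ℝ) 1) →
      (∀ p ∈ B, p.2 ∈ Icc (0 : ℝ) 1) → (∀ p ∈ C, p.2 ∈ Icc (0 : ℝ) 1) →
      (fun p : Plane => (p.1, σ p.2)) '' (toUpper '' (toUpper '' A ∪ toLower '' B) ∪ toLower '' C) =
        toUpper '' A ∪ toLower '' (toUpper '' B ∪ toLower '' C) := by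
    intro A B C hA hB hC
    simp only [image_union, image_image, union_assoc]
    congr 1
    · exact image_congr fun p hp => hG p (hA p hp)
    congr 1
    · exact image_congr fun p hp => hH p (hB p hp)
    · exact image_congr fun p hp => hK p (hC p hp)
  refine isIsotopic_of_reparam _ _ σ (by fun_prop) ?_ (by norm_num [σ]) (by norm_num [σ]) ?_ ?_
  · intro x y h
    simp only [σ]
    exact max_lt_max (by linarith) (max_lt_max (by linarith) (by linarith))
  · exact himg _ _ _ (fun p hp => (G.carrier_subset hp).2) (fun p hp => (H.carrier_subset hp).2)
      (fun p hp => (K.carrier_subset hp).2)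
  · exact himg _ _ _ (fun p hp => (G.carrier_subset (G.verts_subset hp)).2)
      (fun p hp => (H.carrier_subset (H.verts_subset hp)).2)
      (fun p hp => (K.carrier_subset (K.verts_subset hp)).2)

lemma strands_stack (G : RectGraph n) : G.IsIsotopic (stack (strands n) G) := by
  obtain ⟨ε, h0, h1, hG, -, hc, -⟩ := stack_collar G G
  have hs : (1 + ε) / (2 * ε) * ε = (1 + ε) / 2 := by field_simp
  have hs1 : 1 < (1 + ε) / (2 * ε) := by rw [lt_div_iff₀ (by positivity)]; linarith
  set s := (1 + ε) / (2 * ε)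
  let σ : ℝ → ℝ := fun y => max (y / 2) (1 - s * (1 - y))
  have hlo : ∀ y ≤ 1 - ε, σ y = y / 2 := fun y hy => by
    simp only [σ]; apply max_eq_left; nlinarith
  have hhi : ∀ y, 1 - ε ≤ y → σ y = 1 - s * (1 - y) := fun y hy => by
    simp only [σ]; apply max_eq_right; nlinarith
  have hmono : StrictMono σ := fun x y h => max_lt_max (by linarith) (by nlinarith)
  refine isIsotopic_of_reparam _ _ σ (by fun_prop) hmono ?_ ?_ ?_ ?_
  · rw [hlo 0 (by linarith)]; simp
  · rw [hhi 1 (by linarith)]; simp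
  · ext p
    constructor
    · rintro ⟨q, hq, rfl⟩
      have hq2 := (G.carrier_subset hq).2
      rcases le_total q.2 (1 - ε) with h | h
      · right
        rw [mem_toLower_image]
        simp only [hlo _ h]
        convert hq using 1
        ext <;> simp; ring
      · have hi := (hc q (Or.inr ⟨h, hq2.2⟩)).1 hq
        simp only [hhi _ h]
        have b1 : (1 - ε) / 2 ≤ 1 - s * (1 - q.2) := by nlinarith
        have b2 : 1 - s * (1 - q.2) ≤ 1 := by nlinarith [hq2.2]
        rcases le_total (1 - s * (1 - q.2)) (1 / 2) with h' | h'
        · right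
          rw [mem_toLower_image]
          exact (hc _ (Or.inr (by simp only [mem_Icc]; constructor <;> linarith))).2 hi
        · left
          rw [mem_toUpper_image]
          exact ⟨hi, by simp only [mem_Icc]; constructor <;> linarith⟩
    · have hbig : ∀ q : Plane, (∃ i, q.1 = strandPos n i) → q.2 ∈ Icc ((1 - ε) / 2) 1 →
          q ∈ (fun p : Plane => (p.1, σ p.2)) '' G.carrier := by
        intro q hi hq
        have hs0 : 0 < s := by linarith
        have e : 1 - ε ≤ 1 - (1 - q.2) / s := by
          have : (1 - q.2) / s ≤ ε := by rw [div_le_iff₀ hs0]; linarith [hq.1]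
          linarith
        refine ⟨(q.1, 1 - (1 - q.2) / s), (hc _ (Or.inr ⟨e, ?_⟩)).2 hi, ?_⟩
        · have : 0 ≤ (1 - q.2) / s := div_nonneg (by linarith [hq.2]) hs0.le
          simpa using this
        · simp only [hhi _ e]
          ext
          · rfl
          · simp only; field_simp; ring
      rintro (h | h)
      · have h2 := upper_of_mem _ h
        exact hbig p (mem_toUpper_image.1 h).1 ⟨by linarith [h2.1], h2.2⟩
      · have hp := mem_toLower_image.1 h
        have h2 := lower_of_mem _ h
        rcases le_total (2 * p.2) (1 - ε) with h' | h'
        · exact ⟨_, hp, by simp [hlo _ h']⟩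
        · exact hbig p ((hc (p.1, 2 * p.2) (Or.inr ⟨h', by simp only; linarith [h2.2]⟩)).1 hp)
            ⟨by linarith, by linarith [h2.2]⟩
  · simp only [stack, strands, image_empty, empty_union]
    refine image_congr fun p hp => ?_
    rw [hlo _ (hG p hp).2.le]; rfl

lemma stack_strands (G : RectGraph n) : G.IsIsotopic (stack G (strands n)) := by
  obtain ⟨ε, h0, h1, hG, -, hc, -⟩ := stack_collar G G
  have hs : (1 + ε) / (2 * ε) * ε = (1 + ε) / 2 := by field_simp
  have hs1 : 1 < (1 + ε) / (2 * ε) := by rw [lt_div_iff₀ (by positivity)]; linarith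
  set s := (1 + ε) / (2 * ε)
  let σ : ℝ → ℝ := fun y => min (s * y) ((y + 1) / 2)
  have hlo : ∀ y ≤ ε, σ y = s * y := fun y hy => by
    simp only [σ]; apply min_eq_left; nlinarith
  have hhi : ∀ y, ε ≤ y → σ y = (y + 1) / 2 := fun y hy => by
    simp only [σ]; apply min_eq_right; nlinarith
  have hmono : StrictMono σ := fun x y h => min_lt_min (by nlinarith) (by linarith)
  refine isIsotopic_of_reparam _ _ σ (by fun_prop) hmono ?_ ?_ ?_ ?_
  · rw [hlo 0 (by linarith)]; simp
  · rw [hhi 1 (by linarith)]; norm_num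
  · ext p
    constructor
    · rintro ⟨q, hq, rfl⟩
      have hq2 := (G.carrier_subset hq).2
      rcases le_total q.2 ε with h | h
      · have hi := (hc q (Or.inl ⟨hq2.1, h⟩)).1 hq
        simp only [hlo _ h]
        have b1 : s * q.2 ≤ (1 + ε) / 2 := by nlinarith
        have b2 : 0 ≤ s * q.2 := by nlinarith [hq2.1]
        rcases le_total (s * q.2) (1 / 2) with h' | h'
        · right
          rw [mem_toLower_image]
          exact ⟨hi, by simp only [mem_Icc]; constructor <;> linarith⟩
        · left
          rw [mem_toUpper_image]
          exact (hc _ (Or.inl (by simp only [mem_Icc]; constructor <;> linarith))).2 hi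
      · left
        rw [mem_toUpper_image]
        simp only [hhi _ h]
        convert hq using 1
        ext <;> simp; ring
    · have hbig : ∀ q : Plane, (∃ i, q.1 = strandPos n i) → q.2 ∈ Icc 0 ((1 + ε) / 2) →
          q ∈ (fun p : Plane => (p.1, σ p.2)) '' G.carrier := by
        intro q hi hq
        have hs0 : 0 < s := by linarith
        have e : q.2 / s ≤ ε := by rw [div_le_iff₀ hs0]; linarith [hq.2]
        refine ⟨(q.1, q.2 / s), (hc _ (Or.inl ⟨div_nonneg hq.1 hs0.le, e⟩)).2 hi, ?_⟩
        simp only [hlo _ e]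
        ext
        · rfl
        · simp only; field_simp
      rintro (h | h)
      · have hp := mem_toUpper_image.1 h
        have h2 := upper_of_mem _ h
        rcases le_total ε (2 * p.2 - 1) with h' | h'
        · exact ⟨_, hp, by simp [hhi _ h']⟩
        · exact hbig p ((hc (p.1, 2 * p.2 - 1)
            (Or.inl ⟨by simp only; linarith [h2.1], h'⟩)).1 hp)
            ⟨by linarith [h2.1], by linarith⟩
      · have h2 := lower_of_mem _ h
        exact hbig p (mem_toLower_image.1 h).1 ⟨h2.1, by linarith [h2.2]⟩
  · simp only [stack, strands, image_empty, union_empty]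
    refine image_congr fun p hp => ?_
    rw [hhi _ (hG p hp).1.le]; rfl

end RectGraph

/-! ### The chromatic algebra -/

/-- The set of isotopy classes of graphs in the rectangle with `n` endpoints at the top and `n`
endpoints at the bottom. -/
def GraphClass (n : ℕ) : Type := Quotient (RectGraph.setoid n)

/-- Isotopy classes of graphs form a monoid under vertical stacking. -/
instance (n : ℕ) : Monoid (GraphClass n) where
  mul := Quotient.map₂ RectGraph.stack
    fun _ _ h _ _ h' => RectGraph.stack_isIsotopic h h'
  mul_assoc := by
    rintro ⟨G⟩ ⟨H⟩ ⟨K⟩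
    exact Quotient.sound (RectGraph.stack_assoc G H K)
  one := Quotient.mk _ (RectGraph.strands n)
  one_mul := by
    rintro ⟨G⟩
    exact (Quotient.sound (RectGraph.strands_stack G)).symm
  mul_one := by
    rintro ⟨G⟩
    exact (Quotient.sound (RectGraph.stack_strands G)).symm

/-- The free algebra `F_n` over `k`, with additive basis the isotopy classes of graphs and with
multiplication given by vertical stacking. -/
abbrev FreeGraphAlgebra (k : Type*) [CommRing k] (n : ℕ) : Type _ := MonoidAlgebra k (GraphClass n)

/-- The additive generator of the free algebra given by the graph `G`. -/
def freeGen (k : Type*) [CommRing k] {n : ℕ} (G : RectGraph n) : FreeGraphAlgebra k n :=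
  MonoidAlgebra.of k (GraphClass n) (Quotient.mk _ G)

/-- The defining relations of the chromatic algebra, for the parameter `Q`: the
contraction-deletion relation `G = G / e - G \ e` for inner edges that are not loops, the relation
`G = (Q - 1) (G \ e)` for inner loops, and `G = 0` for graphs with a `1`-valent vertex. -/
inductive Rel {k : Type*} [CommRing k] (Q : k) {n : ℕ} :
    FreeGraphAlgebra k n → FreeGraphAlgebra k n → Prop
  | contraction_deletion (G G₁ G₂ : RectGraph n) (e : Set Plane) (he : G.IsInnerEdge e)
      (hl : ¬ G.IsLoop e) (h₁ : G.IsContraction e G₁) (h₂ : G.IsDeletion e G₂) :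
      Rel Q (freeGen k G) (freeGen k G₁ - freeGen k G₂)
  | loop (G G₂ : RectGraph n) (e : Set Plane) (he : G.IsInnerEdge e) (hl : G.IsLoop e)
      (h₂ : G.IsDeletion e G₂) : Rel Q (freeGen k G) ((Q - 1) • freeGen k G₂)
  | one_valent (G : RectGraph n) (v : Plane) (hv : v ∈ G.verts) (h : HasValence G.carrier v 1) :
      Rel Q (freeGen k G) 0

/-- The chromatic algebra in degree `n` over `k` with parameter `Q ∈ k`: the quotient of the free
algebra by the two-sided ideal generated by the defining relations.  The chromatic algebra `C_n` is
the case of the indeterminate `Q = X` in `k = ℂ[X]`. -/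
abbrev ChromAlg {k : Type*} [CommRing k] (Q : k) (n : ℕ) : Type _ := RingQuot (Rel Q (n := n))

/-- The additive generator of the chromatic algebra given by the graph `G`. -/
def gen {k : Type*} [CommRing k] (Q : k) {n : ℕ} (G : RectGraph n) : ChromAlg Q n :=
  RingQuot.mkAlgHom k (Rel Q) (freeGen k G)

/-! ### Closures -/

/-- The arc in the complement of the rectangle which joins the `i`-th marked point at the top to the
`i`-th marked point at the bottom: the boundary of the rectangle
`[x, 2 - x] × [-(1 - x), 2 - x]` without the open segment `{x} × (0, 1)`, where `x` is the position
of the marked points. -/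
def closingArc (n : ℕ) (i : Fin n) : Set Plane :=
  {p | max |p.1 - 1| (|p.2 - 1 / 2| - 1 / 2) = 1 - strandPos n i ∧
    ¬ (p.1 = strandPos n i ∧ p.2 ∈ Ioo 0 1)}

/-- The underlying set of the closure of `G`, a graph in the plane with the same vertices as `G`. -/
def RectGraph.closureCarrier {n : ℕ} (G : RectGraph n) : Set Plane :=
  G.carrier ∪ ⋃ i, closingArc n i

/-- The dual graph of the closure of `G`; its vertices are the components of the complement of the
closure in the plane. -/
def RectGraph.closureDual {n : ℕ} (G : RectGraph n) : Graph (Set Plane) (Set Plane) :=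
  dualOf univ G.closureCarrier G.verts

end ChromaticAlgebra

end

/-! The dual graph turns the defining relations of the algebra into identities of chromatic
polynomials. Deleting an edge merges the two regions beside it, that is, contracts the dual edge
(`isIsoTo_contractEdge`). Contracting an edge that ends at a vertex leaves the regions as they are
and only removes the dual edge (`isIsoTo_deleteEdges`). Hence the contraction-deletion relation
becomes the classical formula for the dual, obtained by splitting the sum over edge sets according
to whether they contain the dual edge. A loop has different regions on its two sides, and no other
edge crosses from one side to the other; so its dual edge is a bridge, and contracting a bridge
costs a factor `Q - 1`. Near a `1`-valent vertex the graph does not separate the plane, so the edge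
ending there is dual to a loop. For a loop, contraction and deletion agree, and the polynomial
vanishes.

The topological core is `Tame.exists_separation`: a loop separates its sides. It rests on
`exists_separatesAt_of_isClosed`: a closed, locally two-sided subset of the plane has two global
sides. Locally a side can be chosen, and two choices differ by a sign. The choices are glued over
small rectangles along segments, whose connectedness leaves only one sign to adjust, and then over
growing squares. If the loop has a base vertex, an inversion moves that vertex to infinity, which
makes the punctured curve closed.

The combinatorics of regions is developed once, for `Tame` graphs in a convex part `Y` of the plane.
It is applied with `Y` the rectangle, and with `Y` the whole plane for closures. A closure is tame
because the closing arcs continue the strands smoothly enough to be two-sided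
(`hasValence_closureCarrier`), and an inner edge of the graph is still an edge of the closure.

On the algebraic side, the relations are stable under stacking a graph above or below
(`IsInsertion`, `Rel.mul_left`, `Rel.mul_right`). So an isotopy invariant that respects the
relations kills the whole two-sided ideal and descends to the quotient (`existsUnique_linearMap`);
it is unique because graphs span. For the trace over `ℂ[Q]` one divides by `Q`, which is possible
since every edge set has at least one component. -/

noncomputable section

/-! ### Chromatic polynomials: isomorphism invariance, contraction-deletion, loops and bridges. -/

namespace Graph

variable {α β α' β' : Type*}

lemma chromaticPolynomial_eq_finsum_powerset (Γ : Graph α β) :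
    Γ.chromaticPolynomial =
      ∑ᶠ S ∈ 𝒫 Γ.edgeSet, (-1 : ℂ[X]) ^ S.ncard * X ^ Γ.numComponents S := rfl

/-- The set of edges which corresponds to `S` under a bijection of the edge sets. -/
def transportEdges {E : Set β} {E' : Set β'} (g : E ≃ E') (S : Set β) : Set β' :=
  {e' | ∃ e : E, e.1 ∈ S ∧ (g e).1 = e'}

lemma transportEdges_symm {E : Set β} {E' : Set β'} (g : E ≃ E') {S : Set β} (hS : S ⊆ E) :
    transportEdges g.symm (transportEdges g S) = S := by
  ext e
  constructor
  · rintro ⟨e', ⟨e₁, h₁, h₂⟩, rfl⟩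
    have : e' = g e₁ := Subtype.ext h₂.symm
    subst this
    simpa using h₁
  · intro he
    exact ⟨g ⟨e, hS he⟩, ⟨⟨e, hS he⟩, he, rfl⟩, by simp⟩

lemma transportEdges_subset {E : Set β} {E' : Set β'} (g : E ≃ E') (S : Set β) :
    transportEdges g S ⊆ E' := by
  rintro _ ⟨e, -, rfl⟩
  exact (g e).2

lemma ncard_transportEdges {E : Set β} {E' : Set β'} (g : E ≃ E') {S : Set β} (hS : S ⊆ E) :
    (transportEdges g S).ncard = S.ncard := by
  symm
  refine Set.ncard_congr (fun e he => (g ⟨e, hS he⟩).1) ?_ ?_ ?_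
  · intro e he
    exact ⟨⟨e, hS he⟩, he, rfl⟩
  · intro a b ha hb h
    simpa using g.injective (Subtype.ext h)
  · rintro _ ⟨e, he, rfl⟩
    exact ⟨e.1, he, rfl⟩

lemma IsIsoTo.chromaticPolynomial_eq {Γ : Graph α β} {Δ : Graph α' β'} (h : Γ.IsIsoTo Δ) :
    Γ.chromaticPolynomial = Δ.chromaticPolynomial := by
  obtain ⟨f, g, hfg⟩ := h
  rw [chromaticPolynomial_eq_finsum_powerset, chromaticPolynomial_eq_finsum_powerset]
  refine finsum_mem_eq_of_bijOn (transportEdges g)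
    (Set.InvOn.bijOn (f' := transportEdges g.symm) ⟨?_, ?_⟩ ?_ ?_) ?_
  · intro S hS
    exact transportEdges_symm g hS
  · intro S hS
    simpa using transportEdges_symm g.symm hS
  · intro S _
    exact transportEdges_subset g S
  · intro S _
    exact transportEdges_subset g.symm S
  · intro S hS
    rw [ncard_transportEdges g hS]
    congr 2
    refine Nat.card_congr (Quot.congr f fun x y => ?_)
    constructor
    · rintro ⟨e, he, hl⟩
      exact ⟨_, ⟨⟨e, hS he⟩, he, rfl⟩, (hfg ⟨e, hS he⟩ x y).1 hl⟩
    · rintro ⟨_, ⟨e, he, rfl⟩, hl⟩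
      exact ⟨e.1, he, (hfg e x y).2 hl⟩

lemma IsIsoTo.symm {Γ : Graph α β} {Δ : Graph α' β'} (h : Γ.IsIsoTo Δ) : Δ.IsIsoTo Γ := by
  obtain ⟨f, g, hfg⟩ := h
  exact ⟨f.symm, g.symm, fun e x y => by simpa using (hfg (g.symm e) (f.symm x) (f.symm y)).symm⟩

/-- Every edge set `S` gives at least one component. -/
lemma numComponents_pos {Γ : Graph α β} (hV : Γ.vertexSet.Finite) (hne : Γ.vertexSet.Nonempty)
    (S : Set β) : 0 < Γ.numComponents S := by
  have := hV.to_subtype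
  have : Nonempty (Quot fun x y : Γ.vertexSet => ∃ e ∈ S, Γ.IsLink e x y) :=
    hne.to_subtype.map (Quot.mk _)
  have : Finite (Quot fun x y : Γ.vertexSet => ∃ e ∈ S, Γ.IsLink e x y) := Quot.finite _
  exact Nat.card_pos

/-- Every summand has a positive power of `X`; this is what allows the trace to be divided by `Q`.
Finiteness enters because `Nat.card` of an infinite set of components would be `0`. -/
lemma X_dvd_chromaticPolynomial {Γ : Graph α β} (hV : Γ.vertexSet.Finite)
    (hne : Γ.vertexSet.Nonempty) : X ∣ Γ.chromaticPolynomial := by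
  rw [chromaticPolynomial_eq_finsum_powerset]
  refine finsum_mem_induction (fun p : ℂ[X] => X ∣ p) (dvd_zero _) (fun _ _ => dvd_add) ?_
  intro S _
  exact dvd_mul_of_dvd_right (dvd_pow_self _ (numComponents_pos hV hne S).ne') _

section Contract

variable {Γ : Graph α β} {e : β} {a b : α}

open Classical in
lemma contractEdge_vertexSet : (Γ.contractEdge e a b).vertexSet =
    (fun x => if x = b then a else x) '' Γ.vertexSet := rfl

lemma contractEdge_edgeSet : (Γ.contractEdge e a b).edgeSet = Γ.edgeSet \ {e} := rfl

open Classical in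
lemma contractEdge_isLink {e' : β} {x y : α} : (Γ.contractEdge e a b).IsLink e' x y ↔
    ∃ u v, Γ.IsLink e' u v ∧ e' ≠ e ∧ (if u = b then a else u) = x ∧ (if v = b then a else v) = y := by
  constructor
  · rintro ⟨u, v, ⟨h, h'⟩, rfl, rfl⟩
    exact ⟨u, v, h, h', rfl, rfl⟩
  · rintro ⟨u, v, h, h', rfl, rfl⟩
    exact ⟨u, v, ⟨h, h'⟩, rfl, rfl⟩

open Classical in
/-- The quotient map to the contracted graph. -/
def toContract (Γ : Graph α β) (e : β) (a b : α) (x : Γ.vertexSet) :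
    (Γ.contractEdge e a b).vertexSet := ⟨if x.1 = b then a else x.1, x.1, x.2, rfl⟩

lemma toContract_surjective : Function.Surjective (toContract Γ e a b) := by
  rintro ⟨_, x, hx, rfl⟩
  exact ⟨⟨x, hx⟩, rfl⟩

lemma numComponents_deleteEdges {S : Set β} {F : Set β} (h : Disjoint S F) :
    (Γ.deleteEdges F).numComponents S = Γ.numComponents S := by
  refine Nat.card_congr (Quot.congr (Equiv.refl _) fun x y => ?_)
  constructor
  · rintro ⟨e', he', hl⟩
    exact ⟨e', he', hl.1⟩
  · rintro ⟨e', he', hl⟩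
    exact ⟨e', he', hl, Set.disjoint_left.1 h he'⟩

/-- The only distinct vertices that contraction can identify are `a` and `b`, and `r` already
relates these two. -/
lemma quot_eq_of_toContract_eq {r : Γ.vertexSet → Γ.vertexSet → Prop}
    (hl : Γ.IsLink e a b) (hr : r ⟨a, hl.left_mem⟩ ⟨b, hl.right_mem⟩) {x y : Γ.vertexSet}
    (h : toContract Γ e a b x = toContract Γ e a b y) : Quot.mk r x = Quot.mk r y := by
  have hab := Quot.sound hr
  have h' := congrArg Subtype.val h
  obtain ⟨x, hx⟩ := x
  obtain ⟨y, hy⟩ := y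
  simp only [toContract] at h'
  split_ifs at h' with h1 h2 h2
  · subst h1 h2; rfl
  · subst h1 h'; exact hab.symm
  · subst h2 h'; exact hab
  · subst h'; rfl

/-- Contraction of `e` computes the components for the edge sets which contain `e`. -/
lemma numComponents_contractEdge (hl : Γ.IsLink e a b) {S : Set β} (hS : e ∉ S) :
    (Γ.contractEdge e a b).numComponents S = Γ.numComponents (insert e S) := by
  symm
  refine Nat.card_congr (Equiv.ofBijective
    (Quot.lift (fun x => Quot.mk _ (toContract Γ e a b x)) ?_) ⟨?_, ?_⟩)
  · rintro x y ⟨e', rfl | he', h⟩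
    · have : toContract Γ e' a b x = toContract Γ e' a b y := by
        apply Subtype.ext
        obtain ⟨h1, h2⟩ | ⟨h1, h2⟩ := hl.eq_and_eq_or_eq_and_eq h
        · simp [toContract, ← h1, ← h2]
        · simp [toContract, ← h1, ← h2]
      rw [this]
    · refine Quot.sound ⟨e', he', contractEdge_isLink.2 ⟨_, _, h, ?_, rfl, rfl⟩⟩
      rintro rfl
      exact hS he'
  · let r : Γ.vertexSet → Γ.vertexSet → Prop := fun x y => ∃ e' ∈ insert e S, Γ.IsLink e' x y
    have hr : r ⟨a, hl.left_mem⟩ ⟨b, hl.right_mem⟩ := ⟨e, mem_insert _ _, hl⟩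
    -- Any section of the contraction map induces an inverse on components, because its ambiguity
    -- disappears once `e` is among the edges.
    let σ : (Γ.contractEdge e a b).vertexSet → Γ.vertexSet :=
      Function.surjInv toContract_surjective
    have hσ : ∀ z, toContract Γ e a b (σ z) = z := Function.surjInv_eq _
    let G : Quot (fun x y : (Γ.contractEdge e a b).vertexSet =>
        ∃ e' ∈ S, (Γ.contractEdge e a b).IsLink e' x y) →
        Quot (fun x y : Γ.vertexSet => ∃ e' ∈ insert e S, Γ.IsLink e' x y) :=
      Quot.lift (fun z => Quot.mk _ (σ z)) (by
        rintro x y ⟨e', he', h⟩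
        obtain ⟨u, v, huv, -, hu, hv⟩ := contractEdge_isLink.1 h
        have h1 := quot_eq_of_toContract_eq (r := r) (x := σ x) (y := ⟨u, huv.left_mem⟩) hl hr
          (by rw [hσ]; exact Subtype.ext hu.symm)
        have h2 := quot_eq_of_toContract_eq (r := r) (x := σ y) (y := ⟨v, huv.right_mem⟩) hl hr
          (by rw [hσ]; exact Subtype.ext hv.symm)
        refine h1.trans (Eq.trans ?_ h2.symm)
        exact Quot.sound ⟨e', mem_insert_of_mem _ he', huv⟩)
    refine Function.LeftInverse.injective (g := G) ?_
    rintro ⟨x⟩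
    exact quot_eq_of_toContract_eq (r := r) hl hr (hσ _)
  · rintro ⟨z⟩
    obtain ⟨x, rfl⟩ := toContract_surjective z
    exact ⟨Quot.mk _ x, rfl⟩

/-- The contraction-deletion formula. -/
lemma chromaticPolynomial_eq_sub (hE : Γ.edgeSet.Finite) (hl : Γ.IsLink e a b) :
    Γ.chromaticPolynomial =
      (Γ.deleteEdges {e}).chromaticPolynomial - (Γ.contractEdge e a b).chromaticPolynomial := by
  classical
  rw [chromaticPolynomial_eq_finsum_powerset, chromaticPolynomial_eq_finsum_powerset,
    chromaticPolynomial_eq_finsum_powerset, contractEdge_edgeSet]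
  change _ = (∑ᶠ S ∈ 𝒫 (Γ.edgeSet \ {e}), _) - _
  have hE' : (𝒫 (Γ.edgeSet \ {e})).Finite := (hE.subset sdiff_subset).finite_subsets
  have he : e ∈ Γ.edgeSet := hl.edge_mem
  -- The edge sets without `e` give the deletion; those of the form `insert e S` give the
  -- contraction, with a minus sign since they have one more element.
  have hu : 𝒫 Γ.edgeSet = 𝒫 (Γ.edgeSet \ {e}) ∪ (insert e) '' 𝒫 (Γ.edgeSet \ {e}) := by
    conv_lhs => rw [← insert_eq_of_mem he, ← insert_sdiff_singleton]
    exact powerset_insert _ _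
  have hnot : ∀ S ∈ 𝒫 (Γ.edgeSet \ {e}), e ∉ S := fun S hS h => (hS h).2 rfl
  rw [hu, finsum_mem_union _ hE' (hE'.image _), finsum_mem_image, sub_eq_add_neg,
    ← finsum_mem_neg_distrib _ hE']
  · congr 1
    · refine finsum_mem_congr rfl fun S hS => ?_
      rw [numComponents_deleteEdges (by simpa using hnot S hS)]
    · refine finsum_mem_congr rfl fun S hS => ?_
      rw [numComponents_contractEdge hl (hnot S hS),
        Set.ncard_insert_of_notMem (hnot S hS) (hE.subset (hS.trans sdiff_subset))]
      ring
  · intro S hS T hT h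
    have h' : insert e S \ {e} = insert e T \ {e} := congrArg (· \ {e}) h
    rwa [insert_sdiff_self_of_notMem (hnot S hS), insert_sdiff_self_of_notMem (hnot T hT)] at h'
  · rw [Set.disjoint_left]
    rintro _ hS ⟨T, -, rfl⟩
    exact hnot _ hS (mem_insert _ _)

lemma contractEdge_self : Γ.contractEdge e a a = Γ.deleteEdges {e} := by
  classical
  refine Eq.trans ?_ (Graph.map_id (G := Γ.deleteEdges {e}))
  refine Graph.map_eq_of_eqOn fun x _ => ?_
  simp only [ite_eq_right_iff, id]
  exact Eq.symm

/-- Contracting a loop is deleting it, so the two terms of contraction-deletion cancel. -/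
lemma chromaticPolynomial_eq_zero_of_isLink_self (hE : Γ.edgeSet.Finite) (hl : Γ.IsLink e a a) :
    Γ.chromaticPolynomial = 0 := by
  rw [chromaticPolynomial_eq_sub hE hl, contractEdge_self, sub_self]

/-- If the ends of `e` are separated by `c`, and no other edge joins vertices which are separated
by `c`, then `e` is a bridge. -/
lemma numComponents_contractEdge_add_one (hV : Γ.vertexSet.Finite) (hl : Γ.IsLink e a b)
    (c : α → Prop) (hc : c a ≠ c b) (hc' : ∀ e' x y, e' ≠ e → Γ.IsLink e' x y → c x = c y)
    {S : Set β} (hS : e ∉ S) :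
    (Γ.contractEdge e a b).numComponents S + 1 = Γ.numComponents S := by
  classical
  have := hV.to_subtype
  set r : Γ.vertexSet → Γ.vertexSet → Prop := fun x y => ∃ e ∈ S, Γ.IsLink e x y with hr
  set r' : (Γ.contractEdge e a b).vertexSet → (Γ.contractEdge e a b).vertexSet → Prop :=
    fun x y => ∃ e' ∈ S, (Γ.contractEdge e a b).IsLink e' x y with hr'
  let A : Quot r := Quot.mk r ⟨a, hl.left_mem⟩
  let B : Quot r := Quot.mk r ⟨b, hl.right_mem⟩
  have hAB : A ≠ B := by
    -- No edge of `S` changes `c`, so `c` is defined on components and distinguishes `A` from `B`.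
    let C : Quot r → Prop := Quot.lift (fun x => c x.1) (by
      rintro x y ⟨e', he', h⟩
      exact hc' e' _ _ (fun h => hS (h ▸ he')) h)
    intro h
    exact hc (congrArg C h)
  have hmk : ∀ x : Γ.vertexSet, Quot.mk r x ≠ B → (toContract Γ e a b x).1 = x.1 := by
    intro x hx
    have : x.1 ≠ b := by
      rintro h
      exact hx (congrArg (Quot.mk r) (Subtype.ext h))
    simp [toContract, this]
  -- The component of `b` is redirected to that of `a`, so the image avoids `B`. The outer `else A`
  -- is a mere default: vertices of the contraction are vertices of `Γ`.
  let h : (Γ.contractEdge e a b).vertexSet → Quot r := fun z =>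
    if hz : z.1 ∈ Γ.vertexSet then (if Quot.mk r ⟨z.1, hz⟩ = B then A else Quot.mk r ⟨z.1, hz⟩)
    else A
  have hto : ∀ x : Γ.vertexSet, h (toContract Γ e a b x) =
      if Quot.mk r x = B then A else Quot.mk r x := by
    rintro ⟨x, hx⟩
    by_cases hxb : x = b
    · subst hxb
      have : (toContract Γ e a x ⟨x, hx⟩).1 = a := by simp [toContract]
      simp only [h, this, hl.left_mem, dite_true]
      rw [if_neg hAB, if_pos rfl]
    · have : (toContract Γ e a b ⟨x, hx⟩).1 = x := by simp [toContract, hxb]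
      simp only [h, this, hx, dite_true]
  let H : Quot r' → Quot r := Quot.lift h (by
    rintro x y ⟨e', he', hxy⟩
    obtain ⟨u, v, huv, -, hu, hv⟩ := contractEdge_isLink.1 hxy
    have h1 : x = toContract Γ e a b ⟨u, huv.left_mem⟩ := Subtype.ext hu.symm
    have h2 : y = toContract Γ e a b ⟨v, huv.right_mem⟩ := Subtype.ext hv.symm
    have h3 : Quot.mk r ⟨u, huv.left_mem⟩ = Quot.mk r ⟨v, huv.right_mem⟩ :=
      Quot.sound ⟨e', he', huv⟩
    rw [h1, h2, hto, hto, h3])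
  let K : Quot r → Quot r' := Quot.lift (fun x => Quot.mk r' (toContract Γ e a b x)) (by
    rintro x y ⟨e', he', hxy⟩
    refine Quot.sound ⟨e', he', contractEdge_isLink.2 ⟨_, _, hxy, ?_, rfl, rfl⟩⟩
    rintro rfl
    exact hS he')
  have hHK : ∀ q, H (K q) = if q = B then A else q := by
    rintro ⟨x⟩
    exact hto x
  have hKH : ∀ q, K (H q) = q := by
    rintro ⟨z⟩
    obtain ⟨x, rfl⟩ := toContract_surjective z
    change K (h _) = _
    rw [hto]
    split_ifs with hx
    · change K A = K (Quot.mk r x)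
      rw [hx]
      exact congrArg (Quot.mk r') (Subtype.ext (by simp [toContract]))
    · rfl
  have hHB : ∀ q, H q ≠ B := by
    rintro ⟨z⟩
    obtain ⟨x, rfl⟩ := toContract_surjective z
    change h _ ≠ _
    rw [hto]
    split_ifs with hx
    · exact hAB
    · exact hx
  -- Contraction loses exactly the component `B`, which merges with `A`.
  let E : Quot r' ≃ {q : Quot r // q ≠ B} :=
    { toFun := fun q => ⟨H q, hHB q⟩
      invFun := fun q => K q.1
      left_inv := hKH
      right_inv := fun q => Subtype.ext (by simp [hHK, q.2]) }
  have hfin : Finite (Quot r) := Quot.finite _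
  have e1 : Nat.card (Quot r') = Nat.card {q : Quot r // q ≠ B} := Nat.card_congr E
  change Nat.card (Quot r') + 1 = Nat.card (Quot r)
  rw [e1, ← Nat.card_congr (Equiv.optionSubtypeNe B), Finite.card_option]

/-- Without the bridge there is always one component more than in the contraction, so the deletion
contributes `X` times the contraction; subtracting the contraction leaves `X - 1`. -/
lemma chromaticPolynomial_eq_of_bridge (hV : Γ.vertexSet.Finite) (hE : Γ.edgeSet.Finite)
    (hl : Γ.IsLink e a b) (c : α → Prop) (hc : c a ≠ c b)
    (hc' : ∀ e' x y, e' ≠ e → Γ.IsLink e' x y → c x = c y) :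
    Γ.chromaticPolynomial = (X - 1) * (Γ.contractEdge e a b).chromaticPolynomial := by
  have hE' : (𝒫 (Γ.edgeSet \ {e})).Finite := (hE.subset sdiff_subset).finite_subsets
  have : (Γ.deleteEdges {e}).chromaticPolynomial =
      X * (Γ.contractEdge e a b).chromaticPolynomial := by
    rw [chromaticPolynomial_eq_finsum_powerset, chromaticPolynomial_eq_finsum_powerset,
      contractEdge_edgeSet]
    rw [mul_finsum_mem' _ _ hE']
    refine finsum_mem_congr rfl fun S hS => ?_
    have hS' : e ∉ S := fun h => (hS h).2 rfl
    rw [numComponents_deleteEdges (by simpa using hS'),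
      ← numComponents_contractEdge_add_one hV hl c hc hc' hS']
    ring
  rw [chromaticPolynomial_eq_sub hE hl, this]
  ring

/-- Contracting a pendant edge amounts to deleting its pendant vertex. -/
lemma contractEdge_eq_deleteVerts (hl : Γ.IsLink e a b) (hab : a ≠ b)
    (h : ∀ e' x, Γ.IsLink e' x b → e' = e) : Γ.contractEdge e a b = Γ.deleteVerts {b} := by
  classical
  refine Graph.ext ?_ ?_
  · rw [vertexSet_deleteVerts, contractEdge_vertexSet]
    ext x
    constructor
    · rintro ⟨y, hy, rfl⟩
      simp only
      split_ifs with hyb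
      · exact ⟨hl.left_mem, hab⟩
      · exact ⟨hy, hyb⟩
    · rintro ⟨hx, hxb⟩
      exact ⟨x, hx, if_neg hxb⟩
  · intro e' x y
    rw [contractEdge_isLink, deleteVerts_isLink]
    constructor
    · rintro ⟨u, v, huv, he', rfl, rfl⟩
      have hu : u ≠ b := by rintro rfl; exact he' (h _ _ huv.symm)
      have hv : v ≠ b := by rintro rfl; exact he' (h _ _ huv)
      simp [hu, hv, huv]
    · rintro ⟨hxy, hx, hy⟩
      refine ⟨x, y, hxy, ?_, if_neg hx, if_neg hy⟩
      rintro rfl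
      obtain ⟨-, h2⟩ | ⟨h1, -⟩ := hl.eq_and_eq_or_eq_and_eq hxy
      · exact hy h2.symm
      · exact hy (by by_contra; exact hx (hl.right_unique (h1 ▸ hxy.symm)).symm)

end Contract

end Graph

/-! ### Connected components of subsets -/

section Components

variable {α : Type*} [TopologicalSpace α] {F C D T : Set α} {p : α}

/-- The connected components of the subset `F`. -/
def componentsIn (F : Set α) : Set (Set α) := {C | ∃ p ∈ F, C = connectedComponentIn F p}

lemma exists_mem_componentsIn (hp : p ∈ F) : ∃ C ∈ componentsIn F, p ∈ C :=
  ⟨_, ⟨p, hp, rfl⟩, mem_connectedComponentIn hp⟩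

namespace componentsIn

lemma nonempty (hC : C ∈ componentsIn F) : C.Nonempty := by
  obtain ⟨p, hp, rfl⟩ := hC
  exact ⟨p, mem_connectedComponentIn hp⟩

lemma isPreconnected (hC : C ∈ componentsIn F) : IsPreconnected C := by
  obtain ⟨p, hp, rfl⟩ := hC
  exact isPreconnected_connectedComponentIn

lemma subset (hC : C ∈ componentsIn F) : C ⊆ F := by
  obtain ⟨p, hp, rfl⟩ := hC
  exact connectedComponentIn_subset _ _

lemma eq_connectedComponentIn (hC : C ∈ componentsIn F) (hp : p ∈ C) :
    C = connectedComponentIn F p := by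
  obtain ⟨q, hq, rfl⟩ := hC
  exact connectedComponentIn_eq hp

lemma eq_of_mem (hC : C ∈ componentsIn F) (hD : D ∈ componentsIn F) (hp : p ∈ C) (hp' : p ∈ D) :
    C = D := by
  rw [eq_connectedComponentIn hC hp, eq_connectedComponentIn hD hp']

lemma subset_of_isPreconnected (hC : C ∈ componentsIn F) (hT : IsPreconnected T) (hTF : T ⊆ F)
    (h : (T ∩ C).Nonempty) : T ⊆ C := by
  obtain ⟨p, hpT, hpC⟩ := h
  rw [eq_connectedComponentIn hC hpC]
  exact hT.subset_connectedComponentIn hpT hTF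

lemma closure_inter_subset (hC : C ∈ componentsIn F) : closure C ∩ F ⊆ C := by
  obtain ⟨q, hq⟩ := nonempty hC
  refine subset_of_isPreconnected hC ?_ inter_subset_right
    ⟨q, ⟨subset_closure hq, subset hC hq⟩, hq⟩
  exact (isPreconnected hC).subset_closure (subset_inter subset_closure (subset hC))
    inter_subset_left

end componentsIn

/-- Here `O` witnesses that `C` is relatively open and `hcl` that it is relatively closed. If `T`
left `C`, it would be disconnected by `O` and the complement of `closure C`. -/
lemma IsPreconnected.subset_of_relClopen {O : Set α} (hT : IsPreconnected T) (hTF : T ⊆ F)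
    (hO : IsOpen O) (hOC : O ∩ F ⊆ C) (hCO : C ⊆ O) (hcl : closure C ∩ F ⊆ C)
    (h : (T ∩ C).Nonempty) : T ⊆ C := by
  intro q hq
  by_contra hqC
  have hv : q ∉ closure C := fun h => hqC (hcl ⟨h, hTF hq⟩)
  obtain ⟨r, hrT, hrO, hr⟩ := hT O (closure C)ᶜ hO isClosed_closure.isOpen_compl (fun r hr => by
    by_cases h : r ∈ closure C
    · exact Or.inl (hCO (hcl ⟨h, hTF hr⟩))
    · exact Or.inr h) (h.mono (inter_subset_inter_right _ hCO)) ⟨q, hq, hv⟩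
  exact hr (subset_closure (hOC ⟨hrO, hTF hrT⟩))

/-- This criterion recognizes regions and edges again after the graph has been changed elsewhere. -/
lemma mem_componentsIn_of_relClopen {O : Set α} (hC : IsPreconnected C) (hne : C.Nonempty)
    (hCF : C ⊆ F) (hO : IsOpen O) (hOC : O ∩ F ⊆ C) (hCO : C ⊆ O) (hcl : closure C ∩ F ⊆ C) :
    C ∈ componentsIn F := by
  obtain ⟨p, hp⟩ := hne
  refine ⟨p, hCF hp, (hC.subset_connectedComponentIn hp hCF).antisymm ?_⟩
  exact isPreconnected_connectedComponentIn.subset_of_relClopen (connectedComponentIn_subset _ _)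
    hO hOC hCO hcl ⟨p, mem_connectedComponentIn (hCF hp), hp⟩

/-- Components of a locally connected set are relatively open. -/
lemma componentsIn.exists_isOpen (hC : C ∈ componentsIn F)
    (h : ∀ p ∈ C, ∃ N ∈ nhds p, IsPreconnected (N ∩ F)) : ∃ O, IsOpen O ∧ O ∩ F = C := by
  choose! N hN hN' using h
  refine ⟨⋃ p ∈ C, interior (N p), isOpen_biUnion fun p _ => isOpen_interior, ?_⟩
  ext q
  simp only [mem_inter_iff, mem_iUnion, exists_prop]
  constructor
  · rintro ⟨⟨p, hp, hq⟩, hqF⟩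
    exact componentsIn.subset_of_isPreconnected hC (hN' p hp) inter_subset_right
      ⟨p, ⟨mem_of_mem_nhds (hN p hp), componentsIn.subset hC hp⟩, hp⟩ ⟨interior_subset hq, hqF⟩
  · intro hq
    exact ⟨⟨q, hq, mem_interior_iff_mem_nhds.2 (hN q hq)⟩, componentsIn.subset hC hq⟩

/-- Components correspond under a closed continuous map which is injective on `F`. -/
lemma image_connectedComponentIn_of_isClosedMap {β : Type*} [TopologicalSpace β] {f : α → β}
    (hf : Continuous f) (hcl : IsClosedMap f) (hF : ∀ x ∈ F, ∀ y, f x = f y → x = y) (hp : p ∈ F) :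
    f '' connectedComponentIn F p = connectedComponentIn (f '' F) (f p) := by
  have hfp := mem_image_of_mem f hp
  apply Subset.antisymm
  · exact (isPreconnected_connectedComponentIn.image f hf.continuousOn).subset_connectedComponentIn
      ⟨p, mem_connectedComponentIn hp, rfl⟩ (image_mono (connectedComponentIn_subset _ _))
  · set T := connectedComponentIn (f '' F) (f p)
    have hT : IsPreconnected T := isPreconnected_connectedComponentIn
    have hTF : T ⊆ f '' F := connectedComponentIn_subset _ _
    -- Over `T` the map is a closed continuous bijection, so connectedness can be pulled back.
    have hpre : IsPreconnected (f ⁻¹' T) := by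
      have h1 : IsClosedMap (T.restrictPreimage f) := hcl.restrictPreimage T
      have h2 : Function.Injective (T.restrictPreimage f) := by
        rintro ⟨x, hx⟩ ⟨y, hy⟩ h
        have h' : f x = f y := congrArg Subtype.val h
        obtain ⟨z, hz, hzx⟩ := hTF hx
        have h3 := hF z hz x hzx
        subst h3
        exact Subtype.ext (hF z hz y h')
      have := Subtype.preconnectedSpace hT
      have h3 := (isPreconnected_univ (α := T)).preimage_of_isClosedMap h2 h1 (by
        rintro ⟨y, hy⟩ -
        obtain ⟨z, hz, rfl⟩ := hTF hy
        exact ⟨⟨z, hy⟩, rfl⟩)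
      exact isPreconnected_iff_preconnectedSpace.2 ⟨h3⟩
    have hsub : f ⁻¹' T ⊆ F := by
      intro x hx
      obtain ⟨z, hz, hzx⟩ := hTF hx
      rwa [← hF z hz x hzx]
    have := hpre.subset_connectedComponentIn (mem_connectedComponentIn hfp) hsub
    intro y hy
    obtain ⟨z, hz, rfl⟩ := hTF hy
    exact ⟨z, this hy, rfl⟩

end Components

/-! ### Local structure of plane graphs -/

section TwoSided

variable {α β : Type*} [TopologicalSpace α] [TopologicalSpace β]

/-- Near `p`, the set `E` is connected and has exactly two local sides. -/
def TwoSidedAt (E : Set α) (p : α) : Prop :=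
  ∀ U ∈ nhds p, ∃ N ⊆ U, IsOpen N ∧ p ∈ N ∧ IsPreconnected (N ∩ E) ∧
    ∃ S T, IsOpen S ∧ IsOpen T ∧ Disjoint S T ∧ IsPreconnected S ∧ IsPreconnected T ∧
      N \ E = S ∪ T ∧ N ∩ E ⊆ closure S ∩ closure T

/-- Two-sidedness is a local topological property: the neighbourhood is chosen inside the target of
the chart, so that it and its two sides can be carried back. -/
lemma TwoSidedAt.of_openPartialHomeomorph {E : Set α} {E' : Set β} {p : α}
    (φ : OpenPartialHomeomorph α β) (hp : p ∈ φ.source) (hE : ∀ q ∈ φ.source, q ∈ E ↔ φ q ∈ E')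
    (h : TwoSidedAt E' (φ p)) : TwoSidedAt E p := by
  intro U hU
  have hU' : φ.symm ⁻¹' U ∩ φ.target ∈ nhds (φ p) := by
    refine Filter.inter_mem ?_ (φ.open_target.mem_nhds (φ.map_source hp))
    exact (φ.continuousAt_symm (φ.map_source hp)).preimage_mem_nhds (by rwa [φ.left_inv hp])
  obtain ⟨N, hNU, hN, hpN, hc, S, T, hS, hT, hd, hSc, hTc, hST, hcl⟩ := h _ hU'
  have hNt : N ⊆ φ.target := fun q hq => (hNU hq).2
  have hSN : S ⊆ N := fun q hq => (hST.symm.subset (Or.inl hq)).1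
  have hTN : T ⊆ N := fun q hq => (hST.symm.subset (Or.inr hq)).1
  have himg : ∀ W ⊆ N, φ.symm '' W = φ.source ∩ φ ⁻¹' W := fun W hW =>
    φ.symm_image_eq_source_inter_preimage (hW.trans hNt)
  have hconn : ∀ W ⊆ N, IsPreconnected W → IsPreconnected (φ.source ∩ φ ⁻¹' W) := fun W hW h => by
    rw [← himg W hW]
    exact h.image _ (φ.symm.continuousOn.mono (hW.trans hNt))
  have hopen : ∀ W, IsOpen W → IsOpen (φ.source ∩ φ ⁻¹' W) := fun W hW =>
    φ.isOpen_inter_preimage hW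
  have hcls : ∀ W ⊆ N, ∀ q ∈ φ.source, φ q ∈ closure W → q ∈ closure (φ.source ∩ φ ⁻¹' W) := by
    intro W hW q hq hqW
    rw [← himg W hW, ← φ.left_inv hq]
    exact ((φ.continuousAt_symm (φ.map_source hq)).continuousWithinAt).mem_closure_image hqW
  refine ⟨φ.source ∩ φ ⁻¹' N, ?_, hopen N hN, ⟨hp, hpN⟩, ?_, φ.source ∩ φ ⁻¹' S,
    φ.source ∩ φ ⁻¹' T, hopen S hS, hopen T hT, ?_, hconn S hSN hSc, hconn T hTN hTc, ?_, ?_⟩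
  · rintro q ⟨hq, hqN⟩
    have := (hNU hqN).1
    rwa [mem_preimage, φ.left_inv hq] at this
  · convert hconn _ inter_subset_left hc using 1
    ext q
    constructor
    · rintro ⟨⟨h1, h2⟩, h3⟩
      exact ⟨h1, h2, (hE q h1).1 h3⟩
    · rintro ⟨h1, h2, h3⟩
      exact ⟨⟨h1, h2⟩, (hE q h1).2 h3⟩
  · exact (hd.preimage φ).mono inter_subset_right inter_subset_right
  · rw [← inter_union_distrib_left, ← preimage_union, ← hST]
    ext q
    constructor
    · rintro ⟨⟨h1, h2⟩, h3⟩
      exact ⟨h1, h2, fun h => h3 ((hE q h1).2 h)⟩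
    · rintro ⟨h1, h2, h3⟩
      exact ⟨⟨h1, h2⟩, fun h => h3 ((hE q h1).1 h)⟩
  · rintro q ⟨⟨h1, h2⟩, h3⟩
    have := hcl ⟨h2, (hE q h1).1 h3⟩
    exact ⟨hcls S hSN q h1 this.1, hcls T hTN q h1 this.2⟩

/-- A disc meets the real axis in a convex set, and the axis cuts it into two convex half-discs. -/
lemma twoSidedAt_im_eq_zero : TwoSidedAt {z : ℂ | z.im = 0} 0 := by
  intro U hU
  obtain ⟨r, hr, hrU⟩ := Metric.mem_nhds_iff.1 hU
  have hb : Convex ℝ (Metric.ball (0 : ℂ) r) := convex_ball _ _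
  have him : IsLinearMap ℝ Complex.im := Complex.imLm.isLinear
  refine ⟨Metric.ball 0 r, hrU, Metric.isOpen_ball, Metric.mem_ball_self hr,
    (hb.inter (convex_hyperplane him 0)).isPreconnected, Metric.ball 0 r ∩ {z | 0 < z.im},
    Metric.ball 0 r ∩ {z | z.im < 0}, Metric.isOpen_ball.inter (isOpen_lt continuous_const
    Complex.continuous_im), Metric.isOpen_ball.inter (isOpen_lt Complex.continuous_im
    continuous_const), ?_, (hb.inter (convex_halfSpace_gt him 0)).isPreconnected,
    (hb.inter (convex_halfSpace_lt him 0)).isPreconnected, ?_, ?_⟩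
  · rw [Set.disjoint_left]
    rintro z ⟨-, h1⟩ ⟨-, h2⟩
    exact lt_asymm (show 0 < z.im from h1) (show z.im < 0 from h2)
  · ext z
    simp only [mem_sdiff, mem_ofPred_eq, mem_union, mem_inter_iff, ← and_or_left]
    rw [or_comm, ← ne_iff_lt_or_gt]
  · rintro z ⟨hz, hz0⟩
    have hz0' : z.im = 0 := hz0
    -- A point of the axis is approached vertically from above (`s = 1`) and from below (`s = -1`).
    have key : ∀ s : ℝ, s ≠ 0 → ∀ P : Set ℂ, (∀ t : ℝ, 0 < t → z + t * s * Complex.I ∈ P) →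
        z ∈ closure (Metric.ball 0 r ∩ P) := by
      intro s _ P hP
      have hc : Continuous fun t : ℝ => z + t * s * Complex.I := by fun_prop
      have ht : Filter.Tendsto (fun t : ℝ => z + t * s * Complex.I) (nhdsWithin 0 (Ioi 0))
          (nhds z) := by
        have := hc.tendsto 0
        simp only [Complex.ofReal_zero, zero_mul, add_zero] at this
        exact this.mono_left nhdsWithin_le_nhds
      refine mem_closure_of_tendsto ht ?_
      filter_upwards [ht (Metric.isOpen_ball.mem_nhds hz), self_mem_nhdsWithin] with t h1 h2
      exact ⟨h1, hP t h2⟩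
    refine ⟨key 1 one_ne_zero _ fun t ht => ?_, key (-1) (by simp) _ fun t ht => ?_⟩
    · simpa [hz0'] using ht
    · simpa [hz0'] using ht

end TwoSided

namespace ChromaticAlgebra

open RectGraph

lemma HasValence.twoSidedAt {X : Set Plane} {p : Plane} (h : HasValence X p 2) :
    TwoSidedAt X p := by
  obtain ⟨φ, hp, h0, hφ⟩ := h
  refine TwoSidedAt.of_openPartialHomeomorph φ hp (E' := {z | z.im = 0}) ?_ ?_
  · intro q hq
    rw [hφ q hq, mem_star_two]
    rfl
  · rw [h0]
    exact twoSidedAt_im_eq_zero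

/-- The ray number `k` of the star with `d` rays. -/
def ray (d k : ℕ) (r : ℝ) : Set ℂ :=
  (fun t : ℝ => (t : ℂ) * Complex.exp (2 * Real.pi * Complex.I * k / d)) '' Ioo 0 r

lemma isPreconnected_ray (d k : ℕ) (r : ℝ) : IsPreconnected (ray d k r) :=
  isPreconnected_Ioo.image _ (by fun_prop)

lemma star_inter_ball (d : ℕ) (r : ℝ) :
    (Metric.ball 0 r ∩ star d) \ {0} = ⋃ k : Fin d, ray d k r := by
  have hn : ∀ k : ℕ, ‖Complex.exp (2 * Real.pi * Complex.I * k / d)‖ = 1 := fun k => by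
    have : 2 * Real.pi * Complex.I * k / d = ((2 * Real.pi * k / d : ℝ) : ℂ) * Complex.I := by
      push_cast; ring
    rw [this, Complex.norm_exp_ofReal_mul_I]
  ext z
  simp only [mem_sdiff, mem_inter_iff, mem_iUnion, mem_singleton_iff, Metric.mem_ball,
    dist_zero_right]
  constructor
  · rintro ⟨⟨hz, rfl | ⟨k, hk, t, ht, rfl⟩⟩, h0⟩
    · exact absurd rfl h0
    · refine ⟨⟨k, hk⟩, t, ⟨ht, ?_⟩, rfl⟩
      rwa [norm_mul, hn, mul_one, Complex.norm_real, Real.norm_of_nonneg ht.le] at hz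
  · rintro ⟨k, t, ht, rfl⟩
    refine ⟨⟨?_, Or.inr ⟨k, k.2, t, ht.1, rfl⟩⟩, ?_⟩
    · simp only
      rw [norm_mul, hn, mul_one, Complex.norm_real, Real.norm_of_nonneg ht.1.le]
      exact ht.2
    · simp only [mul_eq_zero, Complex.ofReal_eq_zero, Complex.exp_ne_zero, or_false]
      exact ht.1.ne'

/-- Near a vertex of valence `d` the graph consists of the vertex and of `d` connected rays; if
`d = 1`, the graph does not separate a neighbourhood of the vertex. -/
lemma HasValence.exists_nhds {X : Set Plane} {v : Plane} {d : ℕ} (h : HasValence X v d)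
    {U : Set Plane} (hU : U ∈ nhds v) : ∃ N ⊆ U, IsOpen N ∧ v ∈ N ∧
      (∃ ρ : Fin d → Set Plane, (∀ k, IsPreconnected (ρ k)) ∧ (N ∩ X) \ {v} = ⋃ k, ρ k) ∧
      (d = 1 → IsPreconnected (N \ X) ∧ ((N ∩ X) \ {v}).Nonempty) := by
  obtain ⟨φ, hv, h0, hφ⟩ := h
  have hU' : φ.symm ⁻¹' U ∩ φ.target ∈ nhds (0 : ℂ) := by
    rw [← h0]
    refine Filter.inter_mem ?_ (φ.open_target.mem_nhds (φ.map_source hv))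
    exact (φ.continuousAt_symm (φ.map_source hv)).preimage_mem_nhds (by rwa [φ.left_inv hv])
  obtain ⟨r, hr, hrU⟩ := Metric.mem_nhds_iff.1 hU'
  have hNt : Metric.ball 0 r ⊆ φ.target := fun q hq => (hrU hq).2
  have himg : ∀ W ⊆ Metric.ball 0 r, φ.symm '' W = φ.source ∩ φ ⁻¹' W := fun W hW =>
    φ.symm_image_eq_source_inter_preimage (hW.trans hNt)
  have hconn : ∀ W ⊆ Metric.ball 0 r, IsPreconnected W → IsPreconnected (φ.symm '' W) :=
    fun W hW h => h.image _ (φ.symm.continuousOn.mono (hW.trans hNt))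
  have hX : ((φ.source ∩ φ ⁻¹' Metric.ball 0 r) ∩ X) \ {v} =
      φ.symm '' ((Metric.ball 0 r ∩ star d) \ {0}) := by
    rw [himg _ (sdiff_subset.trans inter_subset_left)]
    ext q
    constructor
    · rintro ⟨⟨⟨h1, h2⟩, h3⟩, h4⟩
      refine ⟨h1, ⟨h2, (hφ q h1).1 h3⟩, fun h => h4 ?_⟩
      rw [mem_singleton_iff, ← h0] at h
      exact φ.injOn h1 hv h
    · rintro ⟨h1, ⟨h2, h3⟩, h4⟩
      refine ⟨⟨⟨h1, h2⟩, (hφ q h1).2 h3⟩, ?_⟩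
      rintro rfl
      exact h4 h0
  have hray : ∀ k : Fin d, ray d k r ⊆ Metric.ball 0 r := fun k z hz =>
    ((star_inter_ball d r).symm.subset (mem_iUnion.2 ⟨k, hz⟩)).1.1
  refine ⟨φ.source ∩ φ ⁻¹' Metric.ball 0 r, ?_, φ.isOpen_inter_preimage Metric.isOpen_ball,
    ⟨hv, by simp [h0, hr]⟩, ⟨fun k => φ.symm '' ray d k r,
      fun k => hconn _ (hray k) (isPreconnected_ray _ _ _), ?_⟩, ?_⟩
  · rintro q ⟨hq, hqN⟩
    have := (hrU hqN).1
    rwa [mem_preimage, φ.left_inv hq] at this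
  · rw [hX, star_inter_ball, image_iUnion]
  · rintro rfl
    constructor
    · have : (φ.source ∩ φ ⁻¹' Metric.ball 0 r) \ X = φ.symm '' (Metric.ball 0 r \ star 1) := by
        rw [himg _ sdiff_subset]
        ext q
        constructor
        · rintro ⟨⟨h1, h2⟩, h3⟩
          exact ⟨h1, h2, fun h => h3 ((hφ q h1).2 h)⟩
        · rintro ⟨h1, h2, h3⟩
          exact ⟨⟨h1, h2⟩, fun h => h3 ((hφ q h1).1 h)⟩
      rw [this]
      refine hconn _ sdiff_subset ?_
      -- The star with one ray is the nonnegative real axis, whose complement is the reflected slit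
      -- plane. Together with the disc it is star-shaped about `-r / 2`, hence connected.
      have hstar : Metric.ball 0 r \ star 1 = Metric.ball 0 r ∩ (Neg.neg ⁻¹' Complex.slitPlane) := by
        ext z
        refine and_congr_right fun _ => ?_
        rw [mem_preimage, ← not_iff_not, not_not, Complex.mem_slitPlane_iff]
        simp only [Complex.neg_re, Complex.neg_im, not_or, not_lt, not_not,
          neg_eq_zero, Left.neg_pos_iff]
        constructor
        · rintro (rfl | ⟨k, hk, t, ht, rfl⟩)
          · simp
          · interval_cases k
            simpa using ht.le
        · rintro ⟨h1, h2⟩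
          rcases h1.eq_or_lt with h | h
          · exact Or.inl (Complex.ext h.symm h2)
          · refine Or.inr ⟨0, one_pos, z.re, h, ?_⟩
            apply Complex.ext <;> simp [h2]
      rw [hstar]
      have hs : StarConvex ℝ (-(r / 2 : ℝ) : ℂ) (Neg.neg ⁻¹' Complex.slitPlane) := by
        intro z hz a b ha hb hab
        have h1 := Complex.mem_slitPlane_iff.1 hz
        rw [mem_preimage, Complex.mem_slitPlane_iff]
        simp at h1 ⊢
        rcases hb.eq_or_lt with rfl | hb'
        · left; simp at hab; simp [hab, hr]
        · rcases h1 with h1 | h1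
          · left; nlinarith
          · right; exact ⟨hb'.ne', h1⟩
      have hb : StarConvex ℝ (-(r / 2 : ℝ) : ℂ) (Metric.ball 0 r) :=
        (convex_ball (0 : ℂ) r).starConvex (by
          rw [Metric.mem_ball, dist_zero_right, norm_neg, Complex.norm_real,
            Real.norm_of_nonneg (by positivity)]
          linarith)
      refine ((hb.inter hs).isPathConnected ?_).isConnected.isPreconnected
      refine ⟨?_, ?_⟩
      · rw [Metric.mem_ball, dist_zero_right, norm_neg, Complex.norm_real,
            Real.norm_of_nonneg (by positivity)]
        linarith
      · rw [mem_preimage, neg_neg, Complex.mem_slitPlane_iff]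
        left
        simpa using hr
    · rw [hX, star_inter_ball, image_nonempty]
      exact (nonempty_Ioo.2 hr).image _ |>.mono (subset_iUnion (fun k : Fin 1 => ray 1 k r) 0)

end ChromaticAlgebra

/-! ### Transport of multigraph isomorphisms and of connected components. -/

namespace Graph

variable {α β α' β' : Type*}

/-- One implication suffices, because an edge determines its unordered pair of ends. -/
lemma isIsoTo_of_bijOn {Γ : Graph α β} {Δ : Graph α' β'} (f : α → α') (g : β → β')
    (hf : BijOn f Γ.vertexSet Δ.vertexSet) (hg : BijOn g Γ.edgeSet Δ.edgeSet)
    (h : ∀ e x y, Γ.IsLink e x y → Δ.IsLink (g e) (f x) (f y)) : Γ.IsIsoTo Δ := by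
  refine ⟨hf.equiv f, hg.equiv g, fun e x y => ⟨h e x y, fun hl => ?_⟩⟩
  obtain ⟨u, v, huv⟩ := Γ.exists_isLink_of_mem_edgeSet e.2
  have hl' : Δ.IsLink (g e) (f x) (f y) := hl
  obtain ⟨h1, h2⟩ | ⟨h1, h2⟩ := (h _ _ _ huv).eq_and_eq_or_eq_and_eq hl'
  · rwa [← hf.injOn huv.left_mem x.2 h1, ← hf.injOn huv.right_mem y.2 h2]
  · rw [← hf.injOn huv.left_mem y.2 h1, ← hf.injOn huv.right_mem x.2 h2]
    exact huv.symm

end Graph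

/-- The other components are disjoint from `C`, so they stay connected and cannot grow when `C` is
removed. -/
lemma componentsIn_diff {α : Type*} [TopologicalSpace α] {F C : Set α} (hC : C ∈ componentsIn F) :
    componentsIn (F \ C) = componentsIn F \ {C} := by
  have key : ∀ p ∈ F \ C, connectedComponentIn (F \ C) p = connectedComponentIn F p := by
    intro p hp
    refine (connectedComponentIn_mono p sdiff_subset).antisymm ?_
    refine isPreconnected_connectedComponentIn.subset_connectedComponentIn
      (mem_connectedComponentIn hp.1) fun q hq => ⟨connectedComponentIn_subset _ _ hq, fun hqC => ?_⟩
    have := componentsIn.eq_of_mem hC ⟨p, hp.1, rfl⟩ hqC hq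
    exact hp.2 (this ▸ mem_connectedComponentIn hp.1)
  ext D
  constructor
  · rintro ⟨p, hp, rfl⟩
    refine ⟨⟨p, hp.1, key p hp⟩, fun h => hp.2 ?_⟩
    rw [mem_singleton_iff] at h
    rw [← h]
    exact mem_connectedComponentIn hp
  · rintro ⟨⟨p, hp, rfl⟩, hD⟩
    have hp' : p ∈ F \ C := ⟨hp, fun h => hD (componentsIn.eq_connectedComponentIn hC h).symm⟩
    exact ⟨p, hp', (key p hp').symm⟩

lemma bijOn_image_componentsIn {α β : Type*} [TopologicalSpace α] [TopologicalSpace β] {f : α → β}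
    (hf : Continuous f) (hcl : IsClosedMap f) {F : Set α}
    (hF : ∀ x ∈ F, ∀ y, f x = f y → x = y) :
    BijOn (image f) (componentsIn F) (componentsIn (f '' F)) := by
  refine ⟨?_, ?_, ?_⟩
  · rintro _ ⟨p, hp, rfl⟩
    exact ⟨f p, mem_image_of_mem f hp, image_connectedComponentIn_of_isClosedMap hf hcl hF hp⟩
  · intro C hC D hD h
    obtain ⟨p, hp⟩ := componentsIn.nonempty hC
    have h' : f '' C = f '' D := h
    obtain ⟨q, hq, hqp⟩ := h'.subset (mem_image_of_mem f hp)
    have := hF p (componentsIn.subset hC hp) q hqp.symm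
    exact componentsIn.eq_of_mem hC hD hp (this ▸ hq)
  · rintro _ ⟨_, ⟨p, hp, rfl⟩, rfl⟩
    exact ⟨_, ⟨p, hp, rfl⟩, image_connectedComponentIn_of_isClosedMap hf hcl hF hp⟩

/-! ### The dual of a tame plane graph, and its behaviour under deletion and contraction. -/

namespace ChromaticAlgebra

/-- The properties of a graph with underlying set `X` and set of vertices `V` in the part `Y` of
the plane on which the combinatorics of its dual graph depends. -/
structure Tame (Y X V : Set Plane) : Prop where
  convex : Convex ℝ Y
  isClosed : IsClosed X
  subset : X ⊆ Y
  verts_subset : V ⊆ X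
  finite_verts : V.Finite
  isPreconnected_diff : IsPreconnected (Y \ V)
  -- The sides are taken inside `Y`, so that the end points of strands on the boundary of the
  -- rectangle are covered too.
  arc : ∀ p ∈ X \ V, ∃ N, IsOpen N ∧ p ∈ N ∧ IsPreconnected (N ∩ X) ∧ Disjoint N V ∧
    ∃ S T, IsPreconnected S ∧ IsPreconnected T ∧ (N ∩ Y) \ X = S ∪ T ∧
      N ∩ X ⊆ closure S ∩ closure T
  finite_edges : (edgesOf X V).Finite

namespace Tame

variable {Y X V : Set Plane} {e e' A B C D : Set Plane} {p : Plane}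

section

variable (h : Tame Y X V)
include h

lemma exists_isOpen_edge (he : e ∈ edgesOf X V) : ∃ O, IsOpen O ∧ O ∩ (X \ V) = e := by
  refine componentsIn.exists_isOpen he fun p hp => ?_
  obtain ⟨N, hN, hpN, hc, hd, -⟩ := h.arc p (componentsIn.subset he hp)
  refine ⟨N, hN.mem_nhds hpN, ?_⟩
  rwa [← inter_sdiff_assoc, (hd.mono_left inter_subset_left).sdiff_eq_left]

lemma closure_edge_subset (he : e ∈ edgesOf X V) : closure e ⊆ X :=
  closure_minimal ((componentsIn.subset he).trans sdiff_subset) h.isClosed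

/-- Edges are relatively closed in `X \ V`, so all they can gain in their closure is vertices. -/
lemma mem_edge_of_mem_closure (he : e ∈ edgesOf X V) (hp : p ∈ closure e) (hpV : p ∉ V) : p ∈ e :=
  componentsIn.closure_inter_subset he ⟨hp, h.closure_edge_subset he hp, hpV⟩

lemma exists_isOpen_region (hA : A ∈ regionsOf Y X) : ∃ O, IsOpen O ∧ O ∩ Y = A := by
  obtain ⟨O, hO, hOA⟩ := componentsIn.exists_isOpen hA fun p hp => by
    have hpX : p ∈ Xᶜ := (componentsIn.subset hA hp).2
    obtain ⟨r, hr, hrX⟩ := Metric.mem_nhds_iff.1 (h.isClosed.isOpen_compl.mem_nhds hpX)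
    refine ⟨Metric.ball p r, Metric.ball_mem_nhds p hr, ?_⟩
    have : Metric.ball p r ∩ (Y \ X) = Metric.ball p r ∩ Y := by
      ext q
      exact ⟨fun hq => ⟨hq.1, hq.2.1⟩, fun hq => ⟨hq.1, hq.2, hrX hq.1⟩⟩
    rw [this]
    exact ((convex_ball p r).inter h.convex).isPreconnected
  refine ⟨O ∩ Xᶜ, hO.inter h.isClosed.isOpen_compl, ?_⟩
  rw [← hOA]
  ext q
  exact ⟨fun hq => ⟨hq.1.1, hq.2, hq.1.2⟩, fun hq => ⟨⟨hq.1, hq.2.2⟩, hq.2.1⟩⟩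

/-- Near a point of an edge there are (at most) two regions. -/
lemma exists_adjacent (hp : p ∈ X \ V) : ∃ N, IsOpen N ∧ p ∈ N ∧ IsPreconnected (N ∩ X) ∧
    N ∩ X ⊆ X \ V ∧ ∃ A ∈ regionsOf Y X, ∃ B ∈ regionsOf Y X, (N ∩ Y) \ X ⊆ A ∪ B ∧
      ∀ q ∈ N ∩ X, ∀ C ∈ regionsOf Y X, q ∈ closure C ↔ C = A ∨ C = B := by
  obtain ⟨N, hN, hpN, hc, hd, S, T, hS, hT, hST, hcl⟩ := h.arc p hp
  have hpS := hcl ⟨hpN, hp.1⟩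
  have hSY : S ⊆ Y \ X := fun q hq => by
    have := hST.symm.subset (Or.inl hq)
    exact ⟨this.1.2, this.2⟩
  have hTY : T ⊆ Y \ X := fun q hq => by
    have := hST.symm.subset (Or.inr hq)
    exact ⟨this.1.2, this.2⟩
  obtain ⟨s, hs⟩ := closure_nonempty_iff.1 ⟨p, hpS.1⟩
  obtain ⟨t, ht⟩ := closure_nonempty_iff.1 ⟨p, hpS.2⟩
  obtain ⟨A, hA, hsA⟩ := exists_mem_componentsIn (hSY hs)
  obtain ⟨B, hB, htB⟩ := exists_mem_componentsIn (hTY ht)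
  have hSA : S ⊆ A := componentsIn.subset_of_isPreconnected hA hS hSY ⟨s, hs, hsA⟩
  have hTB : T ⊆ B := componentsIn.subset_of_isPreconnected hB hT hTY ⟨t, ht, htB⟩
  have hAB : (N ∩ Y) \ X ⊆ A ∪ B := hST.subset.trans (union_subset_union hSA hTB)
  refine ⟨N, hN, hpN, hc, fun q hq => ⟨hq.2, Set.disjoint_left.1 hd hq.1⟩, A, hA, B, hB, hAB, ?_⟩
  intro q hq C hC
  constructor
  · intro hqC
    obtain ⟨r, hrN, hrC⟩ := mem_closure_iff.1 hqC N hN hq.1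
    have hr := componentsIn.subset hC hrC
    rcases hAB ⟨⟨hrN, hr.1⟩, hr.2⟩ with h' | h'
    · exact Or.inl (componentsIn.eq_of_mem hC hA hrC h')
    · exact Or.inr (componentsIn.eq_of_mem hC hB hrC h')
  · rintro (rfl | rfl)
    · exact closure_mono hSA (hcl hq).1
    · exact closure_mono hTB (hcl hq).2

/-- The set of regions accumulating at a point is locally constant along an edge, hence constant; at
any one point it consists of the regions of the two local sides. -/
lemma exists_isLink (he : e ∈ edgesOf X V) : ∃ A B, (dualOf Y X V).IsLink e A B := by
  let f : e → Set (Set Plane) := fun p => {C | C ∈ regionsOf Y X ∧ p.1 ∈ closure C}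
  have hf : IsLocallyConstant f := by
    rw [IsLocallyConstant.iff_eventually_eq]
    intro p
    obtain ⟨N, hN, hpN, -, -, A, hA, B, hB, -, hAB⟩ :=
      h.exists_adjacent (componentsIn.subset he p.2)
    filter_upwards [(hN.preimage continuous_subtype_val).mem_nhds hpN] with q hq
    ext C
    refine and_congr_right fun hC => ?_
    rw [hAB q ⟨hq, (componentsIn.subset he q.2).1⟩ C hC,
      hAB p ⟨hpN, (componentsIn.subset he p.2).1⟩ C hC]
  obtain ⟨p, hp⟩ := componentsIn.nonempty he
  obtain ⟨N, hN, hpN, -, -, A, hA, B, hB, -, hAB⟩ := h.exists_adjacent (componentsIn.subset he hp)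
  refine ⟨A, B, he, hA, hB, fun q hq C hC => ?_⟩
  have := Subtype.preconnectedSpace (componentsIn.isPreconnected he)
  have hfq : f ⟨q, hq⟩ = f ⟨p, hp⟩ := hf.apply_eq_of_isPreconnected isPreconnected_univ trivial trivial
  have : q ∈ closure C ↔ p ∈ closure C := by
    have h1 := congrArg (C ∈ ·) hfq
    simpa [f, hC] using h1
  rw [this, hAB p ⟨hpN, (componentsIn.subset he hp).1⟩ C hC]

lemma edgeSet_dualOf : (dualOf Y X V).edgeSet = edgesOf X V := by
  ext e
  rw [Graph.edge_mem_iff_exists_isLink]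
  exact ⟨fun ⟨A, B, hl⟩ => hl.1, fun he => h.exists_isLink he⟩

/-- Near a point of `e` only the regions adjacent to `e` occur. -/
lemma exists_nhds_of_isLink (hl : (dualOf Y X V).IsLink e A B) (hp : p ∈ e) :
    ∃ N, IsOpen N ∧ p ∈ N ∧ N ∩ X ⊆ e ∧ (N ∩ Y) \ X ⊆ A ∪ B := by
  have hpX := componentsIn.subset hl.1 hp
  obtain ⟨N, hN, hpN, hc, hNX, A', hA', B', hB', hAB, hcl⟩ := h.exists_adjacent hpX
  refine ⟨N, hN, hpN, ?_, hAB.trans ?_⟩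
  · exact componentsIn.subset_of_isPreconnected hl.1 hc hNX ⟨p, ⟨hpN, hpX.1⟩, hp⟩
  · have h1 : A' = A ∨ A' = B := (hl.2.2.2 p hp A' hA').1
      ((hcl p ⟨hpN, hpX.1⟩ A' hA').2 (Or.inl rfl))
    have h2 : B' = A ∨ B' = B := (hl.2.2.2 p hp B' hB').1
      ((hcl p ⟨hpN, hpX.1⟩ B' hB').2 (Or.inr rfl))
    refine union_subset ?_ ?_
    · rcases h1 with rfl | rfl
      exacts [subset_union_left, subset_union_right]
    · rcases h2 with rfl | rfl
      exacts [subset_union_left, subset_union_right]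

/-- A region that touches no edge is open and closed in `Y \ V`, which is connected. -/
lemma eq_diff_of_closure_subset (hD : D ∈ regionsOf Y X) (hcl : closure D ∩ (X \ V) = ∅) :
    D = Y \ V := by
  have hDY : D ⊆ Y \ V := fun q hq => ⟨(componentsIn.subset hD hq).1,
    fun hqV => (componentsIn.subset hD hq).2 (h.verts_subset hqV)⟩
  refine hDY.antisymm ?_
  obtain ⟨O, hO, hOD⟩ := h.exists_isOpen_region hD
  obtain ⟨q, hq⟩ := componentsIn.nonempty hD
  refine h.isPreconnected_diff.subset_of_relClopen subset_rfl hO ?_ ?_ ?_ ⟨q, hDY hq, hq⟩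
  · exact (inter_subset_inter_right _ sdiff_subset).trans hOD.subset
  · exact hOD.symm.subset.trans inter_subset_left
  · rintro r ⟨hr, hrY, hrV⟩
    by_cases hrX : r ∈ X
    · exact absurd (show r ∈ closure D ∩ (X \ V) from ⟨hr, hrX, hrV⟩) (by simp [hcl])
    · exact componentsIn.closure_inter_subset hD ⟨hr, hrY, hrX⟩

/-- Each of the finitely many edges borders at most two regions, and `Y \ V` is the only possible
region bordered by no edge. -/
lemma finite_regions : (regionsOf Y X).Finite := by
  have h1 : ∀ e ∈ edgesOf X V, {C | C ∈ regionsOf Y X ∧ (closure C ∩ e).Nonempty}.Finite := by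
    intro e he
    obtain ⟨A, B, hl⟩ := h.exists_isLink he
    refine (Set.toFinite {A, B}).subset ?_
    rintro C ⟨hC, p, hpC, hp⟩
    exact (hl.2.2.2 p hp C hC).1 hpC
  refine ((h.finite_edges.biUnion h1).union (finite_singleton (Y \ V))).subset fun D hD => ?_
  rcases (closure D ∩ (X \ V)).eq_empty_or_nonempty with h0 | ⟨p, hpD, hp⟩
  · exact Or.inr (h.eq_diff_of_closure_subset hD h0)
  · obtain ⟨e, he, hpe⟩ := exists_mem_componentsIn hp
    exact Or.inl (mem_biUnion he ⟨hD, p, hpD, hpe⟩)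

end

lemma mem_closure_left (hl : (dualOf Y X V).IsLink e A B) (hp : p ∈ e) : p ∈ closure A :=
  (hl.2.2.2 p hp A hl.2.1).2 (Or.inl rfl)

lemma mem_closure_right (hl : (dualOf Y X V).IsLink e A B) (hp : p ∈ e) : p ∈ closure B :=
  (hl.2.2.2 p hp B hl.2.2.1).2 (Or.inr rfl)

/-! ### Deletion of an edge -/

section Deletion

variable (h : Tame Y X V) (hl : (dualOf Y X V).IsLink e A B)

lemma edgesOf_diff (he : e ∈ edgesOf X V) : edgesOf (X \ e) V = edgesOf X V \ {e} := by
  have : (X \ e) \ V = (X \ V) \ e := sdiff_right_comm _ _ _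
  change componentsIn ((X \ e) \ V) = componentsIn (X \ V) \ {e}
  rw [this]
  exact componentsIn_diff he

include hl in
lemma isPreconnected_merge : IsPreconnected (A ∪ e ∪ B) := by
  obtain ⟨p, hp⟩ := componentsIn.nonempty hl.1
  have hA : IsPreconnected (A ∪ e) :=
    (componentsIn.isPreconnected hl.2.1).subset_closure subset_union_left
      (union_subset subset_closure fun q hq => mem_closure_left hl hq)
  have hB : IsPreconnected (B ∪ e) :=
    (componentsIn.isPreconnected hl.2.2.1).subset_closure subset_union_left
      (union_subset subset_closure fun q hq => mem_closure_right hl hq)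
  have := hA.union p (Or.inr hp) (Or.inr hp) hB
  convert this using 1
  ext q
  simp only [mem_union]
  tauto

include hl in
lemma merge_notMem_regionsOf : A ∪ e ∪ B ∉ regionsOf Y X := fun hM => by
  obtain ⟨p, hp⟩ := componentsIn.nonempty hl.1
  exact (componentsIn.subset hM (Or.inl (Or.inr hp))).2 (componentsIn.subset hl.1 hp).1

include h hl

lemma diff_diff_edge : Y \ (X \ e) = (Y \ X) ∪ e := by
  have : e ⊆ Y := (componentsIn.subset hl.1).trans (sdiff_subset.trans h.subset)
  ext q
  simp only [mem_sdiff, mem_union, not_and, not_not]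
  constructor
  · rintro ⟨h1, h2⟩
    by_cases hq : q ∈ X
    · exact Or.inr (h2 hq)
    · exact Or.inl ⟨h1, hq⟩
  · rintro (⟨h1, h2⟩ | h1)
    · exact ⟨h1, fun h' => absurd h' h2⟩
    · exact ⟨this h1, fun _ => h1⟩

/-- The complement grows by `e` alone, and only `A` and `B` accumulate on `e`; every other region
therefore stays relatively closed. -/
lemma closure_inter_subset_of_ne (hC : C ∈ regionsOf Y X) (hA : C ≠ A) (hB : C ≠ B) :
    closure C ∩ (Y \ (X \ e)) ⊆ C := by
  rw [h.diff_diff_edge hl]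
  rintro q ⟨hq, hq' | hqe⟩
  · exact componentsIn.closure_inter_subset hC ⟨hq, hq'⟩
  · rcases (hl.2.2.2 q hqe C hC).1 hq with h' | h'
    exacts [absurd h' hA, absurd h' hB]

lemma mem_regionsOf_of_ne (hC : C ∈ regionsOf Y X) (hA : C ≠ A) (hB : C ≠ B) :
    C ∈ regionsOf Y (X \ e) := by
  obtain ⟨O, hO, hOC⟩ := h.exists_isOpen_region hC
  refine mem_componentsIn_of_relClopen (componentsIn.isPreconnected hC) (componentsIn.nonempty hC)
    ?_ hO ?_ ?_ (h.closure_inter_subset_of_ne hl hC hA hB)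
  · exact (componentsIn.subset hC).trans (sdiff_subset_sdiff_right sdiff_subset)
  · exact (inter_subset_inter_right _ sdiff_subset).trans hOC.subset
  · exact hOC.symm.subset.trans inter_subset_left

/-- The union is connected since `e` lies in the closures of `A` and `B`. The component containing
it cannot reach another old region, because such a region is still a component by itself. -/
lemma merge_mem_regionsOf : A ∪ e ∪ B ∈ regionsOf Y (X \ e) := by
  have hsub : A ∪ e ∪ B ⊆ Y \ (X \ e) := by
    rw [h.diff_diff_edge hl]
    exact union_subset (union_subset_union (componentsIn.subset hl.2.1) subset_rfl)
      ((componentsIn.subset hl.2.2.1).trans subset_union_left)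
  obtain ⟨p, hp⟩ := componentsIn.nonempty hl.1
  have hp' : p ∈ A ∪ e ∪ B := Or.inl (Or.inr hp)
  obtain ⟨M, hM, hpM⟩ := exists_mem_componentsIn (hsub hp')
  have h1 := componentsIn.subset_of_isPreconnected hM (isPreconnected_merge hl) hsub ⟨p, hp', hpM⟩
  refine (h1.antisymm fun q hq => ?_ : A ∪ e ∪ B = M) ▸ hM
  have hqY := componentsIn.subset hM hq
  rw [h.diff_diff_edge hl] at hqY
  rcases hqY with hqY | hqe
  · obtain ⟨C, hC, hqC⟩ := exists_mem_componentsIn hqY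
    by_contra hne
    have hCA : C ≠ A := by rintro rfl; exact hne (Or.inl (Or.inl hqC))
    have hCB : C ≠ B := by rintro rfl; exact hne (Or.inr hqC)
    have hC' := h.mem_regionsOf_of_ne hl hC hCA hCB
    have := componentsIn.eq_of_mem hM hC' hq hqC
    subst this
    exact (componentsIn.subset hC hpM).2 (componentsIn.subset hl.1 hp).1
  · exact Or.inl (Or.inr hqe)

lemma mem_regionsOf_diff_iff : D ∈ regionsOf Y (X \ e) ↔
    D = A ∪ e ∪ B ∨ (D ∈ regionsOf Y X ∧ D ≠ A ∧ D ≠ B) := by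
  constructor
  · intro hD
    obtain ⟨q, hq⟩ := componentsIn.nonempty hD
    have hqY := componentsIn.subset hD hq
    rw [h.diff_diff_edge hl] at hqY
    by_cases hqM : q ∈ A ∪ e ∪ B
    · exact Or.inl (componentsIn.eq_of_mem hD (h.merge_mem_regionsOf hl) hq hqM)
    · right
      obtain ⟨C, hC, hqC⟩ := exists_mem_componentsIn (hqY.resolve_right fun h' =>
        hqM (Or.inl (Or.inr h')))
      have hCA : C ≠ A := by rintro rfl; exact hqM (Or.inl (Or.inl hqC))
      have hCB : C ≠ B := by rintro rfl; exact hqM (Or.inr hqC)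
      have := componentsIn.eq_of_mem hD (h.mem_regionsOf_of_ne hl hC hCA hCB) hq hqC
      subst this
      exact ⟨hC, hCA, hCB⟩
  · rintro (rfl | ⟨hD, hA, hB⟩)
    · exact h.merge_mem_regionsOf hl
    · exact h.mem_regionsOf_of_ne hl hD hA hB

open Classical in
lemma isLink_diff {u v : Set Plane} (hl' : (dualOf Y X V).IsLink e' u v) (hne : e' ≠ e) :
    (dualOf Y (X \ e) V).IsLink e' (if u = A ∨ u = B then A ∪ e ∪ B else u)
      (if v = A ∨ v = B then A ∪ e ∪ B else v) := by
  have hmem : ∀ u ∈ regionsOf Y X, (if u = A ∨ u = B then A ∪ e ∪ B else u) ∈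
      regionsOf Y (X \ e) := by
    intro u hu
    split_ifs with h'
    · exact h.merge_mem_regionsOf hl
    · rw [not_or] at h'
      exact h.mem_regionsOf_of_ne hl hu h'.1 h'.2
  have hM := merge_notMem_regionsOf hl
  refine ⟨?_, hmem u hl'.2.1, hmem v hl'.2.2.1, ?_⟩
  · rw [edgesOf_diff hl.1]
    exact ⟨hl'.1, hne⟩
  · intro p hp D hD
    rcases (h.mem_regionsOf_diff_iff hl).1 hD with rfl | ⟨hD', hDA, hDB⟩
    -- A point of another edge is not a limit of `e`, so it is a limit of the merged region exactly
    -- if it is one of `A` or of `B`.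
    · have hpe : p ∉ closure e := fun h' => hne (componentsIn.eq_of_mem hl'.1 hl.1 hp
        (h.mem_edge_of_mem_closure hl.1 h' (componentsIn.subset hl'.1 hp).2))
      rw [closure_union, closure_union]
      simp only [mem_union, hpe, or_false, hl'.2.2.2 p hp A hl.2.1, hl'.2.2.2 p hp B hl.2.2.1]
      have key : ∀ u ∈ regionsOf Y X,
          (A ∪ e ∪ B = if u = A ∨ u = B then A ∪ e ∪ B else u) ↔ (u = A ∨ u = B) := by
        intro u hu
        split_ifs with h'
        · simp [h']
        · simp only [h', iff_false]
          rintro rfl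
          exact hM hu
      rw [key u hl'.2.1, key v hl'.2.2.1]
      simp only [eq_comm (a := A), eq_comm (a := B)]
      tauto
    · rw [hl'.2.2.2 p hp D hD']
      have key : ∀ u ∈ regionsOf Y X,
          (D = if u = A ∨ u = B then A ∪ e ∪ B else u) ↔ D = u := by
        intro u hu
        split_ifs with h'
        · constructor
          · rintro rfl
            exact absurd hD' hM
          · rintro rfl
            rcases h' with h' | h'
            exacts [absurd h' hDA, absurd h' hDB]
        · rfl
      rw [key u hl'.2.1, key v hl'.2.2.1]

open Classical in
/-- The dual of `G \ e` is obtained from the dual of `G` by contraction of the dual edge. -/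
lemma isIsoTo_contractEdge :
    (dualOf Y (X \ e) V).IsIsoTo ((dualOf Y X V).contractEdge e A B) := by
  have hM := merge_notMem_regionsOf hl
  -- The contraction keeps the name `A` for the identified vertex; the isomorphism renames it to the
  -- merged region and fixes all edges.
  refine (Graph.isIsoTo_of_bijOn (fun C => if C = A then A ∪ e ∪ B else C) id ⟨?_, ?_, ?_⟩ ?_
    ?_).symm
  · rintro _ ⟨u, hu, rfl⟩
    have hu' : u ∈ regionsOf Y X := hu
    refine (h.mem_regionsOf_diff_iff hl).2 ?_
    by_cases h1 : u = B <;> by_cases h2 : u = A <;> simp_all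
  · have hsub : ∀ C ∈ ((dualOf Y X V).contractEdge e A B).vertexSet, C ∈ regionsOf Y X := by
      rintro _ ⟨u, hu, rfl⟩
      simp only
      split_ifs
      · exact hl.2.1
      · exact hu
    intro C hC D hD hCD
    have hC' := hsub C hC
    have hD' := hsub D hD
    simp only at hCD
    split_ifs at hCD with h1 h2 h2
    · rw [h1, h2]
    · exact absurd (hCD ▸ hD') hM
    · exact absurd (hCD ▸ hC') hM
    · exact hCD
  · intro D hD
    rcases (h.mem_regionsOf_diff_iff hl).1 hD with rfl | ⟨hD', hDA, hDB⟩
    · exact ⟨A, ⟨A, hl.2.1, by simp⟩, by simp⟩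
    · exact ⟨D, ⟨D, hD', by simp [hDB]⟩, by simp [hDA]⟩
  · have : (dualOf Y (X \ e) V).edgeSet = ((dualOf Y X V).contractEdge e A B).edgeSet := by
      rw [Graph.contractEdge_edgeSet, h.edgeSet_dualOf]
      ext e'
      rw [Graph.edge_mem_iff_exists_isLink]
      constructor
      · rintro ⟨_, _, h', -⟩
        rwa [edgesOf_diff hl.1] at h'
      · rintro ⟨h1, h2⟩
        obtain ⟨u, v, huv⟩ := h.exists_isLink h1
        exact ⟨_, _, h.isLink_diff hl huv h2⟩
    rw [this]
    exact bijOn_id _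
  · intro e' x y hxy
    obtain ⟨u, v, huv, hne, rfl, rfl⟩ := Graph.contractEdge_isLink.1 hxy
    have key : ∀ u : Set Plane, (if u = A ∨ u = B then A ∪ e ∪ B else u) =
        if (if u = B then A else u) = A then A ∪ e ∪ B else (if u = B then A else u) := by
      intro u
      by_cases h1 : u = B <;> by_cases h2 : u = A <;> simp_all
    have := h.isLink_diff hl huv hne
    rw [key u, key v] at this
    change (dualOf Y (X \ e) V).IsLink e' _ _
    convert this

end Deletion

/-! ### Images under maps of the plane -/

/-- The dual graph of the image of a graph under a map which collapses the subset `K` of the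
graph. -/
lemma isIsoTo_image (h : Tame Y X V) {f : Plane → Plane} (hf : Continuous f)
    (hcl : IsClosedMap f) (hsurj : Function.Surjective f) (hY : ∀ p, f p ∈ Y ↔ p ∈ Y) {K : Set Plane}
    (hK : K ⊆ X) (hfib : ∀ p q, f p = f q ↔ p = q ∨ (p ∈ K ∧ q ∈ K))
    (hV : f '' X \ f '' V = f '' ((X \ V) \ K)) (F : Set (Set Plane))
    (hF : componentsIn ((X \ V) \ K) = edgesOf X V \ F) :
    (dualOf Y (f '' X) (f '' V)).IsIsoTo ((dualOf Y X V).deleteEdges F) := by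
  have hinj : ∀ p, p ∉ K → ∀ q, f p = f q → p = q := fun p hp q hpq =>
    ((hfib p q).1 hpq).resolve_right fun h' => hp h'.1
  have hR : Y \ f '' X = f '' (Y \ X) := by
    ext q
    obtain ⟨p, rfl⟩ := hsurj q
    constructor
    · rintro ⟨h1, h2⟩
      exact ⟨p, ⟨(hY p).1 h1, fun h' => h2 ⟨p, h', rfl⟩⟩, rfl⟩
    · rintro ⟨r, ⟨h1, h2⟩, hr⟩
      have := hinj r (fun h' => h2 (hK h')) p hr
      subst this
      refine ⟨(hY r).2 h1, ?_⟩
      rintro ⟨s, hs, hsr⟩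
      have := hinj r (fun h' => h2 (hK h')) s hsr.symm
      exact h2 (this ▸ hs)
  have hbR : BijOn (image f) (regionsOf Y X) (regionsOf Y (f '' X)) := by
    have := bijOn_image_componentsIn hf hcl (F := Y \ X) fun p hp => hinj p fun h' => hp.2 (hK h')
    rwa [← hR] at this
  have hbE : BijOn (image f) (edgesOf X V \ F) (edgesOf (f '' X) (f '' V)) := by
    have := bijOn_image_componentsIn hf hcl (F := (X \ V) \ K) fun p hp => hinj p hp.2
    rwa [← hV, hF] at this
  have hlink : ∀ e A B, (dualOf Y X V).IsLink e A B → e ∉ F →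
      (dualOf Y (f '' X) (f '' V)).IsLink (f '' e) (f '' A) (f '' B) := by
    rintro e A B hl heF
    refine ⟨hbE.mapsTo ⟨hl.1, heF⟩, hbR.mapsTo hl.2.1, hbR.mapsTo hl.2.2.1, ?_⟩
    rintro _ ⟨p, hp, rfl⟩ D hD
    obtain ⟨C, hC, rfl⟩ := hbR.surjOn hD
    have hpK : p ∉ K := by
      have h1 : e ∈ componentsIn ((X \ V) \ K) := by rw [hF]; exact ⟨hl.1, heF⟩
      exact (componentsIn.subset h1 hp).2
    -- A closed continuous map commutes with closures, and `p` is alone in its fibre because edges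
    -- outside `F` avoid `K`.
    have h1 : f p ∈ closure (f '' C) ↔ p ∈ closure C := by
      rw [hcl.closure_image_eq_of_continuous hf]
      constructor
      · rintro ⟨q, hq, hqp⟩
        rwa [hinj p hpK q hqp.symm]
      · exact mem_image_of_mem f
    rw [h1, hl.2.2.2 p hp C hC]
    rw [hbR.injOn.eq_iff hC hl.2.1, hbR.injOn.eq_iff hC hl.2.2.1]
  refine (Graph.isIsoTo_of_bijOn (image f) (image f) hbR ?_ ?_).symm
  · have h1 : (dualOf Y (f '' X) (f '' V)).edgeSet = edgesOf (f '' X) (f '' V) := by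
      ext e
      rw [Graph.edge_mem_iff_exists_isLink]
      constructor
      · rintro ⟨A, B, hl⟩
        exact hl.1
      · intro he
        obtain ⟨e', he', rfl⟩ := hbE.surjOn he
        obtain ⟨A, B, hl⟩ := h.exists_isLink he'.1
        exact ⟨_, _, hlink e' A B hl he'.2⟩
    rw [h1]
    change BijOn _ ((dualOf Y X V).edgeSet \ F) _
    rwa [h.edgeSet_dualOf]
  · intro e A B hl
    exact hlink e A B hl.1 hl.2

/-- A `1`-valent vertex gives rise to a loop of the dual graph. -/
lemma exists_isLoopAt (h : Tame Y X V) {v : Plane} (hY : Y ∈ nhds v)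
    (hval : HasValence X v 1) : ∃ e A, v ∈ closure e ∧ (dualOf Y X V).IsLoopAt e A := by
  have hU : ∀ U ∈ nhds v, Y ∩ (V \ {v})ᶜ ∩ U ∈ nhds v := fun U hU => by
    refine Filter.inter_mem (Filter.inter_mem hY ?_) hU
    exact ((h.finite_verts.subset sdiff_subset).isClosed.isOpen_compl).mem_nhds (by simp)
  obtain ⟨N, hNU, hN, hvN, ⟨ρ, hρ, hNρ⟩, h1⟩ := hval.exists_nhds (hU univ Filter.univ_mem)
  obtain ⟨hc, p, hp⟩ := h1 rfl
  have hNV : (N ∩ X) \ {v} ⊆ X \ V := fun q hq => ⟨hq.1.2, fun hqV => (hNU hq.1.1).1.2 ⟨hqV, hq.2⟩⟩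
  have hconn : IsPreconnected ((N ∩ X) \ {v}) := by
    rw [hNρ]
    have : ⋃ k, ρ k = ρ 0 := by
      ext q; simp
    rw [this]
    exact hρ 0
  obtain ⟨e, he, hpe⟩ := exists_mem_componentsIn (hNV hp)
  have hsub := componentsIn.subset_of_isPreconnected he hconn hNV ⟨p, hp, hpe⟩
  obtain ⟨A, B, hl⟩ := h.exists_isLink he
  refine ⟨e, A, ?_, ?_⟩
  · rw [mem_closure_iff_nhds]
    intro U hU'
    obtain ⟨N', hNU', hN', hvN', -, h1'⟩ := hval.exists_nhds (Filter.inter_mem hU' (hN.mem_nhds hvN))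
    obtain ⟨-, q, hq⟩ := h1' rfl
    exact ⟨q, (hNU' hq.1.1).1, hsub ⟨⟨(hNU' hq.1.1).2, hq.1.2⟩, hq.2⟩⟩
  -- Both regions adjacent at `p` meet `N \ X`, which is connected for valence `1`.
  · have hAB : A = B := by
      obtain ⟨a, haN, haA⟩ := mem_closure_iff.1 (mem_closure_left hl hpe) N hN hp.1.1
      obtain ⟨b, hbN, hbB⟩ := mem_closure_iff.1 (mem_closure_right hl hpe) N hN hp.1.1
      have ha := componentsIn.subset hl.2.1 haA
      have := componentsIn.subset_of_isPreconnected hl.2.1 hc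
        (fun q hq => ⟨(hNU hq.1).1.1, hq.2⟩) ⟨a, ⟨haN, ha.2⟩, haA⟩
      have hb := componentsIn.subset hl.2.2.1 hbB
      exact componentsIn.eq_of_mem hl.2.1 hl.2.2.1 (this ⟨hbN, hb.2⟩) hbB
    subst hAB
    exact hl

end Tame

end ChromaticAlgebra

/-! ### Separation by locally two-sided sets -/

section Separation

variable {α β : Type*} [TopologicalSpace α] [TopologicalSpace β]

/-- Near `p`, the predicate `s` is locally constant outside `E`, and it takes both values near `p`
if `p ∈ E`. -/
def SeparatesAt (E : Set α) (s : α → Prop) (p : α) : Prop :=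
  (p ∉ E → ∀ᶠ q in nhds p, s q = s p) ∧
    (p ∈ E → (∃ᶠ q in nhds p, q ∉ E ∧ s q) ∧ ∃ᶠ q in nhds p, q ∉ E ∧ ¬ s q)

/-- `s` separates the sides of `E` near every point of `K`. -/
def SeparatesOn (E : Set α) (s : α → Prop) (K : Set α) : Prop :=
  ∀ p ∈ K, ∀ᶠ q in nhds p, SeparatesAt E s q

lemma IsPreconnected.eq_of_eventually_eq {γ : Type*} {T : Set α} (hT : IsPreconnected T) {f : α → γ}
    (h : ∀ p ∈ T, ∀ᶠ q in nhds p, q ∈ T → f q = f p) {x y : α} (hx : x ∈ T) (hy : y ∈ T) :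
    f x = f y := by
  have := Subtype.preconnectedSpace hT
  have hf : IsLocallyConstant fun p : T => f p := by
    rw [IsLocallyConstant.iff_eventually_eq]
    intro p
    have := (continuous_subtype_val.tendsto p).eventually (h p p.2)
    exact this.mono fun q hq => hq q.2
  exact hf.apply_eq_of_isPreconnected isPreconnected_univ (x := ⟨x, hx⟩) (y := ⟨y, hy⟩) trivial
    trivial

/-- Only the values off `E` matter, which leaves freedom on `E` when predicates are glued. -/
lemma SeparatesAt.congr {E : Set α} (hE : IsClosed E) {s s' : α → Prop} {p : α}
    (h : SeparatesAt E s p) (hs : ∀ᶠ q in nhds p, q ∉ E → s q = s' q) : SeparatesAt E s' p := by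
  constructor
  · intro hp
    filter_upwards [h.1 hp, hs, hE.isOpen_compl.mem_nhds hp] with q h1 h2 h3
    rw [← h2 h3, h1, hs.self_of_nhds hp]
  · intro hp
    refine ⟨((h.2 hp).1.and_eventually hs).mono ?_, ((h.2 hp).2.and_eventually hs).mono ?_⟩
    · rintro q ⟨⟨h1, h2⟩, h3⟩
      exact ⟨h1, h3 h1 ▸ h2⟩
    · rintro q ⟨⟨h1, h2⟩, h3⟩
      exact ⟨h1, h3 h1 ▸ h2⟩

/-- The predicate `s q ↔ c` is `s` or its negation; `c` plays the role of a sign, and exchanging the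
two sides is harmless. -/
lemma SeparatesAt.iff_const {E : Set α} {s : α → Prop} {p : α} (h : SeparatesAt E s p) (c : Prop) :
    SeparatesAt E (fun q => s q ↔ c) p := by
  by_cases hc : c
  · simpa [hc] using h
  · simp only [hc, iff_false]
    refine ⟨fun hp => (h.1 hp).mono fun q hq => congrArg Not hq, fun hp => ⟨(h.2 hp).2, ?_⟩⟩
    simpa using (h.2 hp).1

lemma SeparatesAt.of_openPartialHomeomorph {E' : Set α} {E : Set β} {s : α → Prop} {w : α}
    (φ : OpenPartialHomeomorph α β) (hw : w ∈ φ.source) (hE : ∀ q ∈ φ.source, q ∈ E' ↔ φ q ∈ E)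
    (h : SeparatesAt E' s w) : SeparatesAt E (fun q => s (φ.symm q)) (φ w) := by
  have hsrc := φ.open_source.mem_nhds hw
  constructor
  · intro hp
    have h1 := (φ.continuousAt_symm (φ.map_source hw)).tendsto
    rw [φ.left_inv hw] at h1
    simp only [φ.left_inv hw]
    exact h1.eventually (h.1 fun h' => hp ((hE w hw).1 h'))
  · intro hp
    have h1 := h.2 ((hE w hw).2 hp)
    refine ⟨(φ.continuousAt hw).tendsto.frequently ((h1.1.and_eventually hsrc).mono ?_),
      (φ.continuousAt hw).tendsto.frequently ((h1.2.and_eventually hsrc).mono ?_)⟩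
    · rintro q ⟨⟨h2, h3⟩, h4⟩
      exact ⟨fun h' => h2 ((hE q h4).2 h'), by simpa only [φ.left_inv h4]⟩
    · rintro q ⟨⟨h2, h3⟩, h4⟩
      exact ⟨fun h' => h2 ((hE q h4).2 h'), by simpa only [φ.left_inv h4]⟩

/-- Near each point there is a separating predicate. -/
lemma exists_separatesAt {E : Set α} (hE : IsClosed E) (h : ∀ p ∈ E, TwoSidedAt E p) (p : α) :
    ∃ U, IsOpen U ∧ p ∈ U ∧ ∃ s : α → Prop, ∀ q ∈ U, SeparatesAt E s q := by
  by_cases hp : p ∈ E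
  · obtain ⟨N, -, hN, hpN, -, S, T, hS, hT, hd, -, -, hST, hcl⟩ := h p hp univ Filter.univ_mem
    refine ⟨N, hN, hpN, (· ∈ S), fun q hq => ⟨fun hqE => ?_, fun hqE => ?_⟩⟩
    · rcases hST.subset ⟨hq, hqE⟩ with h' | h'
      · filter_upwards [hS.mem_nhds h'] with r hr
        simp [hr, h']
      · filter_upwards [hT.mem_nhds h'] with r hr
        simp [Set.disjoint_right.1 hd hr, Set.disjoint_right.1 hd h']
    · obtain ⟨h1, h2⟩ := hcl ⟨hq, hqE⟩
      rw [mem_closure_iff_frequently] at h1 h2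
      refine ⟨h1.mono fun r hr => ⟨?_, hr⟩, h2.mono fun r hr => ⟨?_, Set.disjoint_right.1 hd hr⟩⟩
      · exact (hST.symm.subset (Or.inl hr)).2
      · exact (hST.symm.subset (Or.inr hr)).2
  · exact ⟨Eᶜ, hE.isOpen_compl, hp, fun _ => True, fun q hq => ⟨by simp, fun h' => absurd h' hq⟩⟩

lemma SeparatesOn.mono {E K K' : Set α} {s : α → Prop} (h : SeparatesOn E s K) (hK : K' ⊆ K) :
    SeparatesOn E s K' := fun p hp => h p (hK hp)

/-- Two separating predicates agree locally, up to negation. -/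
lemma exists_iff_of_separatesAt {E : Set α} (h : ∀ p ∈ E, TwoSidedAt E p)
    {s s' : α → Prop} {p : α} (hs : ∀ᶠ q in nhds p, SeparatesAt E s q)
    (hs' : ∀ᶠ q in nhds p, SeparatesAt E s' q) :
    ∃ c : Prop, ∀ᶠ q in nhds p, q ∉ E → s q = (s' q ↔ c) := by
  by_cases hp : p ∈ E
  · obtain ⟨N, hNU, hN, hpN, -, S, T, -, -, -, hS, hT, hST, hcl⟩ := h p hp _ (hs.and hs')
    have hSE : ∀ q ∈ S, q ∈ N \ E := fun q hq => hST.symm.subset (Or.inl hq)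
    have hTE : ∀ q ∈ T, q ∈ N \ E := fun q hq => hST.symm.subset (Or.inr hq)
    obtain ⟨a, ha⟩ := closure_nonempty_iff.1 ⟨p, (hcl ⟨hpN, hp⟩).1⟩
    obtain ⟨b, hb⟩ := closure_nonempty_iff.1 ⟨p, (hcl ⟨hpN, hp⟩).2⟩
    -- A separating predicate is constant on each local side, and the two constants differ because
    -- both values occur near `p`. So two such predicates are compared by their values at the one
    -- point `a`.
    have key : ∀ t : α → Prop, (∀ q ∈ N, SeparatesAt E t q) →
        (∀ q ∈ S, t q = t a) ∧ (∀ q ∈ T, t q = ¬ t a) := by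
      intro t ht
      have h1 : ∀ q ∈ S, t q = t a := fun q hq => hS.eq_of_eventually_eq
        (fun r hr => ((ht r (hSE r hr).1).1 (hSE r hr).2).mono fun _ h' _ => h') hq ha
      have h2 : ∀ q ∈ T, t q = t b := fun q hq => hT.eq_of_eventually_eq
        (fun r hr => ((ht r (hTE r hr).1).1 (hTE r hr).2).mono fun _ h' _ => h') hq hb
      have h3 : t b = ¬ t a := by
        by_contra hne
        have hne' : t b = t a := by
          by_cases h4 : t a <;> by_cases h5 : t b <;> simp_all
        have h4 : ∀ q ∈ N, q ∉ E → t q = t a := fun q hq hqE => by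
          rcases hST.subset ⟨hq, hqE⟩ with h' | h'
          exacts [h1 q h', (h2 q h').trans hne']
        obtain ⟨f1, f2⟩ := (ht p hpN).2 hp
        obtain ⟨q, ⟨hqE, hq⟩, hqN⟩ := (f1.and_eventually (hN.mem_nhds hpN)).exists
        obtain ⟨r, ⟨hrE, hr⟩, hrN⟩ := (f2.and_eventually (hN.mem_nhds hpN)).exists
        rw [h4 q hqN hqE] at hq
        rw [h4 r hrN hrE] at hr
        exact hr hq
      exact ⟨h1, fun q hq => (h2 q hq).trans h3⟩
    obtain ⟨k1, k2⟩ := key s fun q hq => (hNU hq).1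
    obtain ⟨k1', k2'⟩ := key s' fun q hq => (hNU hq).2
    refine ⟨s a ↔ s' a, ?_⟩
    filter_upwards [hN.mem_nhds hpN] with q hq hqE
    rcases hST.subset ⟨hq, hqE⟩ with h' | h'
    · rw [k1 q h', k1' q h']
      exact propext (by tauto)
    · rw [k2 q h', k2' q h']
      exact propext (by tauto)
  · refine ⟨s p ↔ s' p, ?_⟩
    filter_upwards [hs.self_of_nhds.1 hp, hs'.self_of_nhds.1 hp] with q h1 h2 _
    rw [h1, h2]
    exact propext (by tauto)

/-- Two separating predicates agree near connected sets, up to negation. -/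
lemma exists_iff_of_separatesOn {E : Set α} (hE : IsClosed E) (h : ∀ p ∈ E, TwoSidedAt E p)
    {s s' : α → Prop} {L : Set α} (hL : IsPreconnected L) (hs : SeparatesOn E s L)
    (hs' : SeparatesOn E s' L) :
    ∃ c : Prop, ∀ p ∈ L, ∀ᶠ q in nhds p, q ∉ E → s q = (s' q ↔ c) := by
  have h1 : ∀ p ∈ L, ∃ c : Prop, ∀ᶠ q in nhds p, q ∉ E → s q = (s' q ↔ c) := fun p hp =>
    exists_iff_of_separatesAt h (hs p hp) (hs' p hp)
  choose! c hc using h1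
  -- Points off `E` occur near every point of `L`; they determine the local sign, which is therefore
  -- locally constant.
  have hfreq : ∀ p ∈ L, ∃ᶠ q in nhds p, q ∉ E := by
    intro p hp
    by_cases hpE : p ∈ E
    · exact (((hs p hp).self_of_nhds.2 hpE).1).mono fun q hq => hq.1
    · have : ∀ᶠ q in nhds p, q ∉ E := hE.isOpen_compl.mem_nhds hpE
      exact this.frequently
  have hloc : ∀ p ∈ L, ∀ᶠ q in nhds p, q ∈ L → c q = c p := by
    intro p hp
    filter_upwards [(hc p hp).eventually_nhds] with q hq hqL
    obtain ⟨r, hr, h2, h3⟩ := ((hfreq q hqL).and_eventually (hq.and (hc q hqL))).exists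
    have h2 := h2 hr
    rw [h3 hr] at h2
    by_cases h4 : s' r <;> simp_all [not_iff_not]
  rcases L.eq_empty_or_nonempty with rfl | ⟨p, hp⟩
  · exact ⟨True, by simp⟩
  · refine ⟨c p, fun q hq => ?_⟩
    rw [hL.eq_of_eventually_eq hloc hp hq]
    exact hc q hq

/-- Gluing of separating predicates along the hypersurface `f = m`. -/
lemma SeparatesOn.glue {E : Set α} (hE : IsClosed E) (h : ∀ p ∈ E, TwoSidedAt E p)
    {s s' : α → Prop} {K K' : Set α} {f : α → ℝ} (hf : Continuous f) (m : ℝ)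
    (hs : SeparatesOn E s K) (hs' : SeparatesOn E s' K') (hK : ∀ p ∈ K, f p ≤ m)
    (hK' : ∀ p ∈ K', m ≤ f p) (hKK' : ∀ p ∈ K ∪ K', f p = m → p ∈ K ∩ K')
    (hL : IsPreconnected (K ∩ K')) : ∃ t, SeparatesOn E t (K ∪ K') := by
  classical
  -- On the connected overlap a single sign compares the two predicates; it is absorbed into the
  -- second one.
  obtain ⟨c, hc⟩ := exists_iff_of_separatesOn hE h hL (hs.mono inter_subset_left)
    (hs'.mono inter_subset_right)
  refine ⟨fun q => if f q ≤ m then s q else (s' q ↔ c), fun p hp => ?_⟩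
  rcases lt_trichotomy (f p) m with hlt | heq | hgt
  · have hpK : p ∈ K := hp.resolve_right fun h' => (hK' p h').not_gt hlt
    have h1 : ∀ᶠ q in nhds p, f q < m := hf.continuousAt.eventually_lt continuousAt_const hlt
    filter_upwards [hs p hpK, h1.eventually_nhds] with q h2 h3
    exact h2.congr hE (h3.mono fun r hr _ => by simp [hr.le])
  · have hpL := hKK' p hp heq
    filter_upwards [hs p hpL.1, (hc p hpL).eventually_nhds] with q h2 h3
    refine h2.congr hE (h3.mono fun r hr hrE => ?_)
    split_ifs
    · rfl
    · exact hr hrE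
  · have hpK : p ∈ K' := hp.resolve_left fun h' => (hK p h').not_gt hgt
    have h1 : ∀ᶠ q in nhds p, m < f q := continuousAt_const.eventually_lt hf.continuousAt hgt
    filter_upwards [hs' p hpK, h1.eventually_nhds] with q h2 h3
    exact (h2.iff_const c).congr hE (h3.mono fun r hr _ => by simp [hr.not_ge])

end Separation

/-- An additive property of intervals which holds for short intervals holds for all intervals. -/
lemma forall_interval_of_add {P : ℝ → ℝ → Prop} (hadd : ∀ a b c, a ≤ b → b ≤ c → P a b → P b c → P a c)
    {δ : ℝ} (hδ : 0 < δ) (a₀ b₀ : ℝ)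
    (hloc : ∀ a b, a₀ ≤ a → a ≤ b → b ≤ b₀ → b - a ≤ δ → P a b) (h₀ : a₀ ≤ b₀) : P a₀ b₀ := by
  have key : ∀ n : ℕ, ∀ b, a₀ ≤ b → b ≤ b₀ → b - a₀ ≤ (n + 1) * δ → P a₀ b := by
    intro n
    induction n with
    | zero =>
      intro b h1 h2 h3
      exact hloc a₀ b le_rfl h1 h2 (by simpa using h3)
    | succ n ih =>
      intro b h1 h2 h3
      push_cast at h3
      rcases le_total (b - a₀) δ with h4 | h4
      · exact hloc a₀ b le_rfl h1 h2 h4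
      · refine hadd a₀ (b - δ) b (by linarith) (by linarith) (ih _ (by linarith) (by linarith) ?_)
          (hloc _ _ (by linarith) (by linarith) h2 (by linarith))
        linarith
  obtain ⟨n, hn⟩ := exists_nat_ge ((b₀ - a₀) / δ)
  refine key n b₀ h₀ le_rfl ?_
  rw [div_le_iff₀ hδ] at hn
  linarith

/-- The rectangle `[a, b] × [c, d]` in the complex plane. -/
def complexRect (a b c d : ℝ) : Set ℂ := {z | (a ≤ z.re ∧ z.re ≤ b) ∧ (c ≤ z.im ∧ z.im ≤ d)}

lemma mem_complexRect {a b c d : ℝ} {z : ℂ} :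
    z ∈ complexRect a b c d ↔ (a ≤ z.re ∧ z.re ≤ b) ∧ (c ≤ z.im ∧ z.im ≤ d) := Iff.rfl

lemma complexRect_eq (a b c d : ℝ) : complexRect a b c d = Icc a b ×ℂ Icc c d := by
  ext z
  simp [complexRect, Complex.mem_reProdIm]

lemma isCompact_complexRect (a b c d : ℝ) : IsCompact (complexRect a b c d) := by
  rw [complexRect_eq]
  exact isCompact_Icc.reProdIm isCompact_Icc

lemma isPreconnected_complexRect (a b c d : ℝ) : IsPreconnected (complexRect a b c d) := by
  rw [complexRect_eq]
  refine Convex.isPreconnected ?_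
  exact ((convex_Icc a b).is_linear_preimage Complex.reLm.isLinear).inter
    ((convex_Icc c d).is_linear_preimage Complex.imLm.isLinear)

section Plane

variable {E : Set ℂ}

/-- Sufficiently small rectangles lie in the domain of one local predicate. Pieces are glued along
horizontal segments and then along vertical ones; these are connected, so no sign conflict arises.
-/
lemma exists_separatesOn_complexRect (hE : IsClosed E) (h : ∀ p ∈ E, TwoSidedAt E p)
    {a b c d : ℝ} (hab : a ≤ b) (hcd : c ≤ d) : ∃ s, SeparatesOn E s (complexRect a b c d) := by
  choose U hU hpU s hs using exists_separatesAt hE h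
  obtain ⟨δ, hδ, hδU⟩ := lebesgue_number_lemma_of_metric (isCompact_complexRect a b c d) hU
    (fun p _ => mem_iUnion.2 ⟨p, hpU p⟩)
  -- A rectangle with sides at most `δ / 3` lies within distance `2δ / 3 < δ` of its lower left
  -- corner, hence in one set of the cover.
  refine forall_interval_of_add (P := fun a b => ∃ s, SeparatesOn E s (complexRect a b c d))
    ?_ (δ := δ / 3) (by positivity) a b ?_ hab
  · rintro a b b' hab hbb ⟨s, hs⟩ ⟨s', hs'⟩
    have hunion : complexRect a b' c d = complexRect a b c d ∪ complexRect b b' c d := by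
      ext z
      simp only [mem_union, mem_complexRect]
      constructor
      · rintro ⟨⟨h1, h2⟩, h3⟩
        rcases le_total z.re b with h4 | h4
        exacts [Or.inl ⟨⟨h1, h4⟩, h3⟩, Or.inr ⟨⟨h4, h2⟩, h3⟩]
      · rintro (⟨⟨h1, h2⟩, h3⟩ | ⟨⟨h1, h2⟩, h3⟩)
        exacts [⟨⟨h1, h2.trans hbb⟩, h3⟩, ⟨⟨hab.trans h1, h2⟩, h3⟩]
    have hinter : complexRect a b c d ∩ complexRect b b' c d = complexRect b b c d := by
      ext z
      simp only [mem_inter_iff, mem_complexRect]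
      constructor
      · rintro ⟨⟨⟨h1, h2⟩, h3⟩, ⟨h4, h5⟩, -⟩
        exact ⟨⟨h4, h2⟩, h3⟩
      · rintro ⟨⟨h1, h2⟩, h3⟩
        exact ⟨⟨⟨hab.trans h1, h2⟩, h3⟩, ⟨h1, h2.trans hbb⟩, h3⟩
    rw [hunion]
    refine hs.glue hE h Complex.continuous_re b hs' (fun p hp => hp.1.2) (fun p hp => hp.1.1) ?_ ?_
    · intro p hp hpb
      rw [hinter]
      exact ⟨⟨hpb.ge, hpb.le⟩, hp.elim (fun h' => h'.2) fun h' => h'.2⟩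
    · rw [hinter]
      exact isPreconnected_complexRect _ _ _ _
  intro a' b' ha' hab' hb' hδ1
  refine forall_interval_of_add (P := fun c d => ∃ s, SeparatesOn E s (complexRect a' b' c d))
    ?_ (δ := δ / 3) (by positivity) c d ?_ hcd
  · rintro c d d' hcd hdd ⟨s, hs⟩ ⟨s', hs'⟩
    have hunion : complexRect a' b' c d' = complexRect a' b' c d ∪ complexRect a' b' d d' := by
      ext z
      simp only [mem_union, mem_complexRect]
      constructor
      · rintro ⟨h3, h1, h2⟩
        rcases le_total z.im d with h4 | h4
        exacts [Or.inl ⟨h3, h1, h4⟩, Or.inr ⟨h3, h4, h2⟩]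
      · rintro (⟨h3, h1, h2⟩ | ⟨h3, h1, h2⟩)
        exacts [⟨h3, h1, h2.trans hdd⟩, ⟨h3, hcd.trans h1, h2⟩]
    have hinter : complexRect a' b' c d ∩ complexRect a' b' d d' = complexRect a' b' d d := by
      ext z
      simp only [mem_inter_iff, mem_complexRect]
      constructor
      · rintro ⟨⟨h3, h1, h2⟩, -, h4, h5⟩
        exact ⟨h3, h4, h2⟩
      · rintro ⟨h3, h1, h2⟩
        exact ⟨⟨h3, hcd.trans h1, h2⟩, h3, h1, h2.trans hdd⟩
    rw [hunion]
    refine hs.glue hE h Complex.continuous_im d hs' (fun p hp => hp.2.2) (fun p hp => hp.2.1) ?_ ?_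
    · intro p hp hpb
      rw [hinter]
      exact ⟨hp.elim (fun h' => h'.1) fun h' => h'.1, hpb.ge, hpb.le⟩
    · rw [hinter]
      exact isPreconnected_complexRect _ _ _ _
  intro c' d' hc' hcd' hd' hδ2
  obtain ⟨i, hi⟩ := hδU ⟨a', c'⟩ ⟨⟨ha', hab'.trans hb'⟩, hc', hcd'.trans hd'⟩
  refine ⟨s i, fun p hp => ?_⟩
  have hpU' : p ∈ U i := by
    apply hi
    rw [Metric.mem_ball, Complex.dist_eq]
    have h1 : |(p - ⟨a', c'⟩ : ℂ).re| ≤ δ / 3 := by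
      rw [Complex.sub_re, abs_le]
      constructor <;> linarith [hp.1.1, hp.1.2]
    have h2 : |(p - ⟨a', c'⟩ : ℂ).im| ≤ δ / 3 := by
      rw [Complex.sub_im, abs_le]
      constructor <;> linarith [hp.2.1, hp.2.2]
    linarith [Complex.norm_le_abs_re_add_abs_im (p - ⟨a', c'⟩ : ℂ)]
  filter_upwards [(hU i).mem_nhds hpU'] with q hq
  exact hs i q hq

/-- A closed subset of the plane which is locally two-sided has globally two sides. -/
theorem exists_separatesAt_of_isClosed (hE : IsClosed E) (h : ∀ p ∈ E, TwoSidedAt E p) :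
    ∃ s : ℂ → Prop, ∀ p, SeparatesAt E s p := by
  obtain ⟨z, hz⟩ : ∃ z, z ∉ E := by
    by_contra! hall
    obtain ⟨N, -, hN, hpN, -, S, T, -, -, -, -, -, hST, hcl⟩ := h 0 (hall 0) univ Filter.univ_mem
    obtain ⟨a, ha⟩ := closure_nonempty_iff.1 ⟨0, (hcl ⟨hpN, hall 0⟩).1⟩
    exact (hST.symm.subset (Or.inl ha)).2 (hall a)
  let K : ℕ → Set ℂ := fun n => complexRect (-n) n (-n) n
  have hK : ∀ n, ∃ s, SeparatesOn E s (K n) := fun n =>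
    exists_separatesOn_complexRect hE h (by linarith [(Nat.cast_nonneg n : (0 : ℝ) ≤ n)])
      (by linarith [(Nat.cast_nonneg n : (0 : ℝ) ≤ n)])
  choose s' hs' using hK
  have hnorm : ∀ (q : ℂ) (n : ℕ), ‖q‖ ≤ n → q ∈ K n := by
    intro q n hq
    have h1 := abs_le.1 ((Complex.abs_re_le_norm q).trans hq)
    have h2 := abs_le.1 ((Complex.abs_im_le_norm q).trans hq)
    exact ⟨h1, h2⟩
  obtain ⟨n₀, hn₀⟩ := exists_nat_ge ‖z‖
  -- All predicates are normalized to hold at the base point `z ∉ E`, which fixes the signs and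
  -- makes those on nested squares agree.
  let s : ℕ → ℂ → Prop := fun n q => s' n q ↔ s' n z
  have hs : ∀ n, SeparatesOn E (s n) (K n) := fun n p hp =>
    (hs' n p hp).mono fun q hq => hq.iff_const _
  have hcompat : ∀ n m, n₀ ≤ n → n ≤ m → ∀ q ∈ K n, q ∉ E → s n q = s m q := by
    intro n m hn hnm q hq hqE
    have hnm' : (n : ℝ) ≤ m := by exact_mod_cast hnm
    have hsub : K n ⊆ K m := fun q hq =>
      ⟨⟨by linarith [hq.1.1], by linarith [hq.1.2]⟩, by linarith [hq.2.1], by linarith [hq.2.2]⟩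
    obtain ⟨c, hc⟩ := exists_iff_of_separatesOn hE h (isPreconnected_complexRect _ _ _ _) (hs n)
      ((hs m).mono hsub)
    have hzn : z ∈ K n := hnorm z n (hn₀.trans (by exact_mod_cast hn))
    have h1 := (hc z hzn).self_of_nhds hz
    have h2 := (hc q hq).self_of_nhds hqE
    have hc' : c := by simpa [s] using h1
    simpa [hc'] using h2
  have hcompat' : ∀ n m, n₀ ≤ n → n₀ ≤ m → ∀ q ∈ K n, q ∈ K m → q ∉ E → s n q = s m q := by
    intro n m hn hm q hqn hqm hqE
    rcases le_total n m with h' | h'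
    · exact hcompat n m hn h' q hqn hqE
    · exact (hcompat m n hm h' q hqm hqE).symm
  -- Each point uses a square that contains both it and `z`; near `p` this agrees off `E` with the
  -- predicate of one fixed square.
  refine ⟨fun q => s (max n₀ ⌈‖q‖⌉₊) q, fun p => ?_⟩
  obtain ⟨n, hn⟩ := exists_nat_gt ‖p‖
  have hpn : ‖p‖ < (max n₀ n : ℕ) := hn.trans_le (by exact_mod_cast le_max_right _ _)
  refine ((hs (max n₀ n) p (hnorm p _ hpn.le)).self_of_nhds).congr hE ?_
  have h1 : ∀ᶠ q in nhds p, ‖q‖ < (max n₀ n : ℕ) :=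
    continuous_norm.continuousAt.eventually_lt continuousAt_const hpn
  filter_upwards [h1] with q hq hqE
  refine hcompat' _ _ (le_max_left _ _) (le_max_left _ _) q (hnorm _ _ hq.le) (hnorm _ _ ?_) hqE
  exact (Nat.le_ceil _).trans (by exact_mod_cast le_max_right _ _)

end Plane

/-! ### Inversion: separation by curves punctured at one point. -/

namespace ChromaticAlgebra

/-- The inversion with centre `v`. -/
def inversionAt (v : ℂ) : OpenPartialHomeomorph ℂ ℂ where
  toFun w := v + w⁻¹
  invFun z := (z - v)⁻¹
  source := {0}ᶜ
  target := {v}ᶜ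
  map_source' w hw := by simpa using hw
  map_target' z hz := by simpa [sub_eq_zero] using hz
  left_inv' w hw := by simp
  right_inv' z hz := by simp
  open_source := isOpen_compl_singleton
  open_target := isOpen_compl_singleton
  continuousOn_toFun := continuousOn_const.add (continuousOn_inv₀.mono fun w hw => hw)
  continuousOn_invFun := by
    refine ContinuousOn.inv₀ (by fun_prop) fun z hz => ?_
    simpa [sub_eq_zero] using hz

/-- Inversion exchanges `v` and infinity: boundedness of `E` keeps the preimage away from `0`, and
the one limit point that `E` may miss disappears at infinity. -/
lemma isClosed_inversion_preimage {E : Set ℂ} (hb : Bornology.IsBounded E) {v : ℂ}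
    (hcl : closure E ⊆ E ∪ {v}) : IsClosed {w : ℂ | w ≠ 0 ∧ v + w⁻¹ ∈ E} := by
  rw [← isOpen_compl_iff, isOpen_iff_mem_nhds]
  intro w hw
  by_cases hw0 : w = 0
  · subst hw0
    obtain ⟨M, hM, hEM⟩ := hb.subset_ball_lt 0 v
    have : Metric.ball (0 : ℂ) M⁻¹ ∈ nhds 0 := Metric.ball_mem_nhds _ (by positivity)
    filter_upwards [this] with u hu
    rintro ⟨hu0, huE⟩
    have h1 := hEM huE
    rw [Metric.mem_ball, dist_eq_norm, add_sub_cancel_left, norm_inv] at h1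
    rw [Metric.mem_ball, dist_zero_right] at hu
    have h2 : 0 < ‖u‖ := norm_pos_iff.2 hu0
    exact lt_asymm h1 ((lt_inv_comm₀ h2 hM).1 hu)
  · have h1 : v + w⁻¹ ∉ closure E := by
      intro h'
      rcases hcl h' with h' | h'
      · exact hw ⟨hw0, h'⟩
      · simp [hw0] at h'
    have hc : ContinuousAt (fun u : ℂ => v + u⁻¹) w :=
      continuousAt_const.add (continuousAt_inv₀ hw0)
    filter_upwards [hc.preimage_mem_nhds (isClosed_closure.isOpen_compl.mem_nhds h1)] with u hu
    exact fun h' => hu (subset_closure h'.2)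

/-- A bounded locally two-sided subset of the plane whose closure contains at most one further
point has globally two sides. -/
theorem exists_separatesAt_of_isBounded {E W : Set Plane} (hb : Bornology.IsBounded E) (hW : W.Subsingleton)
    (hd : Disjoint E W) (hcl : closure E ⊆ E ∪ W) (h : ∀ p ∈ E, TwoSidedAt E p) :
    ∃ s : Plane → Prop, ∀ p ∉ W, SeparatesAt E s p := by
  let g : ℂ ≃ₜ Plane := Complex.equivRealProdCLM.toHomeomorph
  have hg : ∀ p ∈ g ⁻¹' E, TwoSidedAt (g ⁻¹' E) p := fun p hp =>
    (h (g p) hp).of_openPartialHomeomorph g.toOpenPartialHomeomorph (by simp) (by simp)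
  have hbg : Bornology.IsBounded (g ⁻¹' E) := by
    have := Complex.equivRealProdCLM.symm.lipschitz.isBounded_image hb
    rwa [ContinuousLinearEquiv.image_symm_eq_preimage] at this
  rcases hW.eq_empty_or_singleton with rfl | ⟨v, rfl⟩
  · have hE : IsClosed E := by
      rw [union_empty] at hcl
      exact isClosed_of_closure_subset hcl
    obtain ⟨s, hs⟩ := exists_separatesAt_of_isClosed (hE.preimage g.continuous) hg
    refine ⟨fun q => s (g.symm q), fun p _ => ?_⟩
    have := (hs (g.symm p)).of_openPartialHomeomorph (E := E) g.toOpenPartialHomeomorph (by simp)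
      (by simp)
    simpa using this
  · have hvE : v ∉ E := fun h' => Set.disjoint_left.1 hd h' rfl
    have hclg : closure (g ⁻¹' E) ⊆ g ⁻¹' E ∪ {g.symm v} := by
      rw [← g.preimage_closure]
      intro p hp
      rcases hcl hp with h' | h'
      · exact Or.inl h'
      · right
        rw [mem_singleton_iff] at h' ⊢
        rw [← h', g.symm_apply_apply]
    set E' : Set ℂ := {w : ℂ | w ≠ 0 ∧ g.symm v + w⁻¹ ∈ g ⁻¹' E} with hE'
    let φ : OpenPartialHomeomorph ℂ Plane :=
      (inversionAt (g.symm v)).trans g.toOpenPartialHomeomorph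
    have hsrc : ∀ w, w ∈ φ.source ↔ w ≠ 0 := fun w => by
      simp [φ, inversionAt]
    have hφ : ∀ w, φ w = g (g.symm v + w⁻¹) := fun w => rfl
    have hφE : ∀ w ∈ φ.source, w ∈ E' ↔ φ w ∈ E := fun w hw => by
      rw [hφ]
      exact and_iff_right ((hsrc w).1 hw)
    obtain ⟨s, hs⟩ := exists_separatesAt_of_isClosed (isClosed_inversion_preimage hbg hclg)
      (fun w hw => (h (φ w) hw.2).of_openPartialHomeomorph φ ((hsrc w).2 hw.1) hφE)
    refine ⟨fun q => s (φ.symm q), fun p hp => ?_⟩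
    have hpt : p ∈ φ.target := by
      simp only [φ, OpenPartialHomeomorph.trans_target, inversionAt]
      simp only [Homeomorph.toOpenPartialHomeomorph_target, univ_inter, mem_preimage,
        mem_compl_iff, mem_singleton_iff]
      intro h'
      exact hp (by simpa using h')
    have := (hs (φ.symm p)).of_openPartialHomeomorph φ (φ.map_target hpt) hφE
    rwa [φ.right_inv hpt] at this

end ChromaticAlgebra

/-! ### Finiteness of the edges, and loops as bridges of the dual. -/

lemma TwoSidedAt.congr {α : Type*} [TopologicalSpace α] {E E' U : Set α} {p : α}
    (h : TwoSidedAt E p) (hU : IsOpen U) (hp : p ∈ U) (hE : ∀ q ∈ U, q ∈ E' ↔ q ∈ E) :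
    TwoSidedAt E' p :=
  TwoSidedAt.of_openPartialHomeomorph (OpenPartialHomeomorph.ofSet U hU) hp hE h

/-- Each connected piece lies in one component, so every point of `X` has a neighbourhood meeting
finitely many components. The condition is imposed on the compact set `X` because edges may
accumulate at vertices outside `F`. -/
lemma finite_componentsIn {α : Type*} [TopologicalSpace α] {X F : Set α} (hX : IsCompact X)
    (hF : F ⊆ X) (h : ∀ p ∈ X, ∃ N ∈ nhds p, ∃ 𝒮 : Set (Set α), 𝒮.Finite ∧
      (∀ S ∈ 𝒮, IsPreconnected S) ∧ N ∩ F = ⋃₀ 𝒮) : (componentsIn F).Finite := by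
  have key : {C | C ∈ componentsIn F ∧ (C ∩ X).Nonempty}.Finite := by
    refine hX.induction_on (p := fun K => {C | C ∈ componentsIn F ∧ (C ∩ K).Nonempty}.Finite)
      ?_ ?_ ?_ ?_
    · simp
    · intro s t hst ht
      exact ht.subset fun C hC => ⟨hC.1, hC.2.mono (inter_subset_inter_right _ hst)⟩
    · intro s t hs ht
      refine (hs.union ht).subset ?_
      rintro C ⟨hC, p, hpC, hp | hp⟩
      exacts [Or.inl ⟨hC, p, hpC, hp⟩, Or.inr ⟨hC, p, hpC, hp⟩]
    · intro p hp
      obtain ⟨N, hN, 𝒮, hfin, hconn, hcov⟩ := h p hp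
      refine ⟨N, mem_nhdsWithin_of_mem_nhds hN, ?_⟩
      have hsub : ∀ S ∈ 𝒮, S ⊆ F := fun S hS =>
        (subset_sUnion_of_mem hS).trans (hcov.symm.subset.trans inter_subset_right)
      have hfin' : ∀ S ∈ 𝒮, {C | C ∈ componentsIn F ∧ (C ∩ S).Nonempty}.Finite := fun S hS => by
        refine Set.Subsingleton.finite ?_
        rintro C ⟨hC, p, hpC, hpS⟩ D ⟨hD, q, hqD, hqS⟩
        exact componentsIn.eq_of_mem hC hD hpC (componentsIn.subset_of_isPreconnected hD
          (hconn S hS) (hsub S hS) ⟨q, hqS, hqD⟩ hpS)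
      refine (hfin.biUnion hfin').subset ?_
      rintro C ⟨hC, p, hpC, hpN⟩
      obtain ⟨S, hS, hpS⟩ := hcov.subset ⟨hpN, componentsIn.subset hC hpC⟩
      exact mem_biUnion hS ⟨hC, p, hpC, hpS⟩
  refine key.subset fun C hC => ⟨hC, ?_⟩
  obtain ⟨p, hp⟩ := componentsIn.nonempty hC
  exact ⟨p, hp, hF (componentsIn.subset hC hp)⟩

namespace ChromaticAlgebra

lemma isPreconnected_compl_of_finite {V : Set Plane} (hV : V.Finite) : IsPreconnected Vᶜ := by
  refine (hV.countable.isConnected_compl_of_one_lt_rank ?_).isPreconnected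
  have : Module.rank ℝ Plane = 1 + 1 := by simp
  rw [this, one_add_one_eq_two]
  exact Cardinal.one_lt_two

namespace Tame

variable {Y X V : Set Plane} {e e' A B C D : Set Plane} {p : Plane}

/-- The edges of a compact graph are finite in number. -/
lemma finite_edges_of_isCompact (hX : IsCompact X) (hV : V.Finite)
    (harc : ∀ p ∈ X \ V, ∃ N, IsOpen N ∧ p ∈ N ∧ IsPreconnected (N ∩ X) ∧ Disjoint N V)
    (hval : ∀ v ∈ V, ∃ d, HasValence X v d) : (edgesOf X V).Finite := by
  refine finite_componentsIn hX sdiff_subset fun p hp => ?_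
  by_cases hpV : p ∈ V
  · obtain ⟨d, hd⟩ := hval p hpV
    have hU : (V \ {p})ᶜ ∈ nhds p :=
      ((hV.subset sdiff_subset).isClosed.isOpen_compl).mem_nhds (by simp)
    obtain ⟨N, hNU, hN, hpN, ⟨ρ, hρ, hNρ⟩, -⟩ := hd.exists_nhds hU
    refine ⟨N, hN.mem_nhds hpN, range ρ, finite_range ρ, by rintro _ ⟨k, rfl⟩; exact hρ k, ?_⟩
    rw [sUnion_range, ← hNρ]
    ext q
    constructor
    · rintro ⟨h1, h2, h3⟩
      exact ⟨⟨h1, h2⟩, fun h => h3 (by rw [mem_singleton_iff] at h; rwa [h])⟩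
    · rintro ⟨⟨h1, h2⟩, h3⟩
      exact ⟨h1, h2, fun h => hNU h1 ⟨h, h3⟩⟩
  · obtain ⟨N, hN, hpN, hc, hd⟩ := harc p ⟨hp, hpV⟩
    refine ⟨N, hN.mem_nhds hpN, {N ∩ X}, finite_singleton _, by simpa using hc, ?_⟩
    rw [sUnion_singleton, ← inter_sdiff_assoc, (hd.mono_left inter_subset_left).sdiff_eq_left]

section

variable (h : Tame Y X V)
include h

/-- The two sides of a loop are separated by the loop. -/
lemma exists_separation (hl : (dualOf Y X V).IsLink e A B) (hY : ∀ p ∈ e, Y ∈ nhds p)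
    (hb : Bornology.IsBounded e) (hloop : (closure e ∩ V).Subsingleton)
    (hside : ∀ p ∈ e, TwoSidedAt X p) : ∃ c : Set Plane → Prop, c A ≠ c B ∧
      ∀ e' x y, e' ≠ e → (dualOf Y X V).IsLink e' x y → c x = c y := by
  have heV : ∀ p ∈ e, p ∉ V := fun p hp => (componentsIn.subset hl.1 hp).2
  -- Near its points the edge is all of the graph, so it inherits two-sidedness.
  have hside' : ∀ p ∈ e, TwoSidedAt e p := fun p hp => by
    obtain ⟨N, hN, hpN, hNX, -⟩ := h.exists_nhds_of_isLink hl hp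
    refine (hside p hp).congr hN hpN fun q hq => ⟨fun hqe => (componentsIn.subset hl.1 hqe).1,
      fun hqX => hNX ⟨hq, hqX⟩⟩
  obtain ⟨s, hs⟩ := exists_separatesAt_of_isBounded hb hloop
    (Set.disjoint_left.2 fun p hp hp' => heV p hp hp'.2)
    (fun p hp => by
      by_cases hpV : p ∈ V
      · exact Or.inr ⟨hp, hpV⟩
      · exact Or.inl (h.mem_edge_of_mem_closure hl.1 hp hpV)) hside'
  have hconst : ∀ D ∈ regionsOf Y X, ∀ x ∈ D, ∀ y ∈ D, s x = s y := by
    intro D hD x hx y hy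
    refine (componentsIn.isPreconnected hD).eq_of_eventually_eq (fun p hp => ?_) hx hy
    have hpX := (componentsIn.subset hD hp).2
    exact ((hs p fun h' => hpX (h.verts_subset h'.2)).1
      fun h' => hpX (componentsIn.subset hl.1 h').1).mono fun q hq _ => hq
  -- Regions avoid `e` and its end vertex, so the side predicate is constant on them and descends to
  -- the vertices of the dual.
  have hc : ∀ D ∈ regionsOf Y X, ∀ x ∈ D, (∃ y ∈ D, s y) = s x := fun D hD x hx => propext
    ⟨fun ⟨y, hy, hsy⟩ => hconst D hD x hx y hy ▸ hsy, fun hsx => ⟨x, hx, hsx⟩⟩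
  refine ⟨fun D => ∃ y ∈ D, s y, ?_, ?_⟩
  · intro hAB
    obtain ⟨p, hp⟩ := componentsIn.nonempty hl.1
    obtain ⟨N, hN, hpN, hNX, hNA⟩ := h.exists_nhds_of_isLink hl hp
    -- If `A` and `B` were on the same side, `s` would be constant off `e` near `p`: there all such
    -- points lie in `A` or `B`.
    have hval : ∀ᶠ q in nhds p, q ∉ e → s q = ∃ y ∈ A, s y := by
      filter_upwards [hN.mem_nhds hpN, hY p hp] with q hqN hqY hqe
      rcases hNA ⟨⟨hqN, hqY⟩, fun h' => hqe (hNX ⟨hqN, h'⟩)⟩ with hq | hq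
      · exact (hc A hl.2.1 q hq).symm
      · exact (hc B hl.2.2.1 q hq).symm.trans hAB.symm
    obtain ⟨f1, f2⟩ := (hs p fun h' => heV p hp h'.2).2 hp
    obtain ⟨q, ⟨hqe, hq⟩, hq'⟩ := (f1.and_eventually hval).exists
    obtain ⟨r, ⟨hre, hr⟩, hr'⟩ := (f2.and_eventually hval).exists
    rw [hq' hqe] at hq
    rw [hr' hre] at hr
    exact hr hq
  · intro e' x y hne hl'
    obtain ⟨p, hp⟩ := componentsIn.nonempty hl'.1
    have hpV : p ∉ V := (componentsIn.subset hl'.1 hp).2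
    have hpe : p ∉ e := fun h' => hne (componentsIn.eq_of_mem hl'.1 hl.1 hp h')
    have hev := (hs p fun h' => hpV h'.2).1 hpe
    have key : ∀ D ∈ regionsOf Y X, p ∈ closure D → (∃ y ∈ D, s y) = s p := by
      intro D hD hpD
      obtain ⟨q, hq, hqD⟩ := ((mem_closure_iff_frequently.1 hpD).and_eventually hev).exists
      rw [hc D hD q hq, hqD]
    exact (key x hl'.2.1 (mem_closure_left hl' hp)).trans
      (key y hl'.2.2.1 (mem_closure_right hl' hp)).symm

lemma edgeSet_finite : (dualOf Y X V).edgeSet.Finite := by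
  rw [h.edgeSet_dualOf]
  exact h.finite_edges

lemma chromaticPolynomial_of_isLoop (he : e ∈ edgesOf X V) (hY : ∀ p ∈ e, Y ∈ nhds p)
    (hb : Bornology.IsBounded e) (hloop : (closure e ∩ V).Subsingleton)
    (hside : ∀ p ∈ e, TwoSidedAt X p) : (dualOf Y X V).chromaticPolynomial =
      (Polynomial.X - 1) * (dualOf Y (X \ e) V).chromaticPolynomial := by
  obtain ⟨A, B, hl⟩ := h.exists_isLink he
  obtain ⟨c, hc, hc'⟩ := h.exists_separation hl hY hb hloop hside
  rw [Graph.chromaticPolynomial_eq_of_bridge h.finite_regions h.edgeSet_finite hl c hc hc',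
    (h.isIsoTo_contractEdge hl).chromaticPolynomial_eq]

/-- The only edge on which `D` accumulates is `e`. It does accumulate there, as otherwise `D` would
be all of `Y \ V` and contain `e`; and separation gives a different region on the other side. -/
lemma isPendant_of_closure_subset (he : e ∈ edgesOf X V) (hY : ∀ p ∈ e, Y ∈ nhds p)
    (hb : Bornology.IsBounded e) (hloop : (closure e ∩ V).Subsingleton)
    (hside : ∀ p ∈ e, TwoSidedAt X p) (hD : D ∈ regionsOf Y X) (hcl : closure D ⊆ D ∪ closure e) :
    (∃ A, A ≠ D ∧ (dualOf Y X V).IsLink e A D) ∧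
      (∀ e' A, (dualOf Y X V).IsLink e' A D → e' = e) ∧
      (dualOf Y (X \ e) V).IsIsoTo ((dualOf Y X V).deleteVerts {D}) := by
  have hclD : ∀ p ∈ X \ V, p ∈ closure D → p ∈ e := fun p hp hpD =>
    h.mem_edge_of_mem_closure he
      ((hcl hpD).resolve_left fun h' => (componentsIn.subset hD h').2 hp.1) hp.2
  obtain ⟨A, B, hl⟩ := h.exists_isLink he
  obtain ⟨c, hc, -⟩ := h.exists_separation hl hY hb hloop hside
  have hne : (closure D ∩ (X \ V)).Nonempty := by
    rw [nonempty_iff_ne_empty]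
    intro h0
    have hDY := h.eq_diff_of_closure_subset hD h0
    obtain ⟨p, hp⟩ := componentsIn.nonempty he
    have hpX := componentsIn.subset he hp
    have : p ∈ D := hDY ▸ ⟨h.subset hpX.1, hpX.2⟩
    exact (componentsIn.subset hD this).2 hpX.1
  obtain ⟨p, hpD, hp⟩ := hne
  have hl' : ∃ A, A ≠ D ∧ (dualOf Y X V).IsLink e A D := by
    have hAB : A ≠ B := fun h' => hc (h' ▸ rfl)
    rcases (hl.2.2.2 p (hclD p hp hpD) D hD).1 hpD with rfl | rfl
    · exact ⟨B, hAB.symm, hl.symm⟩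
    · exact ⟨A, hAB, hl⟩
  have hpend : ∀ e' A, (dualOf Y X V).IsLink e' A D → e' = e := by
    intro e' A hl'
    obtain ⟨q, hq⟩ := componentsIn.nonempty hl'.1
    exact componentsIn.eq_of_mem hl'.1 he hq
      (hclD q (componentsIn.subset hl'.1 hq) (mem_closure_right hl' hq))
  refine ⟨hl', hpend, ?_⟩
  obtain ⟨A', hA', hl''⟩ := hl'
  rw [← Graph.contractEdge_eq_deleteVerts hl'' hA' hpend]
  exact h.isIsoTo_contractEdge hl''

/-- Contraction of the edge `e`, which is not a loop, by the map `f`. -/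
lemma isIsoTo_deleteEdges (he : e ∈ edgesOf X V) (hne : (closure e ∩ V).Nonempty)
    {f : Plane → Plane} (hf : Continuous f) (hcl : IsClosedMap f) (hsurj : Function.Surjective f)
    (hY : ∀ p, f p ∈ Y ↔ p ∈ Y)
    (hfib : ∀ p q, f p = f q ↔ p = q ∨ (p ∈ closure e ∧ q ∈ closure e)) :
    (dualOf Y (f '' X) (f '' V)).IsIsoTo ((dualOf Y X V).deleteEdges {e}) := by
  -- An end of `e` in `V` makes the point to which `e` collapses a vertex, so that it belongs to no
  -- edge of the image.
  obtain ⟨v, hve, hvV⟩ := hne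
  refine h.isIsoTo_image hf hcl hsurj hY (h.closure_edge_subset he) hfib ?_ {e} ?_
  · ext q
    constructor
    · rintro ⟨⟨x, hx, rfl⟩, hq⟩
      exact ⟨x, ⟨⟨hx, fun hxV => hq ⟨x, hxV, rfl⟩⟩,
        fun hxe => hq ⟨v, hvV, (hfib v x).2 (Or.inr ⟨hve, hxe⟩)⟩⟩, rfl⟩
    · rintro ⟨x, ⟨⟨hx, hxV⟩, hxe⟩, rfl⟩
      refine ⟨⟨x, hx, rfl⟩, ?_⟩
      rintro ⟨w, hw, hwx⟩
      rcases (hfib w x).1 hwx with rfl | h'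
      exacts [hxV hw, hxe h'.2]
  · have : (X \ V) \ closure e = (X \ V) \ e := by
      ext q
      exact and_congr_right fun hq => not_congr
        ⟨fun h' => h.mem_edge_of_mem_closure he h' hq.2, fun h' => subset_closure h'⟩
    rw [this]
    exact componentsIn_diff he

lemma chromaticPolynomial_eq_sub (he : e ∈ edgesOf X V) (hne : (closure e ∩ V).Nonempty)
    {f : Plane → Plane} (hf : Continuous f) (hcl : IsClosedMap f) (hsurj : Function.Surjective f)
    (hY : ∀ p, f p ∈ Y ↔ p ∈ Y)
    (hfib : ∀ p q, f p = f q ↔ p = q ∨ (p ∈ closure e ∧ q ∈ closure e)) :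
    (dualOf Y X V).chromaticPolynomial = (dualOf Y (f '' X) (f '' V)).chromaticPolynomial -
      (dualOf Y (X \ e) V).chromaticPolynomial := by
  obtain ⟨A, B, hl⟩ := h.exists_isLink he
  rw [Graph.chromaticPolynomial_eq_sub h.edgeSet_finite hl,
    (h.isIsoTo_contractEdge hl).chromaticPolynomial_eq,
    (h.isIsoTo_deleteEdges he hne hf hcl hsurj hY hfib).chromaticPolynomial_eq]

/-- This is the collapse lemma with nothing collapsed; it yields isotopy invariance. -/
lemma chromaticPolynomial_image (g : Plane ≃ₜ Plane) (hY : ∀ p, g p ∈ Y ↔ p ∈ Y) :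
    (dualOf Y (g '' X) (g '' V)).chromaticPolynomial = (dualOf Y X V).chromaticPolynomial := by
  have := (h.isIsoTo_image g.continuous g.isClosedMap g.surjective hY (empty_subset X)
    (by simp) (by rw [sdiff_empty, image_sdiff g.injective]) ∅ (by
      rw [sdiff_empty, sdiff_empty]; rfl)).chromaticPolynomial_eq
  rwa [Graph.deleteEdges_empty] at this

end

end Tame

/-! ### Graphs in the rectangle and their closures -/

lemma isOpen_openRect : IsOpen openRect := isOpen_Ioo.prod isOpen_Ioo

lemma openRect_subset_rect : openRect ⊆ rect := prod_mono Ioo_subset_Icc_self Ioo_subset_Icc_self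

lemma isCompact_rect : IsCompact rect := isCompact_Icc.prod isCompact_Icc

lemma convex_rect : Convex ℝ rect := (convex_Icc 0 1).prod (convex_Icc 0 1)

/-- Clamping the coordinates retracts the plane onto the rectangle. A point of the open rectangle is
its own only preimage, so the connected set `Vᶜ` is mapped onto `rect \ V`. -/
lemma isPreconnected_rect_diff {V : Set Plane} (hV : V.Finite) (hVR : V ⊆ openRect) :
    IsPreconnected (rect \ V) := by
  let r : Plane → Plane := fun p => (max 0 (min 1 p.1), max 0 (min 1 p.2))
  have hr : Continuous r := by fun_prop
  have hrect : ∀ p, r p ∈ rect := fun p =>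
    ⟨⟨le_max_left _ _, max_le zero_le_one (min_le_left _ _)⟩,
      le_max_left _ _, max_le zero_le_one (min_le_left _ _)⟩
  have hfix : ∀ p ∈ rect, r p = p := fun p hp => by
    simp only [r, min_eq_right hp.1.2, max_eq_right hp.1.1, min_eq_right hp.2.2,
      max_eq_right hp.2.1]
  have key : ∀ x : ℝ, max 0 (min 1 x) ∈ Ioo (0 : ℝ) 1 → max 0 (min 1 x) = x := by
    rintro x ⟨h1, h2⟩
    have h3 : 0 < min 1 x := by
      by_contra h'
      rw [max_eq_left (not_lt.1 h')] at h1
      exact lt_irrefl _ h1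
    rw [max_eq_right h3.le] at h2 ⊢
    have h4 : x ≤ 1 := by
      by_contra h'
      rw [min_eq_left (not_le.1 h').le] at h2
      exact lt_irrefl _ h2
    exact min_eq_right h4
  have : rect \ V = r '' Vᶜ := by
    ext p
    constructor
    · rintro ⟨hp, hpV⟩
      exact ⟨p, hpV, hfix p hp⟩
    · rintro ⟨q, hq, rfl⟩
      refine ⟨hrect q, fun h' => hq ?_⟩
      have h1 := hVR h'
      have : r q = q := Prod.ext (key _ h1.1) (key _ h1.2)
      rwa [← this]
  rw [this]
  exact (isPreconnected_compl_of_finite hV).image r hr.continuousOn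

lemma _root_.TwoSidedAt.exists_arc {Y X V : Set Plane} {p : Plane} (h : TwoSidedAt X p) (hY : Y ∈ nhds p)
    (hV : V.Finite) (hpV : p ∉ V) :
    ∃ N, IsOpen N ∧ p ∈ N ∧ IsPreconnected (N ∩ X) ∧ Disjoint N V ∧
    ∃ S T, IsPreconnected S ∧ IsPreconnected T ∧ (N ∩ Y) \ X = S ∪ T ∧
      N ∩ X ⊆ closure S ∩ closure T := by
  obtain ⟨N, hNU, hN, hpN, hc, S, T, -, -, -, hS, hT, hST, hcl⟩ :=
    h _ (Filter.inter_mem hY (hV.isClosed.isOpen_compl.mem_nhds hpV))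
  refine ⟨N, hN, hpN, hc, Set.disjoint_left.2 fun q hq => (hNU hq).2, S, T, hS, hT, ?_, hcl⟩
  rwa [inter_eq_left.2 (hNU.trans inter_subset_left)]

end ChromaticAlgebra

namespace ChromaticAlgebra

namespace RectGraph

variable {n : ℕ} (G : RectGraph n)

lemma carrier_subset_rect : G.carrier ⊆ rect :=
  G.carrier_subset.trans (prod_mono Ioo_subset_Icc_self subset_rfl)

lemma isCompact_carrier : IsCompact G.carrier :=
  isCompact_rect.of_isClosed_subset G.isClosed_carrier G.carrier_subset_rect

lemma verts_subset_openRect : G.verts ⊆ openRect := by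
  obtain ⟨ε, h0, h1, -⟩ := G.collar
  intro v hv
  have := h1 v hv
  exact ⟨(G.carrier_subset (G.verts_subset hv)).1, by linarith [this.1], by linarith [this.2]⟩

/-- The points of the graph on the boundary of the rectangle are the marked points. -/
lemma boundary_of_mem {p : Plane} (hp : p ∈ G.carrier) (hpR : p ∉ openRect) :
    (p.2 = 0 ∨ p.2 = 1) ∧ ∃ i, p.1 = strandPos n i := by
  obtain ⟨ε, h0, -, h2⟩ := G.collar
  have h := G.carrier_subset hp
  have hp2 : p.2 = 0 ∨ p.2 = 1 := by
    by_contra! h'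
    exact hpR ⟨h.1, h.2.1.lt_of_ne' h'.1, h.2.2.lt_of_ne h'.2⟩
  refine ⟨hp2, (h2 p ?_).1 hp⟩
  rcases hp2 with h' | h'
  · exact Or.inl ⟨h'.ge, by linarith⟩
  · exact Or.inr ⟨by linarith, h'.le⟩

/-- Near a marked point the graph is a vertical line. -/
lemma exists_collar_nhds {y₀ : ℝ} (hy : y₀ = 0 ∨ y₀ = 1) : ∃ ε > 0,
    (∀ v ∈ G.verts, v.2 ∉ Ioo (y₀ - ε) (y₀ + ε)) ∧
    ∀ p : Plane, p.2 ∈ Ioo (y₀ - ε) (y₀ + ε) → p.2 ∈ Icc (0 : ℝ) 1 →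
      (p ∈ G.carrier ↔ ∃ i, p.1 = strandPos n i) := by
  obtain ⟨ε, h0, h1, h2⟩ := G.collar
  refine ⟨ε, h0, ?_, ?_⟩
  · intro v hv hvε
    have := h1 v hv
    rcases hy with rfl | rfl
    · linarith [this.1, hvε.2]
    · linarith [this.2, hvε.1]
  · intro p hp hp'
    refine h2 p ?_
    rcases hy with rfl | rfl
    · exact Or.inl ⟨hp'.1, by linarith [hp.2]⟩
    · exact Or.inr ⟨by linarith [hp.1], hp'.2⟩

/-- In the interior this is valence `2`. At a marked point the collar provides a box, cut off at the
boundary of the rectangle, which a vertical segment divides into left and right. -/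
lemma exists_arc_rect {p : Plane} (hp : p ∈ G.carrier \ G.verts) :
    ∃ N, IsOpen N ∧ p ∈ N ∧ IsPreconnected (N ∩ G.carrier) ∧ Disjoint N G.verts ∧
    ∃ S T, IsPreconnected S ∧ IsPreconnected T ∧ (N ∩ rect) \ G.carrier = S ∪ T ∧
      N ∩ G.carrier ⊆ closure S ∩ closure T := by
  by_cases hpR : p ∈ openRect
  · exact (G.valence_two p hp hpR).twoSidedAt.exists_arc
      (Filter.mem_of_superset (isOpen_openRect.mem_nhds hpR) openRect_subset_rect)
      G.finite_verts hp.2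
  · obtain ⟨hp2, i, hi⟩ := G.boundary_of_mem hp.1 hpR
    obtain ⟨ε, h0, h1, h2⟩ := G.exists_collar_nhds hp2
    obtain ⟨U, hU, hiU, hU'⟩ := exists_open_strandPos i
    obtain ⟨δ, hδ, hδU⟩ := Metric.mem_nhds_iff.1
      ((hU.inter isOpen_Ioo).mem_nhds ⟨hiU, strandPos_mem i⟩)
    rw [Real.ball_eq_Ioo] at hδU
    set x := strandPos n i
    set J : Set ℝ := Ioo (p.2 - ε) (p.2 + ε) ∩ Icc 0 1 with hJ
    have hJc : Convex ℝ J := (convex_Ioo _ _).inter (convex_Icc _ _)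
    have hmem : ∀ q : Plane, q.1 ∈ Ioo (x - δ) (x + δ) → q.2 ∈ J → (q ∈ G.carrier ↔ q.1 = x) :=
      fun q hq hqJ => (h2 q hqJ.1 hqJ.2).trans (hU' _ (hδU hq).1)
    have hNX : Ioo (x - δ) (x + δ) ×ˢ Ioo (p.2 - ε) (p.2 + ε) ∩ G.carrier = {x} ×ˢ J := by
      ext q
      constructor
      · rintro ⟨hq, hqX⟩
        have hqJ : q.2 ∈ J := ⟨hq.2, (G.carrier_subset hqX).2⟩
        exact ⟨(hmem q hq.1 hqJ).1 hqX, hqJ⟩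
      · rintro ⟨hq, hqJ⟩
        have hq' : q.1 = x := hq
        have hqδ : q.1 ∈ Ioo (x - δ) (x + δ) := by rw [hq']; constructor <;> linarith
        exact ⟨⟨hqδ, hqJ.1⟩, (hmem q hqδ hqJ).2 hq'⟩
    have hclos : ∀ I : Set ℝ, x ∈ closure I → {x} ×ˢ J ⊆ closure (I ×ˢ J) := by
      intro I hI
      rw [closure_prod_eq]
      exact prod_mono (singleton_subset_iff.2 hI) subset_closure
    refine ⟨Ioo (x - δ) (x + δ) ×ˢ Ioo (p.2 - ε) (p.2 + ε), isOpen_Ioo.prod isOpen_Ioo,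
      ⟨by rw [hi]; constructor <;> linarith, by constructor <;> linarith⟩, ?_, ?_,
      Ioo (x - δ) x ×ˢ J, Ioo x (x + δ) ×ˢ J, ((convex_Ioo _ _).prod hJc).isPreconnected,
      ((convex_Ioo _ _).prod hJc).isPreconnected, ?_, ?_⟩
    · rw [hNX]
      exact ((convex_singleton x).prod hJc).isPreconnected
    · rw [Set.disjoint_left]
      intro q hq hqV
      exact h1 q hqV hq.2
    · ext q
      constructor
      · rintro ⟨⟨hq, hqR⟩, hqX⟩
        have hqJ : q.2 ∈ J := ⟨hq.2, hqR.2⟩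
        rw [hmem q hq.1 hqJ] at hqX
        rcases lt_or_gt_of_ne hqX with h' | h'
        · exact Or.inl ⟨⟨hq.1.1, h'⟩, hqJ⟩
        · exact Or.inr ⟨⟨h', hq.1.2⟩, hqJ⟩
      · have key : q.1 ∈ Ioo (x - δ) (x + δ) → q.1 ≠ x → q.2 ∈ J →
            q ∈ (Ioo (x - δ) (x + δ) ×ˢ Ioo (p.2 - ε) (p.2 + ε) ∩ rect) \ G.carrier := by
          intro hq hqx hqJ
          exact ⟨⟨⟨hq, hqJ.1⟩, Ioo_subset_Icc_self (hδU hq).2, hqJ.2⟩,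
            fun h' => hqx ((hmem q hq hqJ).1 h')⟩
        rintro (⟨h3, h4⟩ | ⟨h3, h4⟩)
        · exact key ⟨h3.1, by linarith [h3.2]⟩ h3.2.ne h4
        · exact key ⟨by linarith [h3.1], h3.2⟩ h3.1.ne' h4
    · rw [hNX]
      refine subset_inter (hclos _ ?_) (hclos _ ?_)
      · rw [closure_Ioo (by linarith)]
        constructor <;> linarith
      · rw [closure_Ioo (by linarith)]
        constructor <;> linarith

lemma tame : Tame rect G.carrier G.verts where
  convex := convex_rect
  isClosed := G.isClosed_carrier
  subset := G.carrier_subset_rect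
  verts_subset := G.verts_subset
  finite_verts := G.finite_verts
  isPreconnected_diff := isPreconnected_rect_diff G.finite_verts G.verts_subset_openRect
  arc _ hp := G.exists_arc_rect hp
  finite_edges := Tame.finite_edges_of_isCompact G.isCompact_carrier G.finite_verts
    (fun _ hp => by
      obtain ⟨N, h1, h2, h3, h4, -⟩ := G.exists_arc_rect hp
      exact ⟨N, h1, h2, h3, h4⟩) G.valence_verts

end RectGraph

/-! ### The closing arcs -/

/-- The function whose level sets contain the closing arcs. -/
def arcLevel (p : Plane) : ℝ := max |p.1 - 1| (|p.2 - 1 / 2| - 1 / 2)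

lemma continuous_arcLevel : Continuous arcLevel := by
  unfold arcLevel
  fun_prop

/-- A positive level set is the boundary of a rectangle. The signs `σ` and `τ` reflect `p` into one
quadrant, where the level is the maximum of two coordinates and a corner can be straightened. -/
lemma hasValence_arcLevel {c : ℝ} (hc : 0 < c) {p : Plane} (hp : arcLevel p = c) :
    HasValence {q | arcLevel q = c} p 2 := by
  obtain ⟨σ, hσ, hσp⟩ : ∃ σ : ℝ, (σ = 1 ∨ σ = -1) ∧ 0 ≤ σ * (p.1 - 1) := by
    rcases le_total 0 (p.1 - 1) with h | h
    · exact ⟨1, Or.inl rfl, by linarith⟩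
    · exact ⟨-1, Or.inr rfl, by linarith⟩
  obtain ⟨τ, hτ, hτp⟩ : ∃ τ : ℝ, (τ = 1 ∨ τ = -1) ∧ 0 ≤ τ * (p.2 - 1 / 2) := by
    rcases le_total 0 (p.2 - 1 / 2) with h | h
    · exact ⟨1, Or.inl rfl, by linarith⟩
    · exact ⟨-1, Or.inr rfl, by linarith⟩
  have hσ2 : σ * σ = 1 := by rcases hσ with rfl | rfl <;> norm_num
  have hτ2 : τ * τ = 1 := by rcases hτ with rfl | rfl <;> norm_num
  -- the homeomorphism `(u, w) ↦ (max u w, u - w)` straightens the corners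
  let g : Plane ≃ₜ Plane :=
    { toFun := fun q => (max (σ * (q.1 - 1)) (τ * (q.2 - 1 / 2) - 1 / 2),
        σ * (q.1 - 1) - (τ * (q.2 - 1 / 2) - 1 / 2))
      invFun := fun r => (1 + σ * (r.1 + min r.2 0), 1 / 2 + τ * (r.1 - max r.2 0 + 1 / 2))
      left_inv := by
        intro q
        have h1 : ∀ u w : ℝ, max u w + min (u - w) 0 = u := fun u w => by
          rcases le_total u w with h | h
          · rw [max_eq_right h, min_eq_left (by linarith)]; ring
          · rw [max_eq_left h, min_eq_right (by linarith)]; ring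
        have h2 : ∀ u w : ℝ, max u w - max (u - w) 0 = w := fun u w => by
          rcases le_total u w with h | h
          · rw [max_eq_right h, max_eq_right (by linarith)]; ring
          · rw [max_eq_left h, max_eq_left (by linarith)]; ring
        ext
        · simp only [h1]
          linear_combination (q.1 - 1) * hσ2
        · simp only [h2]
          linear_combination (q.2 - 1 / 2) * hτ2
      right_inv := by
        intro r
        have e1 : σ * (1 + σ * (r.1 + min r.2 0) - 1) = r.1 + min r.2 0 := by
          linear_combination (r.1 + min r.2 0) * hσ2
        have e2 : τ * (1 / 2 + τ * (r.1 - max r.2 0 + 1 / 2) - 1 / 2) - 1 / 2 =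
            r.1 - max r.2 0 := by
          linear_combination (r.1 - max r.2 0 + 1 / 2) * hτ2
        simp only [e1, e2]
        rcases le_total r.2 0 with h | h
        · rw [min_eq_left h, max_eq_right h, max_eq_right (by linarith)]
          ext <;> simp
        · rw [min_eq_right h, max_eq_left h, max_eq_left (by linarith)]
          ext <;> simp
      continuous_toFun := by fun_prop
      continuous_invFun := by fun_prop }
  have hg : ∀ q, (g q).1 = max (σ * (q.1 - 1)) (τ * (q.2 - 1 / 2) - 1 / 2) := fun q => rfl
  have habs : ∀ s x : ℝ, (s = 1 ∨ s = -1) → |x| = max (s * x) (-(s * x)) := by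
    rintro s x (rfl | rfl)
    · rw [one_mul]; rfl
    · rw [neg_one_mul, neg_neg, max_comm]; rfl
  -- On `U` the two terms of opposite sign stay below `c` and do not affect the level set.
  let U : Set Plane := {q | -c < σ * (q.1 - 1) ∧ -(1 / 2) < τ * (q.2 - 1 / 2)}
  have hU : IsOpen U :=
    (isOpen_lt (f := fun _ => -c) (g := fun q : Plane => σ * (q.1 - 1)) (by fun_prop)
      (by fun_prop)).inter (isOpen_lt (f := fun _ => -(1 / 2))
      (g := fun q : Plane => τ * (q.2 - 1 / 2)) (by fun_prop) (by fun_prop))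
  have hlevel : ∀ q ∈ U, arcLevel q = c ↔ (g q).1 = c := by
    rintro q ⟨h1, h2⟩
    have e : arcLevel q = max (g q).1 (max (-(σ * (q.1 - 1))) (-(τ * (q.2 - 1 / 2)) - 1 / 2)) := by
      rw [arcLevel, habs σ _ hσ, habs τ _ hτ, hg, ← max_sub_sub_right, max_max_max_comm]
    have e' : max (-(σ * (q.1 - 1))) (-(τ * (q.2 - 1 / 2)) - 1 / 2) < c :=
      max_lt (by linarith) (by linarith)
    rw [e]
    constructor
    · intro h
      rcases max_choice (g q).1 (max (-(σ * (q.1 - 1))) (-(τ * (q.2 - 1 / 2)) - 1 / 2)) with h' | h'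
      · rw [← h', h]
      · rw [h'] at h
        exact absurd h e'.ne
    · intro h
      rw [h]
      exact max_eq_left e'.le
  have hpU : p ∈ U := ⟨by linarith, by linarith⟩
  have hgp : (g p).1 = c := (hlevel p hpU).1 hp
  have h1 : HasValence {q : Plane | q.1 = c} (g p) 2 :=
    RectGraph.hasValence_two_of_vertical isOpen_univ (mem_univ _) fun q _ => by
      rw [hgp]; rfl
  have h2 := RectGraph.hasValence_image h1 g.symm
  rw [g.symm_apply_apply] at h2
  refine RectGraph.hasValence_congr h2 hU hpU fun q hq => ?_
  rw [Homeomorph.image_eq_preimage_symm]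
  exact hlevel q hq

lemma mem_closingArc {n : ℕ} {i : Fin n} {p : Plane} : p ∈ closingArc n i ↔
    arcLevel p = 1 - strandPos n i ∧ ¬ (p.1 = strandPos n i ∧ p.2 ∈ Ioo (0 : ℝ) 1) := Iff.rfl

/-- Inside the rectangle the level sets are vertical segments: each closing arc is continued by the
vertical segment at its own marked position. -/
lemma arcLevel_of_mem_rect {p : Plane} (hp : p ∈ rect) : arcLevel p = 1 - p.1 := by
  have h1 : |p.1 - 1| = 1 - p.1 := by
    rw [abs_of_nonpos (by linarith [hp.1.2])]; ring
  have h2 : |p.2 - 1 / 2| ≤ 1 / 2 := abs_le.2 ⟨by linarith [hp.2.1], by linarith [hp.2.2]⟩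
  rw [arcLevel, h1]
  exact max_eq_left (by linarith [hp.1.2])

lemma closingArc_notMem_openRect {n : ℕ} {i : Fin n} {p : Plane} (hp : p ∈ closingArc n i) :
    p ∉ openRect := fun hpR => by
  obtain ⟨h1, h2⟩ := mem_closingArc.1 hp
  rw [arcLevel_of_mem_rect (openRect_subset_rect hpR)] at h1
  exact h2 ⟨by linarith, hpR.2⟩

lemma isCompact_closingArc {n : ℕ} (i : Fin n) : IsCompact (closingArc n i) := by
  have hs := RectGraph.strandPos_mem i
  -- The removed open segment is the part of the level set with `p.1 < 1` and `0 < p.2 < 1`; cutting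
  -- with closed half-planes instead shows that the arc is closed.
  have e : closingArc n i = {p | arcLevel p = 1 - strandPos n i} ∩
      ({p | 1 ≤ p.1} ∪ {p | p.2 ≤ 0} ∪ {p | 1 ≤ p.2}) := by
    ext p
    rw [mem_closingArc]
    refine and_congr_right fun hp => ?_
    simp only [mem_union, mem_ofPred_eq, mem_Ioo]
    constructor
    · intro h
      by_contra! h'
      have hl : arcLevel p = 1 - strandPos n i := hp
      have h1 : |p.2 - 1 / 2| - 1 / 2 < 0 := by
        have : |p.2 - 1 / 2| < 1 / 2 := abs_lt.2 ⟨by linarith [h'.1.2], by linarith [h'.2]⟩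
        linarith
      have h2 : |p.1 - 1| = 1 - p.1 := by
        rw [abs_of_nonpos (by linarith [h'.1.1])]; ring
      rw [arcLevel, max_eq_left (h1.le.trans (abs_nonneg _)), h2] at hl
      exact h ⟨by linarith, h'.1.2, h'.2⟩
    · rintro h ⟨h1, h2, h3⟩
      rcases h with (h | h) | h
      · linarith [hs.2]
      · linarith
      · linarith
  have hcl : IsClosed (closingArc n i) := by
    rw [e]
    refine (isClosed_eq continuous_arcLevel continuous_const).inter
      (((isClosed_le continuous_const continuous_fst).union
        (isClosed_le continuous_snd continuous_const)).union
        (isClosed_le continuous_const continuous_snd))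
  refine (isCompact_Icc.prod isCompact_Icc : IsCompact (Icc (0 : ℝ) 2 ×ˢ Icc (-1 : ℝ) 2)).of_isClosed_subset
    hcl fun p hp => ?_
  have hl := (mem_closingArc.1 hp).1
  have h1 : |p.1 - 1| ≤ 1 := by
    have := le_max_left |p.1 - 1| (|p.2 - 1 / 2| - 1 / 2)
    rw [← arcLevel, hl] at this
    linarith [hs.1]
  have h2 : |p.2 - 1 / 2| ≤ 3 / 2 := by
    have := le_max_right |p.1 - 1| (|p.2 - 1 / 2| - 1 / 2)
    rw [← arcLevel, hl] at this
    linarith [hs.1]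
  rw [abs_le] at h1 h2
  exact ⟨⟨by linarith, by linarith⟩, by linarith, by linarith⟩

/-! ### Tameness of the closure of a graph. -/

namespace RectGraph

variable {n : ℕ} (G : RectGraph n)

lemma mem_closureCarrier {p : Plane} :
    p ∈ G.closureCarrier ↔ p ∈ G.carrier ∨ ∃ i, p ∈ closingArc n i := by
  simp [closureCarrier]

lemma mem_closureCarrier_of_mem_openRect {p : Plane} (hp : p ∈ openRect) :
    p ∈ G.closureCarrier ↔ p ∈ G.carrier := by
  rw [mem_closureCarrier, or_iff_left]
  rintro ⟨i, hi⟩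
  exact closingArc_notMem_openRect hi hp

lemma isCompact_closureCarrier : IsCompact G.closureCarrier :=
  G.isCompact_carrier.union (isCompact_iUnion fun i => isCompact_closingArc i)

lemma exists_mem_closingArc {p : Plane} (hp : p ∈ G.closureCarrier) (hpR : p ∉ openRect) :
    ∃ i, p ∈ closingArc n i := by
  rcases G.mem_closureCarrier.1 hp with hp | hp
  · obtain ⟨hp2, i, hi⟩ := G.boundary_of_mem hp hpR
    refine ⟨i, mem_closingArc.2 ⟨?_, ?_⟩⟩
    · rw [arcLevel_of_mem_rect (G.carrier_subset_rect hp), hi]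
    · rintro ⟨-, h1, h2⟩
      rcases hp2 with h' | h' <;> linarith
  · exact hp

/-- The arcs occupy finitely many levels, so a neighbourhood of one level set meets no arc of
another level. -/
lemma exists_open_arcLevel (i : Fin n) : ∃ U : Set Plane, IsOpen U ∧
    {p | arcLevel p = 1 - strandPos n i} ⊆ U ∧
    ∀ p ∈ U, ∀ j, arcLevel p = 1 - strandPos n j → strandPos n j = strandPos n i := by
  obtain ⟨U, hU, hiU, hU'⟩ := exists_open_strandPos i
  refine ⟨{p | 1 - arcLevel p ∈ U}, hU.preimage (continuous_const.sub continuous_arcLevel), ?_, ?_⟩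
  · intro p hp
    have hp' : arcLevel p = 1 - strandPos n i := hp
    change 1 - arcLevel p ∈ U
    rwa [hp', sub_sub_cancel]
  · intro p hp j hj
    have hp' : 1 - arcLevel p ∈ U := hp
    rw [hj, sub_sub_cancel] at hp'
    exact (hU' _ hp').1 ⟨j, rfl⟩

/-- Inside the open rectangle the closure is `G`; outside the rectangle it is locally a level set of
`arcLevel`; at a marked point strand and arc form one vertical line. -/
lemma hasValence_closureCarrier {p : Plane} (hp : p ∈ G.closureCarrier) (hpV : p ∉ G.verts) :
    HasValence G.closureCarrier p 2 := by
  by_cases hpR : p ∈ openRect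
  · rw [G.mem_closureCarrier_of_mem_openRect hpR] at hp
    exact hasValence_congr (G.valence_two p ⟨hp, hpV⟩ hpR) isOpen_openRect hpR
      fun q hq => G.mem_closureCarrier_of_mem_openRect hq
  obtain ⟨i, hi⟩ := G.exists_mem_closingArc hp hpR
  obtain ⟨hl, hni⟩ := mem_closingArc.1 hi
  have hs := strandPos_mem i
  obtain ⟨U, hU, hlU, hU'⟩ := exists_open_arcLevel i
  by_cases hpr : p ∈ rect
  · have hp1 : p.1 = strandPos n i := by
      rw [arcLevel_of_mem_rect hpr] at hl
      linarith
    have hp2 : p.2 = 0 ∨ p.2 = 1 := by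
      by_contra! h'
      exact hni ⟨hp1, hpr.2.1.lt_of_ne' h'.1, hpr.2.2.lt_of_ne h'.2⟩
    obtain ⟨ε, h0, -, h2⟩ := G.exists_collar_nhds hp2
    set c := 1 - strandPos n i with hc
    have hc0 : 0 < c := by linarith [hs.2]
    -- Within height `c` of the marked point the vertical term of `arcLevel` is less than `c`, so
    -- the arc there is given by the horizontal term alone and is vertical.
    refine hasValence_two_of_vertical
      (U := U ∩ Iio 1 ×ˢ (Ioo (p.2 - ε) (p.2 + ε) ∩ Ioo (p.2 - c) (p.2 + c)))
      (hU.inter (isOpen_Iio.prod (isOpen_Ioo.inter isOpen_Ioo)))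
      ⟨hlU hl, by rw [hp1]; exact hs.2, ⟨by linarith, by linarith⟩, by linarith, by linarith⟩ ?_
    rintro q ⟨hqU, hq1, hqε, hqc⟩
    have hq1' : q.1 < 1 := hq1
    have habs1 : |q.1 - 1| = 1 - q.1 := by rw [abs_of_neg (by linarith)]; ring
    have habs2 : |q.2 - 1 / 2| - 1 / 2 < c := by
      have : |q.2 - 1 / 2| < c + 1 / 2 := by
        rw [abs_lt]
        rcases hp2 with h' | h' <;> rw [h'] at hqc <;> constructor <;> linarith [hqc.1, hqc.2]
      linarith
    rw [mem_closureCarrier]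
    constructor
    · rintro (hqX | ⟨j, hj⟩)
      · have hqr := G.carrier_subset_rect hqX
        obtain ⟨j, hj⟩ := (h2 q hqε hqr.2).1 hqX
        have := hU' q hqU j (by rw [arcLevel_of_mem_rect hqr, hj])
        rw [hj, this, hp1]
      · have hlj := (mem_closingArc.1 hj).1
        have := hU' q hqU j hlj
        rw [this, ← hc, arcLevel, habs1] at hlj
        rcases max_choice (1 - q.1) (|q.2 - 1 / 2| - 1 / 2) with h' | h'
        · rw [h'] at hlj
          rw [hp1]
          linarith
        · rw [h'] at hlj
          linarith
    · intro hq
      rw [hp1] at hq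
      by_cases hq2 : q.2 ∈ Ioo (0 : ℝ) 1
      · exact Or.inl ((h2 q hqε (Ioo_subset_Icc_self hq2)).2 ⟨i, hq⟩)
      · refine Or.inr ⟨i, mem_closingArc.2 ⟨?_, fun h' => hq2 h'.2⟩⟩
        rw [arcLevel, habs1, hq]
        exact max_eq_left habs2.le
  · refine hasValence_congr (hasValence_arcLevel (by linarith [hs.2]) hl)
      (U := U ∩ rectᶜ) (hU.inter isCompact_rect.isClosed.isOpen_compl) ⟨hlU hl, hpr⟩ ?_
    rintro q ⟨hqU, hqr⟩
    rw [mem_closureCarrier]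
    constructor
    · rintro (hqX | ⟨j, hj⟩)
      · exact absurd (G.carrier_subset_rect hqX) hqr
      · have hlj := (mem_closingArc.1 hj).1
        change arcLevel q = _
        rw [← hU' q hqU j hlj]
        exact hlj
    · intro hq
      refine Or.inr ⟨i, mem_closingArc.2 ⟨hq, ?_⟩⟩
      rintro ⟨h1, h2⟩
      exact hqr ⟨by rw [h1]; exact Ioo_subset_Icc_self hs, Ioo_subset_Icc_self h2⟩

lemma verts_subset_closureCarrier : G.verts ⊆ G.closureCarrier :=
  G.verts_subset.trans subset_union_left

lemma tame_closure : Tame univ G.closureCarrier G.verts where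
  convex := convex_univ
  isClosed := G.isCompact_closureCarrier.isClosed
  subset := subset_univ _
  verts_subset := G.verts_subset_closureCarrier
  finite_verts := G.finite_verts
  isPreconnected_diff := by
    rw [← compl_eq_univ_sdiff]
    exact isPreconnected_compl_of_finite G.finite_verts
  arc _ hp := (G.hasValence_closureCarrier hp.1 hp.2).twoSidedAt.exists_arc Filter.univ_mem
    G.finite_verts hp.2
  finite_edges := Tame.finite_edges_of_isCompact G.isCompact_closureCarrier G.finite_verts
    (fun p hp => by
      obtain ⟨N, h1, h2, h3, h4, -⟩ := (G.hasValence_closureCarrier hp.1 hp.2).twoSidedAt.exists_arc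
        Filter.univ_mem G.finite_verts hp.2
      exact ⟨N, h1, h2, h3, h4⟩) (fun v hv => by
      obtain ⟨d, hd⟩ := G.valence_verts v hv
      exact ⟨d, hasValence_congr hd isOpen_openRect (G.verts_subset_openRect hv)
        fun q hq => G.mem_closureCarrier_of_mem_openRect hq⟩)

end RectGraph

end ChromaticAlgebra

namespace ChromaticAlgebra

/-- Edges in an open set only depend on the graph in this set. -/
lemma Tame.image_mem_edgesOf {Y X V X' V' W e : Set Plane} (h : Tame Y X V) (g : Plane ≃ₜ Plane)
    (he : e ∈ edgesOf X V) (hW : IsOpen W) (heW : e ⊆ W) (hX : ∀ q ∈ W, g q ∈ X' ↔ q ∈ X)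
    (hV : ∀ q ∈ W, g q ∈ V' ↔ q ∈ V) (hVV' : g '' V ⊆ V') : g '' e ∈ edgesOf X' V' := by
  obtain ⟨O, hO, hOe⟩ := h.exists_isOpen_edge he
  refine mem_componentsIn_of_relClopen (O := g '' (O ∩ W))
    ((componentsIn.isPreconnected he).image g g.continuous.continuousOn)
    ((componentsIn.nonempty he).image g) ?_ (g.isOpenMap _ (hO.inter hW)) ?_ ?_ ?_
  · rintro _ ⟨q, hq, rfl⟩
    have := componentsIn.subset he hq
    exact ⟨(hX q (heW hq)).2 this.1, fun h' => this.2 ((hV q (heW hq)).1 h')⟩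
  · rintro _ ⟨⟨q, ⟨hqO, hqW⟩, rfl⟩, hqX, hqV⟩
    exact ⟨q, hOe.subset ⟨hqO, (hX q hqW).1 hqX, fun h' => hqV ((hV q hqW).2 h')⟩, rfl⟩
  · exact image_mono fun q hq => ⟨(hOe.symm.subset hq).1, heW hq⟩
  · rw [← g.image_closure]
    rintro _ ⟨⟨q, hq, rfl⟩, -, hqV⟩
    exact ⟨q, h.mem_edge_of_mem_closure he hq fun h' => hqV (hVV' ⟨q, h', rfl⟩), rfl⟩

/-! ### Maps of the plane which are fixed outside the rectangle -/

section Fix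

variable {f : Plane → Plane} (hfix : ∀ p ∉ openRect, f p = p)
include hfix

/-- The map is the identity outside a compact set. -/
lemma isClosedMap_of_fix (hf : Continuous f) : IsClosedMap f := by
  intro S hS
  have : f '' S = f '' (S ∩ rect) ∪ (S ∩ openRectᶜ) := by
    ext q
    constructor
    · rintro ⟨p, hp, rfl⟩
      by_cases hpr : p ∈ openRect
      · exact Or.inl ⟨p, ⟨hp, openRect_subset_rect hpr⟩, rfl⟩
      · rw [hfix p hpr]
        exact Or.inr ⟨hp, hpr⟩
    · rintro (⟨p, hp, rfl⟩ | ⟨hq, hq'⟩)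
      · exact ⟨p, hp.1, rfl⟩
      · exact ⟨q, hq, hfix q hq'⟩
  rw [this]
  exact ((isCompact_rect.inter_left hS).image hf).isClosed.union
    (hS.inter isOpen_openRect.isClosed_compl)

lemma image_eq_of_fix {S : Set Plane} (hS : Disjoint S openRect) : f '' S = S := by
  rw [show f '' S = id '' S from image_congr fun p hp => hfix p (Set.disjoint_left.1 hS hp),
    image_id]

/-- If `f p` lay outside the rectangle it would be fixed, so `f p` and `p` would share a fibre; then
either `f p = p`, or `f p` lies in `K`, both impossible for `p` in the rectangle. -/
lemma mem_rect_iff_of_fix {K : Set Plane} (hK : K ⊆ rect)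
    (hfib : ∀ p q, f p = f q ↔ p = q ∨ (p ∈ K ∧ q ∈ K)) (p : Plane) : f p ∈ rect ↔ p ∈ rect := by
  constructor
  · intro h
    by_contra hp
    rw [hfix p fun h' => hp (openRect_subset_rect h')] at h
    exact hp h
  · intro h
    by_contra hp
    have h1 : f (f p) = f p := hfix (f p) fun h' => hp (openRect_subset_rect h')
    rcases (hfib _ _).1 h1 with h2 | h2
    · exact hp (h2.symm ▸ h)
    · exact hp (hK h2.1)

end Fix

/-! ### The defining relations and isotopy, seen on the duals of a graph and of its closure. -/

namespace RectGraph

variable {n : ℕ} {G G₁ G₂ H : RectGraph n} {e : Set Plane}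

lemma disjoint_closingArcs : Disjoint (⋃ i, closingArc n i) openRect :=
  Set.disjoint_left.2 fun p hp => by
    obtain ⟨i, hi⟩ := mem_iUnion.1 hp
    exact closingArc_notMem_openRect hi

lemma image_closureCarrier {f : Plane → Plane} (hfix : ∀ p ∉ openRect, f p = p) :
    f '' G.closureCarrier = f '' G.carrier ∪ ⋃ i, closingArc n i := by
  rw [closureCarrier, image_union, image_eq_of_fix hfix disjoint_closingArcs]

section Inner

variable (he : G.IsInnerEdge e)
include he

/-- The edge stays in the open rectangle, where graph and closure coincide, so the closing arcs
cannot extend it. -/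
lemma IsInnerEdge.mem_edgesOf_closure : e ∈ edgesOf G.closureCarrier G.verts := by
  have := G.tame.image_mem_edgesOf (X' := G.closureCarrier) (V' := G.verts) (Homeomorph.refl _) he.1
    isOpen_openRect he.2 (fun q hq => G.mem_closureCarrier_of_mem_openRect hq) (fun _ _ => Iff.rfl)
    (by simp)
  simpa using this

lemma IsInnerEdge.isBounded : Bornology.IsBounded e :=
  isCompact_rect.isBounded.subset (he.2.trans openRect_subset_rect)

lemma IsInnerEdge.rect_mem_nhds : ∀ p ∈ e, rect ∈ nhds p := fun _ hp =>
  Filter.mem_of_superset (isOpen_openRect.mem_nhds (he.2 hp)) openRect_subset_rect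

lemma IsInnerEdge.twoSidedAt : ∀ p ∈ e, TwoSidedAt G.carrier p := fun p hp =>
  (G.valence_two p (componentsIn.subset he.1 hp) (he.2 hp)).twoSidedAt

lemma IsInnerEdge.twoSidedAt_closure : ∀ p ∈ e, TwoSidedAt G.closureCarrier p := fun p hp => by
  have := componentsIn.subset he.mem_edgesOf_closure hp
  exact (G.hasValence_closureCarrier this.1 this.2).twoSidedAt

end Inner

lemma IsDeletion.closureCarrier_eq (h : G.IsDeletion e G₂) (he : G.IsInnerEdge e) :
    G₂.closureCarrier = G.closureCarrier \ e := by
  rw [closureCarrier, closureCarrier, h.1, union_sdiff_distrib,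
    (Disjoint.mono_right he.2 disjoint_closingArcs).sdiff_eq_left]

lemma nonempty_of_not_isLoop (hl : ¬ G.IsLoop e) : (closure e ∩ G.verts).Nonempty :=
  (not_subsingleton_iff.1 hl).nonempty

lemma IsDeletion.dual_eq (h : G.IsDeletion e G₂) :
    G₂.dual = dualOf rect (G.carrier \ e) G.verts := by
  rw [dual, h.1, h.2]

lemma IsDeletion.closureDual_eq (h : G.IsDeletion e G₂) (he : G.IsInnerEdge e) :
    G₂.closureDual = dualOf univ (G.closureCarrier \ e) G.verts := by
  rw [closureDual, h.closureCarrier_eq he, h.2]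

lemma IsContraction.isIsoTo (h : G.IsContraction e G₁) (he : G.IsInnerEdge e)
    (hl : ¬ G.IsLoop e) : G₁.dual.IsIsoTo (G.dual.deleteEdges {e}) := by
  obtain ⟨f, hf, hsurj, hfix, hfib, hX, hV⟩ := h
  rw [dual, hX, hV]
  exact G.tame.isIsoTo_deleteEdges he.1 (nonempty_of_not_isLoop hl) hf (isClosedMap_of_fix hfix hf)
    hsurj (mem_rect_iff_of_fix hfix
      ((G.tame.closure_edge_subset he.1).trans G.carrier_subset_rect) hfib) hfib

lemma chromaticPolynomial_dual_contraction_deletion (he : G.IsInnerEdge e) (hl : ¬ G.IsLoop e)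
    (h₁ : G.IsContraction e G₁) (h₂ : G.IsDeletion e G₂) : G.dual.chromaticPolynomial =
      G₁.dual.chromaticPolynomial - G₂.dual.chromaticPolynomial := by
  obtain ⟨f, hf, hsurj, hfix, hfib, hX, hV⟩ := h₁
  rw [h₂.dual_eq, dual, dual, hX, hV]
  exact G.tame.chromaticPolynomial_eq_sub he.1 (nonempty_of_not_isLoop hl) hf
    (isClosedMap_of_fix hfix hf) hsurj (mem_rect_iff_of_fix hfix
      ((G.tame.closure_edge_subset he.1).trans G.carrier_subset_rect) hfib) hfib

lemma chromaticPolynomial_closureDual_contraction_deletion (he : G.IsInnerEdge e)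
    (hl : ¬ G.IsLoop e) (h₁ : G.IsContraction e G₁) (h₂ : G.IsDeletion e G₂) :
    G.closureDual.chromaticPolynomial =
      G₁.closureDual.chromaticPolynomial - G₂.closureDual.chromaticPolynomial := by
  obtain ⟨f, hf, hsurj, hfix, hfib, hX, hV⟩ := h₁
  have hX' : G₁.closureCarrier = f '' G.closureCarrier := by
    rw [image_closureCarrier hfix, ← hX, closureCarrier]
  rw [h₂.closureDual_eq he, closureDual, closureDual, hX', hV]
  exact G.tame_closure.chromaticPolynomial_eq_sub he.mem_edgesOf_closure
    (nonempty_of_not_isLoop hl) hf (isClosedMap_of_fix hfix hf) hsurj (by simp) hfib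

lemma chromaticPolynomial_dual_loop (he : G.IsInnerEdge e) (hl : G.IsLoop e)
    (h₂ : G.IsDeletion e G₂) :
    G.dual.chromaticPolynomial = (X - 1) * G₂.dual.chromaticPolynomial := by
  rw [h₂.dual_eq]
  exact G.tame.chromaticPolynomial_of_isLoop he.1 he.rect_mem_nhds he.isBounded hl he.twoSidedAt

lemma chromaticPolynomial_closureDual_loop (he : G.IsInnerEdge e) (hl : G.IsLoop e)
    (h₂ : G.IsDeletion e G₂) :
    G.closureDual.chromaticPolynomial = (X - 1) * G₂.closureDual.chromaticPolynomial := by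
  rw [h₂.closureDual_eq he]
  exact G.tame_closure.chromaticPolynomial_of_isLoop he.mem_edgesOf_closure
    (fun _ _ => Filter.univ_mem) he.isBounded hl he.twoSidedAt_closure

lemma exists_isLoopAt_dual {v : Plane} (hv : v ∈ G.verts) (h : HasValence G.carrier v 1) :
    ∃ e A, v ∈ closure e ∧ G.dual.IsLoopAt e A :=
  G.tame.exists_isLoopAt (Filter.mem_of_superset
    (isOpen_openRect.mem_nhds (G.verts_subset_openRect hv)) openRect_subset_rect) h

lemma chromaticPolynomial_dual_one_valent {v : Plane} (hv : v ∈ G.verts)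
    (h : HasValence G.carrier v 1) : G.dual.chromaticPolynomial = 0 := by
  obtain ⟨e, A, -, hl⟩ := exists_isLoopAt_dual hv h
  exact Graph.chromaticPolynomial_eq_zero_of_isLink_self G.tame.edgeSet_finite hl

lemma chromaticPolynomial_closureDual_one_valent {v : Plane} (hv : v ∈ G.verts)
    (h : HasValence G.carrier v 1) : G.closureDual.chromaticPolynomial = 0 := by
  have h' : HasValence G.closureCarrier v 1 := hasValence_congr h isOpen_openRect
    (G.verts_subset_openRect hv) fun q hq => G.mem_closureCarrier_of_mem_openRect hq
  obtain ⟨e, A, -, hl⟩ := G.tame_closure.exists_isLoopAt Filter.univ_mem h'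
  exact Graph.chromaticPolynomial_eq_zero_of_isLink_self G.tame_closure.edgeSet_finite hl

lemma IsIsotopic.chromaticPolynomial_dual (h : G.IsIsotopic H) :
    G.dual.chromaticPolynomial = H.dual.chromaticPolynomial := by
  obtain ⟨F, -, -, hfix, hX, hV⟩ := h
  rw [dual, dual, ← hX, ← hV]
  refine (G.tame.chromaticPolynomial_image (F 1) ?_).symm
  exact mem_rect_iff_of_fix (hfix 1) (empty_subset _) (by simp)

lemma IsIsotopic.chromaticPolynomial_closureDual (h : G.IsIsotopic H) :
    G.closureDual.chromaticPolynomial = H.closureDual.chromaticPolynomial := by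
  obtain ⟨F, -, -, hfix, hX, hV⟩ := h
  have hX' : H.closureCarrier = F 1 '' G.closureCarrier := by
    rw [image_closureCarrier (hfix 1), hX, closureCarrier]
  rw [closureDual, closureDual, hX', ← hV]
  exact (G.tame_closure.chromaticPolynomial_image (F 1) (by simp)).symm

/-- A compact set does not fill the plane, so there is at least one region. -/
lemma X_dvd_closureDual (G : RectGraph n) : X ∣ G.closureDual.chromaticPolynomial := by
  refine Graph.X_dvd_chromaticPolynomial G.tame_closure.finite_regions ?_
  have : ∃ p, p ∉ G.closureCarrier := by
    by_contra! h
    exact NoncompactSpace.noncompact_univ (X := Plane)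
      ((eq_univ_of_forall h) ▸ G.isCompact_closureCarrier)
  obtain ⟨p, hp⟩ := this
  exact ⟨_, p, ⟨mem_univ _, hp⟩, rfl⟩

/-! ### Graphs inserted in larger graphs -/

/-- `G'` is obtained from the image of `G` under `h` by adding the set `R` and the vertices `W`
outside the image of the rectangle. -/
structure IsInsertion (h : Plane ≃ₜ Plane) (R W : Set Plane) (G G' : RectGraph n) : Prop where
  mem_openRect : ∀ q ∈ openRect, h q ∈ openRect
  carrier_eq : G'.carrier = h '' G.carrier ∪ R
  verts_eq : G'.verts = h '' G.verts ∪ W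
  -- The added set may touch the boundary of the image, where strands are joined; added vertices may
  -- not, which keeps the end vertices of an inner edge unchanged.
  disjoint : Disjoint R (h '' openRect)
  disjoint_verts : Disjoint W (h '' rect)

namespace IsInsertion

variable {h : Plane ≃ₜ Plane} {R W : Set Plane} {G' G₁' G₂' : RectGraph n}

lemma mem_carrier_iff (hG : IsInsertion h R W G G') {q : Plane} (hq : q ∈ openRect) :
    h q ∈ G'.carrier ↔ q ∈ G.carrier := by
  rw [hG.carrier_eq, mem_union, h.injective.mem_set_image, or_iff_left]
  exact fun h' => Set.disjoint_left.1 hG.disjoint h' ⟨q, hq, rfl⟩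

lemma mem_verts_iff (hG : IsInsertion h R W G G') {q : Plane} (hq : q ∈ rect) :
    h q ∈ G'.verts ↔ q ∈ G.verts := by
  rw [hG.verts_eq, mem_union, h.injective.mem_set_image, or_iff_left]
  exact fun h' => Set.disjoint_left.1 hG.disjoint_verts h' ⟨q, hq, rfl⟩

lemma isInnerEdge (hG : IsInsertion h R W G G') (he : G.IsInnerEdge e) :
    G'.IsInnerEdge (h '' e) := by
  refine ⟨G.tame.image_mem_edgesOf h he.1 isOpen_openRect he.2 (fun q hq => hG.mem_carrier_iff hq)
    (fun q hq => hG.mem_verts_iff (openRect_subset_rect hq)) ?_, ?_⟩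
  · rw [hG.verts_eq]
    exact subset_union_left
  · rintro _ ⟨q, hq, rfl⟩
    exact hG.mem_openRect q (he.2 hq)

lemma isLoop_iff (hG : IsInsertion h R W G G') (he : G.IsInnerEdge e) :
    G'.IsLoop (h '' e) ↔ G.IsLoop e := by
  have : closure (h '' e) ∩ G'.verts = h '' (closure e ∩ G.verts) := by
    rw [← h.image_closure]
    have hsub := (G.tame.closure_edge_subset he.1).trans G.carrier_subset_rect
    ext q
    constructor
    · rintro ⟨⟨p, hp, rfl⟩, hpV⟩
      exact ⟨p, ⟨hp, (hG.mem_verts_iff (hsub hp)).1 hpV⟩, rfl⟩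
    · rintro ⟨p, ⟨hp, hpV⟩, rfl⟩
      exact ⟨⟨p, hp, rfl⟩, (hG.mem_verts_iff (hsub hp)).2 hpV⟩
  rw [IsLoop, this, IsLoop]
  exact ⟨fun h' => subsingleton_of_image h.injective _ h', fun h' => h'.image h⟩

lemma isDeletion (hG : IsInsertion h R W G G') (hG₂ : IsInsertion h R W G₂ G₂')
    (he : G.IsInnerEdge e) (hd : G.IsDeletion e G₂) : G'.IsDeletion (h '' e) G₂' := by
  refine ⟨?_, by rw [hG₂.verts_eq, hd.2, hG.verts_eq]⟩
  rw [hG₂.carrier_eq, hd.1, hG.carrier_eq, union_sdiff_distrib, image_sdiff h.injective,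
    (hG.disjoint.mono_right (image_mono he.2)).sdiff_eq_left]

lemma isContraction (hG : IsInsertion h R W G G') (hG₁ : IsInsertion h R W G₁ G₁')
    (hd : G.IsContraction e G₁) : G'.IsContraction (h '' e) G₁' := by
  obtain ⟨f, hf, hsurj, hfix, hfib, hX, hV⟩ := hd
  -- The collapsing map is conjugated by `h`; the conjugate fixes everything that was added outside
  -- the image of the open rectangle.
  have hfix' : ∀ p ∉ h '' openRect, h (f (h.symm p)) = p := fun p hp => by
    rw [hfix, h.apply_symm_apply]
    exact fun h' => hp ⟨_, h', h.apply_symm_apply p⟩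
  have himg : ∀ S : Set Plane, (fun p => h (f (h.symm p))) '' (h '' S) = h '' (f '' S) := fun S => by
    rw [image_image, image_image]
    simp
  have hR : ∀ S : Set Plane, Disjoint S (h '' openRect) → (fun p => h (f (h.symm p))) '' S = S := by
    intro S hS
    rw [show (fun p => h (f (h.symm p))) '' S = id '' S from
      image_congr fun p hp => hfix' p (Set.disjoint_left.1 hS hp), image_id]
  refine ⟨fun p => h (f (h.symm p)), by fun_prop, ?_, ?_, ?_, ?_, ?_⟩
  · exact h.surjective.comp (hsurj.comp h.symm.surjective)
  · intro p hp
    refine hfix' p ?_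
    rintro ⟨q, hq, rfl⟩
    exact hp (hG.mem_openRect q hq)
  · intro p q
    have hmem : ∀ p, p ∈ closure (h '' e) ↔ h.symm p ∈ closure e := fun p => by
      rw [← h.image_closure, Homeomorph.image_eq_preimage_symm]; rfl
    rw [h.injective.eq_iff, hfib, h.symm.injective.eq_iff, hmem, hmem]
  · rw [hG₁.carrier_eq, hG.carrier_eq, image_union, himg, hR R hG.disjoint, hX]
  · rw [hG₁.verts_eq, hG.verts_eq, image_union, himg,
      hR W (hG.disjoint_verts.mono_right (image_mono openRect_subset_rect)), hV]

lemma exists_one_valent (hG : IsInsertion h R W G G') {v : Plane} (hv : v ∈ G.verts)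
    (hval : HasValence G.carrier v 1) : h v ∈ G'.verts ∧ HasValence G'.carrier (h v) 1 := by
  have hvR := G.verts_subset_openRect hv
  refine ⟨(hG.mem_verts_iff (openRect_subset_rect hvR)).2 hv, ?_⟩
  refine hasValence_congr (hasValence_image hval h) (h.isOpenMap _ isOpen_openRect)
    ⟨v, hvR, rfl⟩ ?_
  rintro _ ⟨q, hq, rfl⟩
  rw [hG.mem_carrier_iff hq, h.injective.mem_set_image]

end IsInsertion

lemma isInsertion_stack_left (G H : RectGraph n) :
    IsInsertion toUpper (toLower '' H.carrier) (toLower '' H.verts) G (stack G H) where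
  mem_openRect q hq := by
    refine ⟨hq.1, ?_⟩
    change (q.2 + 1) / 2 ∈ Ioo (0 : ℝ) 1
    constructor <;> linarith [hq.2.1, hq.2.2]
  carrier_eq := rfl
  verts_eq := rfl
  disjoint := by
    rw [Set.disjoint_left]
    intro p hp hp'
    have h1 := (mem_toUpper_image.1 hp').2.1
    have h2 := (lower_of_mem H hp).2
    simp only at h1
    linarith
  disjoint_verts := by
    rw [Set.disjoint_left]
    intro p hp hp'
    have h1 := (mem_toUpper_image.1 hp').2.1
    have h2 := (H.verts_subset_openRect (mem_toLower_image.1 hp)).2.2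
    simp only at h1 h2
    linarith

lemma isInsertion_stack_right (G H : RectGraph n) :
    IsInsertion toLower (toUpper '' G.carrier) (toUpper '' G.verts) H (stack G H) where
  mem_openRect q hq := by
    refine ⟨hq.1, ?_⟩
    change q.2 / 2 ∈ Ioo (0 : ℝ) 1
    constructor <;> linarith [hq.2.1, hq.2.2]
  carrier_eq := union_comm _ _
  verts_eq := union_comm _ _
  disjoint := by
    rw [Set.disjoint_left]
    intro p hp hp'
    have h1 := (mem_toLower_image.1 hp').2.2
    have h2 := (upper_of_mem G hp).1
    simp only at h1
    linarith
  disjoint_verts := by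
    rw [Set.disjoint_left]
    intro p hp hp'
    have h1 := (mem_toLower_image.1 hp').2.2
    have h2 := (G.verts_subset_openRect (mem_toUpper_image.1 hp)).2.1
    simp only at h1 h2
    linarith

end RectGraph

/-! ### Linear maps on the chromatic algebra -/

section Lift

variable {k : Type*} [CommRing k] {n : ℕ}

lemma freeGen_mul (G H : RectGraph n) :
    freeGen k G * freeGen k H = freeGen k (RectGraph.stack G H) :=
  (map_mul (MonoidAlgebra.of k (GraphClass n)) _ _).symm

lemma freeGraphAlgebra_induction {p : FreeGraphAlgebra k n → Prop} (hgen : ∀ G, p (freeGen k G))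
    (hadd : ∀ x y, p x → p y → p (x + y)) (hsmul : ∀ (r : k) x, p x → p (r • x))
    (x : FreeGraphAlgebra k n) : p x := by
  refine MonoidAlgebra.induction_on x ?_ hadd hsmul
  rintro ⟨G⟩
  exact hgen G

variable {Q : k}

/-- The defining relations are stable under stacking on the left. -/
lemma Rel.mul_left (H : RectGraph n) {x y : FreeGraphAlgebra k n} (h : Rel Q x y) :
    Rel Q (freeGen k H * x) (freeGen k H * y) := by
  cases h with
  | contraction_deletion G G₁ G₂ e he hl h₁ h₂ =>
    rw [mul_sub, freeGen_mul, freeGen_mul, freeGen_mul]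
    have hG := RectGraph.isInsertion_stack_right H G
    exact .contraction_deletion _ _ _ _ (hG.isInnerEdge he) (fun h' => hl ((hG.isLoop_iff he).1 h'))
      (hG.isContraction (RectGraph.isInsertion_stack_right H G₁) h₁)
      (hG.isDeletion (RectGraph.isInsertion_stack_right H G₂) he h₂)
  | loop G G₂ e he hl h₂ =>
    rw [mul_smul_comm, freeGen_mul, freeGen_mul]
    have hG := RectGraph.isInsertion_stack_right H G
    exact .loop _ _ _ (hG.isInnerEdge he) ((hG.isLoop_iff he).2 hl)
      (hG.isDeletion (RectGraph.isInsertion_stack_right H G₂) he h₂)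
  | one_valent G v hv hval =>
    rw [mul_zero, freeGen_mul]
    obtain ⟨h1, h2⟩ := (RectGraph.isInsertion_stack_right H G).exists_one_valent hv hval
    exact .one_valent _ _ h1 h2

/-- The defining relations are stable under stacking on the right. -/
lemma Rel.mul_right (H : RectGraph n) {x y : FreeGraphAlgebra k n} (h : Rel Q x y) :
    Rel Q (x * freeGen k H) (y * freeGen k H) := by
  cases h with
  | contraction_deletion G G₁ G₂ e he hl h₁ h₂ =>
    rw [sub_mul, freeGen_mul, freeGen_mul, freeGen_mul]
    have hG := RectGraph.isInsertion_stack_left G H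
    exact .contraction_deletion _ _ _ _ (hG.isInnerEdge he) (fun h' => hl ((hG.isLoop_iff he).1 h'))
      (hG.isContraction (RectGraph.isInsertion_stack_left G₁ H) h₁)
      (hG.isDeletion (RectGraph.isInsertion_stack_left G₂ H) he h₂)
  | loop G G₂ e he hl h₂ =>
    rw [smul_mul_assoc, freeGen_mul, freeGen_mul]
    have hG := RectGraph.isInsertion_stack_left G H
    exact .loop _ _ _ (hG.isInnerEdge he) ((hG.isLoop_iff he).2 hl)
      (hG.isDeletion (RectGraph.isInsertion_stack_left G₂ H) he h₂)
  | one_valent G v hv hval =>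
    rw [zero_mul, freeGen_mul]
    obtain ⟨h1, h2⟩ := (RectGraph.isInsertion_stack_left G H).exists_one_valent hv hval
    exact .one_valent _ _ h1 h2

/-- The linear map on the free algebra with given values on the generators. -/
def freeLift (t : GraphClass n → k) : FreeGraphAlgebra k n →ₗ[k] k :=
  Finsupp.linearCombination k t ∘ₗ (MonoidAlgebra.coeffLinearEquiv k).toLinearMap

lemma freeLift_of (t : GraphClass n → k) (c : GraphClass n) :
    freeLift t (MonoidAlgebra.of k (GraphClass n) c) = t c := by
  simp [freeLift]

lemma freeLift_freeGen (t : GraphClass n → k) (G : RectGraph n) :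
    freeLift t (freeGen k G) = t (Quotient.mk _ G) :=
  freeLift_of t _

/-- A linear functional on the free algebra which respects the defining relations respects the
two-sided ideal generated by them. -/
lemma eq_of_mkAlgHom_eq (L : FreeGraphAlgebra k n →ₗ[k] k) (hL : ∀ x y, Rel Q x y → L x = L y)
    {x y : FreeGraphAlgebra k n} (h : RingQuot.mkAlgHom k (Rel Q) x = RingQuot.mkAlgHom k (Rel Q) y) :
    L x = L y := by
  -- This is the largest ring congruence that `L` respects: `L` detects no difference even after
  -- multiplication on both sides. Once it contains the relations, it contains the ideal generated
  -- by them.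
  let c : RingCon (FreeGraphAlgebra k n) :=
    { r := fun x y => ∀ a b, L (a * x * b) = L (a * y * b)
      iseqv := ⟨fun _ _ _ => rfl, fun h a b => (h a b).symm, fun h h' a b => (h a b).trans (h' a b)⟩
      mul' := fun {w x y z} h h' a b => by
        rw [← mul_assoc, mul_assoc (a * w), h, ← mul_assoc, h', ← mul_assoc]
      add' := fun {w x y z} h h' a b => by
        rw [mul_add, mul_add, add_mul, add_mul, map_add, map_add, h, h'] }
  -- By bilinearity the two factors may be taken to be graphs, and stacking with graphs turns
  -- relations into relations.
  have hc : ∀ x y, Rel Q x y → c x y := by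
    intro x y hxy a b
    induction a using freeGraphAlgebra_induction with
    | hadd a a' h h' => simp only [add_mul, map_add, h, h']
    | hsmul r a h => simp only [smul_mul_assoc, map_smul, h]
    | hgen G =>
      induction b using freeGraphAlgebra_induction with
      | hadd b b' h h' => simp only [mul_add, map_add, h, h']
      | hsmul r b h => simp only [mul_smul_comm, map_smul, h]
      | hgen H => exact hL _ _ ((hxy.mul_left G).mul_right H)
  let φ : RingQuot (Rel Q) →+* c.Quotient :=
    RingQuot.lift ⟨c.mk', fun x y hxy => (RingCon.eq c).2 (hc x y hxy)⟩
  have hφ : ∀ z, φ (RingQuot.mkAlgHom k (Rel Q) z) = c.mk' z := fun z => by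
    have h1 : RingQuot.mkAlgHom k (Rel Q) z = RingQuot.mkRingHom (Rel Q) z := by
      rw [← RingQuot.mkAlgHom_coe k]; rfl
    rw [h1]
    exact RingQuot.lift_mkRingHom_apply _ _ _
  have h1 : c.mk' x = c.mk' y := by rw [← hφ, ← hφ, h]
  have h2 : c x y := (RingCon.eq c).1 h1
  simpa using h2 1 1

/-- A function on graphs which is invariant under isotopy and which satisfies the defining relations
extends uniquely to a linear map on the chromatic algebra. -/
theorem existsUnique_linearMap (t : RectGraph n → k) (hiso : ∀ G H, G.IsIsotopic H → t G = t H)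
    (hcd : ∀ (G G₁ G₂ : RectGraph n) (e : Set Plane), G.IsInnerEdge e → ¬ G.IsLoop e →
      G.IsContraction e G₁ → G.IsDeletion e G₂ → t G = t G₁ - t G₂)
    (hloop : ∀ (G G₂ : RectGraph n) (e : Set Plane), G.IsInnerEdge e → G.IsLoop e →
      G.IsDeletion e G₂ → t G = (Q - 1) * t G₂)
    (hone : ∀ (G : RectGraph n), ∀ v ∈ G.verts, HasValence G.carrier v 1 → t G = 0) :
    ∃! L : ChromAlg Q n →ₗ[k] k, ∀ G, L (gen Q G) = t G := by
  let T : FreeGraphAlgebra k n →ₗ[k] k := freeLift (Quotient.lift t hiso)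
  have hT : ∀ G, T (freeGen k G) = t G := fun G => freeLift_freeGen _ G
  have hrel : ∀ x y, Rel Q x y → T x = T y := by
    intro x y hxy
    cases hxy with
    | contraction_deletion G G₁ G₂ e he hl h₁ h₂ =>
      rw [map_sub, hT, hT, hT, hcd G G₁ G₂ e he hl h₁ h₂]
    | loop G G₂ e he hl h₂ => rw [map_smul, hT, hT, smul_eq_mul, hloop G G₂ e he hl h₂]
    | one_valent G v hv hval => rw [map_zero, hT, hone G v hv hval]
  have hsurj := RingQuot.mkAlgHom_surjective k (Rel Q (n := n))
  let π : FreeGraphAlgebra k n →ₗ[k] ChromAlg Q n := (RingQuot.mkAlgHom k (Rel Q)).toLinearMap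
  -- The functional vanishes on the ideal, so it descends along the projection.
  have hker : LinearMap.ker π ≤ LinearMap.ker T := by
    intro x hx
    rw [LinearMap.mem_ker] at hx ⊢
    rw [← map_zero T]
    exact eq_of_mkAlgHom_eq T hrel (hx.trans (map_zero π).symm)
  let L : ChromAlg Q n →ₗ[k] k := (LinearMap.ker π).liftQ T hker ∘ₗ
    (π.quotKerEquivOfSurjective hsurj).symm.toLinearMap
  have hL : ∀ x, L (π x) = T x := fun x => by
    have : (π.quotKerEquivOfSurjective hsurj).symm (π x) = Submodule.Quotient.mk x := by
      rw [LinearEquiv.symm_apply_eq]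
      rfl
    change (LinearMap.ker π).liftQ T hker _ = _
    erw [this]
    rfl
  refine ⟨L, fun G => (hL (freeGen k G)).trans (hT G), ?_⟩
  intro L' hL'
  refine LinearMap.ext fun z => ?_
  obtain ⟨x, rfl⟩ := hsurj z
  induction x using freeGraphAlgebra_induction with
  | hadd x y h h' => rw [map_add, map_add, map_add, h, h']
  | hsmul r x h => rw [map_smul, map_smul, map_smul, h]
  | hgen G => exact (hL' G).trans ((hL (freeGen k G)).trans (hT G)).symm

end Lift

end ChromaticAlgebra

theorem mainTheorem9 (n : ℕ) :
    -- the dual graphs are finite, and their edges are exactly the edges of the given graph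
    (∀ G : ChromaticAlgebra.RectGraph n,
      (G.dual.vertexSet.Finite ∧ G.dual.edgeSet.Finite ∧ G.dual.edgeSet = G.edges) ∧
      (G.closureDual.vertexSet.Finite ∧ G.closureDual.edgeSet.Finite ∧
        G.closureDual.edgeSet = ChromaticAlgebra.edgesOf G.closureCarrier G.verts)) ∧
    -- the chromatic polynomial of the dual graph is a well-defined linear map on `C_n`
    (∃! χ : ChromaticAlgebra.ChromAlg (X : ℂ[X]) n →ₗ[ℂ[X]] ℂ[X],
      ∀ G : ChromaticAlgebra.RectGraph n,
        χ (ChromaticAlgebra.gen X G) = G.dual.chromaticPolynomial) ∧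
    -- relation (1) corresponds to contraction-deletion
    (∀ (G G₁ G₂ : ChromaticAlgebra.RectGraph n) (e : Set ChromaticAlgebra.Plane),
      G.IsInnerEdge e → ¬ G.IsLoop e → G.IsContraction e G₁ → G.IsDeletion e G₂ →
        G₁.dual.IsIsoTo (G.dual.deleteEdges {e}) ∧
        (∃ A B, G.dual.IsLink e A B ∧ G₂.dual.IsIsoTo (G.dual.contractEdge e A B)) ∧
        G.dual.chromaticPolynomial =
          G₁.dual.chromaticPolynomial - G₂.dual.chromaticPolynomial) ∧
    -- relation (2) corresponds to the removal of a pendant vertex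
    (∀ (G G₂ : ChromaticAlgebra.RectGraph n) (e : Set ChromaticAlgebra.Plane),
      G.IsInnerEdge e → G.IsLoop e → G.IsDeletion e G₂ →
        (∀ D ∈ G.dual.vertexSet, closure D ⊆ D ∪ closure e →
          (∃ A, A ≠ D ∧ G.dual.IsLink e A D) ∧ (∀ e' A, G.dual.IsLink e' A D → e' = e) ∧
          G₂.dual.IsIsoTo (G.dual.deleteVerts {D})) ∧
        G.dual.chromaticPolynomial = (X - 1) * G₂.dual.chromaticPolynomial) ∧
    -- relation (3) corresponds to the vanishing on graphs with loops
    (∀ (G : ChromaticAlgebra.RectGraph n) (v : ChromaticAlgebra.Plane),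
      v ∈ G.verts → ChromaticAlgebra.HasValence G.carrier v 1 →
        (∃ e A, v ∈ closure e ∧ G.dual.IsLoopAt e A) ∧ G.dual.chromaticPolynomial = 0) ∧
    -- the normalized trace is well defined, for an indeterminate `Q` ...
    (∃! tr : ChromaticAlgebra.ChromAlg (X : ℂ[X]) n →ₗ[ℂ[X]] ℂ[X],
      ∀ G : ChromaticAlgebra.RectGraph n,
        X * tr (ChromaticAlgebra.gen X G) = G.closureDual.chromaticPolynomial) ∧
    -- ... and for every nonzero complex number `Q`
    (∀ Q : ℂ, Q ≠ 0 → ∃! tr : ChromaticAlgebra.ChromAlg Q n →ₗ[ℂ] ℂ,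
      ∀ G : ChromaticAlgebra.RectGraph n,
        tr (ChromaticAlgebra.gen Q G) = Q⁻¹ * G.closureDual.chromaticPolynomial.eval Q) := by
  refine ⟨fun G => ⟨⟨G.tame.finite_regions, G.tame.edgeSet_finite, G.tame.edgeSet_dualOf⟩,
      G.tame_closure.finite_regions, G.tame_closure.edgeSet_finite,
      G.tame_closure.edgeSet_dualOf⟩,
    ChromaticAlgebra.existsUnique_linearMap (fun G => G.dual.chromaticPolynomial)
      (fun _ _ h => h.chromaticPolynomial_dual)
      (fun _ _ _ _ => ChromaticAlgebra.RectGraph.chromaticPolynomial_dual_contraction_deletion)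
      (fun _ _ _ => ChromaticAlgebra.RectGraph.chromaticPolynomial_dual_loop)
      (fun _ _ => ChromaticAlgebra.RectGraph.chromaticPolynomial_dual_one_valent),
    fun G G₁ G₂ e he hl h₁ h₂ => ⟨h₁.isIsoTo he hl, ?_,
      ChromaticAlgebra.RectGraph.chromaticPolynomial_dual_contraction_deletion he hl h₁ h₂⟩,
    fun G G₂ e he hl h₂ => ⟨fun D hD hcl => ?_,
      ChromaticAlgebra.RectGraph.chromaticPolynomial_dual_loop he hl h₂⟩,
    fun G v hv h => ⟨ChromaticAlgebra.RectGraph.exists_isLoopAt_dual hv h,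
      ChromaticAlgebra.RectGraph.chromaticPolynomial_dual_one_valent hv h⟩, ?_, fun Q hQ => ?_⟩
  · obtain ⟨A, B, hAB⟩ := G.tame.exists_isLink he.1
    exact ⟨A, B, hAB, h₂.dual_eq ▸ G.tame.isIsoTo_contractEdge hAB⟩
  · rw [h₂.dual_eq]
    exact G.tame.isPendant_of_closure_subset he.1 he.rect_mem_nhds he.isBounded hl
      he.twoSidedAt hD hcl
  -- The values of the trace are the quotients by `X`. Every identity required of them is checked
  -- after multiplication by `X`, which is injective on `ℂ[X]`.
  · choose t ht using fun G : ChromaticAlgebra.RectGraph n => G.X_dvd_closureDual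
    have hX : ∀ {p q : ℂ[X]}, X * p = X * q → p = q := fun h => mul_left_cancel₀ X_ne_zero h
    refine (existsUnique_congr fun L => forall_congr' fun G => ?_).1
      (ChromaticAlgebra.existsUnique_linearMap t (fun G H h => hX ?_)
        (fun G G₁ G₂ e he hl h₁ h₂ => hX ?_) (fun G G₂ e he hl h₂ => hX ?_)
        (fun G v hv h => hX ?_))
    · rw [ht]
      exact ⟨fun h => by rw [h], hX⟩
    · rw [← ht, ← ht, h.chromaticPolynomial_closureDual]
    · rw [mul_sub, ← ht, ← ht, ← ht]
      exact ChromaticAlgebra.RectGraph.chromaticPolynomial_closureDual_contraction_deletion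
        he hl h₁ h₂
    · rw [mul_left_comm, ← ht, ← ht]
      exact ChromaticAlgebra.RectGraph.chromaticPolynomial_closureDual_loop he hl h₂
    · rw [mul_zero, ← ht]
      exact ChromaticAlgebra.RectGraph.chromaticPolynomial_closureDual_one_valent hv h
  -- For a fixed number `Q` the polynomial identities are evaluated at `Q` and multiplied by `Q⁻¹`.
  · refine ChromaticAlgebra.existsUnique_linearMap
      (fun G => Q⁻¹ * G.closureDual.chromaticPolynomial.eval Q) (fun G H h => ?_)
      (fun G G₁ G₂ e he hl h₁ h₂ => ?_) (fun G G₂ e he hl h₂ => ?_) (fun G v hv h => ?_)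
    · simp only [h.chromaticPolynomial_closureDual]
    · rw [ChromaticAlgebra.RectGraph.chromaticPolynomial_closureDual_contraction_deletion
        he hl h₁ h₂, eval_sub, mul_sub]
    · rw [ChromaticAlgebra.RectGraph.chromaticPolynomial_closureDual_loop he hl h₂, eval_mul,
        eval_sub, eval_X, eval_one, mul_left_comm]
    · rw [ChromaticAlgebra.RectGraph.chromaticPolynomial_closureDual_one_valent hv h, eval_zero,
        mul_zero]

end
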